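/- Let $M$ be a compact Riemannian 3-manifold with smooth boundary (possibly empty), let $K$ be a compact connected Lie group with Lie algebra $\mathfrak k$, and fix an $\mathrm{Ad}\,K$-invariant inner product on $\mathfrak k$. For $\mathfrak k$-valued forms on $M$ let $\|\cdot\|_2$ and $\|\cdot\|_\infty$ be the usual norms (with $|\cdot|$ the Riemannian norm on $\Lambda^p\otimes\mathfrak k$), and let $W_1$ be the space of forms with finite norm $\|\omega\|_{W_1}^2=\int_M|\nabla\omega|^2\,d\mathrm{Vol}+\|\omega\|_2^2$, where $\nabla$ is the (weak) Riemannian gradient. For a $\mathfrak k$-valued 1-form $A$ let $B=dA+\tfrac12[A\wedge A]$ be its curvature, where $[A\wedge A]=\sum_{i,j}[A_i,A_j]\,dx^i\wedge dx^j$, and let $d_A^*=d^*+(\mathrm{ad}\,A\wedge)^*$, without boundary conditions. Let $0<T\le\infty$. A strong solution of the Yang–Mills heat equation on $[0,T)$ is a continuous function $A:[0,T)\to W_1$ with values in the $\mathfrak k$-valued 1-forms such that, with $B(t)$ the curvature of $A(t)$: (a) $B(t)\in W_1$ for each $t\in(0,T)$; (b) the strong $L^2(M)$ derivative $A'(t)$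 exists for each $t\in(0,T)$; (c) $A'(t)=-d_{A(t)}^*B(t)$ for each $t\in(0,T)$; (d) $\|B(t)\|_\infty$ is bounded on each bounded interval $[a,b)\subset(0,T)$; (e) $t^{3/4}\|B(t)\|_\infty$ is bounded on some interval $(0,b)\subset(0,T)$. At a boundary point with unit conormal $\nu$ a form is written uniquely as $\gamma=\gamma_{tan}+\gamma_{norm}$ with $\gamma_{norm}=\alpha\wedge\nu$, where $\alpha$ and $\gamma_{tan}$ are annihilated by contraction with the unit normal; for $W_1$ forms boundary values are meant in the sense of traces. **Theorem.** Let $A_1(\cdot)$ and $A_2(\cdot)$ be two strong solutions on $[0,T)$ with the same initial data $A_1(0)=A_2(0)\in W_1$, and let $B_1$, $B_2$ be their curvatures. Assume that either (N) $B_j(t)_{norm}=0$ for $j=1,2$ and all $t\in(0,T)$, or (D) $A_j(t)_{tan}=0$ for $j=1,2$ and all $t\in(0,T)$. Then $A_1(t)=A_2(t)$ for all $t\in[0,T)$. -/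

import Mathlib

open scoped Manifold ContDiff ENNReal NNReal Topology
open MeasureTheory

noncomputable section

namespace YangMillsHeat

/-- The Euclidean coordinate space in which the charts of a three-manifold with boundary live;
the charts take values in the half space `{y | 0 ≤ y 0}`. -/
abbrev E3 : Type := EuclideanSpace ℝ (Fin 3)

/-- The `i`-th standard basis vector of the coordinate space. -/
def stdVec (i : Fin 3) : E3 := EuclideanSpace.single i (1 : ℝ)

/-! ### The structure group and its Lie algebra -/

section LieAlgebraPart

variable {n : ℕ} {K : Type*} [TopologicalSpace K] [ChartedSpace (EuclideanSpace ℝ (Fin n)) K]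
  [Group K]

/-- A smooth Lie group has the (weaker) smoothness for which its Lie algebra is set up. -/
instance instLieGroupMinSmoothness [LieGroup (𝓡 n) ∞ K] :
    LieGroup (𝓡 n) (minSmoothness ℝ 3) K := by
  rw [minSmoothness_of_isRCLikeNormedField]
  infer_instance

/-- The adjoint action of `k` on the Lie algebra `T_1 K`: the derivative at the identity of the
conjugation `x ↦ k x k⁻¹`. -/
def adjointAction (k : K) (ξ : GroupLieAlgebra (𝓡 n) K) : GroupLieAlgebra (𝓡 n) K :=
  (mfderiv (𝓡 n) (𝓡 n) (fun x : K => k * x * k⁻¹) 1 : EuclideanSpace ℝ (Fin n) →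
    EuclideanSpace ℝ (Fin n)) ξ

variable (n K) in
/-- An `Ad K` invariant inner product on the Lie algebra of `K`. -/
structure AdInvariantInner where
  inner : GroupLieAlgebra (𝓡 n) K →ₗ[ℝ] GroupLieAlgebra (𝓡 n) K →ₗ[ℝ] ℝ
  symm : ∀ ξ η, inner ξ η = inner η ξ
  pos : ∀ ξ, ξ ≠ 0 → 0 < inner ξ ξ
  invariant : ∀ (k : K) (ξ η), inner (adjointAction k ξ) (adjointAction k η) = inner ξ η

end LieAlgebraPart

/-! ### The manifold: coordinate frames, metric coefficients, Riemannian volume -/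

section ManifoldPart

variable {M : Type*} [TopologicalSpace M] [ChartedSpace (EuclideanHalfSpace 3) M]
  [IsManifold (𝓡∂ 3) ∞ M]

/-- The range, in coordinates, of the preferred chart at `c`: a relatively open subset of the
half space `{y | 0 ≤ y 0}`. -/
def chartRange (c : M) : Set E3 := (extChartAt (𝓡∂ 3) c).target

/-- The point of the manifold with coordinates `y` in the chart at `c`. -/
def chartPoint (c : M) (y : E3) : M := (extChartAt (𝓡∂ 3) c).symm y

/-- The coordinate vector field `∂_i` of the chart at `c`, at the point `x` of its domain. -/
def frame (c x : M) (i : Fin 3) : TangentSpace (𝓡∂ 3) x :=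
  (tangentCoordChange (𝓡∂ 3) c x x (stdVec i) : E3)

variable (M) in
/-- Smooth Riemannian metrics on `M`. -/
abbrev SmoothMetric : Type _ :=
  Bundle.ContMDiffRiemannianMetric (𝓡∂ 3) ∞ E3 (fun x : M => TangentSpace (𝓡∂ 3) x)

/-- The matrix `g_ij = g(∂_i, ∂_j)` of the chart at `c`, at the point `x` of its domain. -/
def gram (g : SmoothMetric M) (c x : M) : Matrix (Fin 3) (Fin 3) ℝ :=
  Matrix.of fun i j => g.inner x (frame c x i) (frame c x j)

/-- The Riemannian volume of the domain of the chart at `c`, `√(det g_ij) dy`, transported to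
`M`. -/
def chartVolume [MeasurableSpace M] (g : SmoothMetric M) (c : M) : Measure M :=
  (((volume : Measure E3).restrict (chartRange c)).withDensity
    (fun y => ENNReal.ofReal (√(gram g c (chartPoint c y)).det))).map (chartPoint c)

/-- The Riemannian volume: the smallest measure which dominates the volume `√(det g_ij) dy` on
each chart domain. (The local volumes agree on overlaps, so this is the measure whose restriction
to each chart domain is the local volume.) -/
def vol [MeasurableSpace M] (g : SmoothMetric M) : Measure M := ⨆ c : M, chartVolume g c

/-- The Christoffel symbols `Γ^l_ij` of the Levi-Civita connection in the chart at `c`, at the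
point with coordinates `y`. -/
def christoffel (g : SmoothMetric M) (c : M) (l i j : Fin 3) (y : E3) : ℝ :=
  let G : Fin 3 → Fin 3 → E3 → ℝ := fun a b z => gram g c (chartPoint c z) a b
  let D : Fin 3 → Fin 3 → Fin 3 → ℝ := fun k a b =>
    fderivWithin ℝ (G a b) (chartRange c) y (stdVec k)
  (1 / 2) * ∑ m : Fin 3, (gram g c (chartPoint c y))⁻¹ l m * (D i m j + D j m i - D m i j)

end ManifoldPart

/-! ### Lie algebra valued forms -/

section Forms

variable (M : Type*) [TopologicalSpace M] [ChartedSpace (EuclideanHalfSpace 3) M]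
  (n : ℕ) (K : Type*) [TopologicalSpace K] [ChartedSpace (EuclideanSpace ℝ (Fin n)) K] [Group K]

/-- `𝔨`-valued `p`-forms on `M` (arbitrary sections, no regularity). -/
abbrev KForm (p : ℕ) : Type _ :=
  (x : M) → (TangentSpace (𝓡∂ 3) x) [⋀^Fin p]→ₗ[ℝ] GroupLieAlgebra (𝓡 n) K

/-- Sections of `T*M ⊗ Λ^p T*M ⊗ 𝔨`: the tensors in which covariant derivatives of `𝔨`-valued
`p`-forms take their values; the first slot is the direction of differentiation. -/
abbrev KTensor (p : ℕ) : Type _ :=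
  (x : M) → TangentSpace (𝓡∂ 3) x →ₗ[ℝ]
    (TangentSpace (𝓡∂ 3) x) [⋀^Fin p]→ₗ[ℝ] GroupLieAlgebra (𝓡 n) K

end Forms

variable {M : Type*} [TopologicalSpace M] [ChartedSpace (EuclideanHalfSpace 3) M]
  [IsManifold (𝓡∂ 3) ∞ M]
  {n : ℕ} {K : Type*} [TopologicalSpace K] [ChartedSpace (EuclideanSpace ℝ (Fin n)) K] [Group K]
  {p : ℕ}

/-- The component `θ_J = θ(∂_{J 0}, …, ∂_{J (p-1)})` of a form in the chart at `c`, as a function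
of the coordinates. The Lie algebra `T_1 K` is, as a vector space, the model space `ℝ^n`, which
supplies the topology used for measurability, integrals and smoothness of components. -/
def comp (θ : KForm M n K p) (c : M) (J : Fin p → Fin 3) (y : E3) : EuclideanSpace ℝ (Fin n) :=
  θ (chartPoint c y) (fun k => frame c (chartPoint c y) (J k))

/-- The component `N_{i;J}` of a tensor in the chart at `c`. -/
def tensorComp (N : KTensor M n K p) (c : M) (i : Fin 3) (J : Fin p → Fin 3) (y : E3) :
    EuclideanSpace ℝ (Fin n) :=
  N (chartPoint c y) (frame c (chartPoint c y) i) (fun k => frame c (chartPoint c y) (J k))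

/-- The inner product on `Λ^p T_x*M ⊗ 𝔨`, for which the `dx^{i_1} ∧ … ∧ dx^{i_p}`,
`i_1 < … < i_p`, are orthonormal if the `dx^i` are:
`⟨u, v⟩ = (1/p!) ∑ g^{i_1 j_1} ⋯ g^{i_p j_p} ⟨u_{i_1…i_p}, v_{j_1…j_p}⟩`. -/
def covInner (g : SmoothMetric M) (κ : AdInvariantInner n K) (x : M)
    (u v : (TangentSpace (𝓡∂ 3) x) [⋀^Fin p]→ₗ[ℝ] GroupLieAlgebra (𝓡 n) K) : ℝ :=
  (1 / (p.factorial : ℝ)) * ∑ I : Fin p → Fin 3, ∑ J : Fin p → Fin 3,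
    (∏ k, (gram g x x)⁻¹ (I k) (J k)) *
      κ.inner (u fun k => frame x x (I k)) (v fun k => frame x x (J k))

/-- The squared norm on `T_x*M ⊗ Λ^p T_x*M ⊗ 𝔨`. -/
def tensorNormSq (g : SmoothMetric M) (κ : AdInvariantInner n K) (x : M)
    (N : TangentSpace (𝓡∂ 3) x →ₗ[ℝ]
      (TangentSpace (𝓡∂ 3) x) [⋀^Fin p]→ₗ[ℝ] GroupLieAlgebra (𝓡 n) K) : ℝ :=
  ∑ i : Fin 3, ∑ j : Fin 3,
    (gram g x x)⁻¹ i j * covInner g κ x (N (frame x x i)) (N (frame x x j))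

/-! ### Lebesgue and Sobolev norms -/

section Norms

variable [MeasurableSpace M]

/-- The `L²` inner product `(θ, η)` of forms. -/
def l2Inner (g : SmoothMetric M) (κ : AdInvariantInner n K) (θ η : KForm M n K p) : ℝ :=
  ∫ x, covInner g κ x (θ x) (η x) ∂(vol g)

/-- `‖θ‖_2²`. -/
def l2NormSq (g : SmoothMetric M) (κ : AdInvariantInner n K) (θ : KForm M n K p) : ℝ≥0∞ :=
  ∫⁻ x, ENNReal.ofReal (covInner g κ x (θ x) (θ x)) ∂(vol g)

/-- `‖θ‖_∞`, the (essential) supremum of the pointwise norm. -/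
def supNorm (g : SmoothMetric M) (κ : AdInvariantInner n K) (θ : KForm M n K p) : ℝ≥0∞ :=
  essSup (fun x => ENNReal.ofReal (√(covInner g κ x (θ x) (θ x)))) (vol g)

/-- Measurable forms: all components in all charts are (Lebesgue) measurable. -/
def MeasurableForm (θ : KForm M n K p) : Prop :=
  ∀ (c : M) (J : Fin p → Fin 3),
    AEStronglyMeasurable (comp θ c J) ((volume : Measure E3).restrict (chartRange c))

/-- Square integrable forms. -/
def MemL2 (g : SmoothMetric M) (κ : AdInvariantInner n K) (θ : KForm M n K p) : Prop :=
  MeasurableForm θ ∧ l2NormSq g κ θ < ⊤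

/-- Real valued smooth functions with compact support in an open set of coordinates. -/
def IsTestFunction (U : Set E3) (φ : E3 → ℝ) : Prop :=
  ContDiff ℝ ∞ φ ∧ HasCompactSupport φ ∧ tsupport φ ⊆ U

/-- `f₁` is the weak partial derivative `∂_i f` in the open set `U`. -/
def IsWeakPartial (U : Set E3) (i : Fin 3) (f f₁ : E3 → EuclideanSpace ℝ (Fin n)) : Prop :=
  LocallyIntegrableOn f U ∧ LocallyIntegrableOn f₁ U ∧
    ∀ φ : E3 → ℝ, IsTestFunction U φ →
      ∫ y, (fderiv ℝ φ y (stdVec i)) • f y = - ∫ y, φ y • f₁ y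

/-- `N` is the weak Riemannian gradient `∇θ`: in every chart
`∂_i θ_J = (∇_i θ)_J + ∑_k Γ^l_{i J_k} θ_{J with J_k replaced by l}`, where `∂_i θ_J` is the weak
derivative of the component in the interior of the chart range. -/
def IsWeakGradient (g : SmoothMetric M) (θ : KForm M n K p) (N : KTensor M n K p) : Prop :=
  ∀ (c : M) (i : Fin 3) (J : Fin p → Fin 3),
    IsWeakPartial (interior (chartRange c)) i (comp θ c J)
      (fun y => tensorComp N c i J y + ∑ k : Fin p, ∑ l : Fin 3,
        christoffel g c l i (J k) y • comp θ c (Function.update J k l) y)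

/-- `‖θ‖_{W_1}² = ∫ |∇θ|² + ‖θ‖_2²`, and `∞` if there is no weak gradient. (The weak gradient is
unique up to null sets, so that the infimum is over equal numbers.) -/
def sobolevNormSq (g : SmoothMetric M) (κ : AdInvariantInner n K) (θ : KForm M n K p) : ℝ≥0∞ :=
  ⨅ (N : KTensor M n K p) (_ : IsWeakGradient g θ N),
    (∫⁻ x, ENNReal.ofReal (tensorNormSq g κ x (N x)) ∂(vol g)) + l2NormSq g κ θ

/-- The Sobolev space `W_1` of forms. -/
def MemW1 (g : SmoothMetric M) (κ : AdInvariantInner n K) (θ : KForm M n K p) : Prop :=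
  MeasurableForm θ ∧ sobolevNormSq g κ θ < ⊤

/-- Two forms are the same element of `L²` (or of `W_1`). -/
def SameForm (g : SmoothMetric M) (θ η : KForm M n K p) : Prop :=
  ∀ᵐ x ∂(vol g), θ x = η x

end Norms

/-! ### Exterior derivative, bracket, curvature, covariant coderivative -/

/-- `η` is the weak exterior derivative `dα` of the one-form `α`: in every chart
`η_ij = ∂_i α_j - ∂_j α_i` weakly in the interior of the chart range. -/
def IsExtDeriv (α : KForm M n K 1) (η : KForm M n K 2) : Prop :=
  ∀ (c : M) (i j : Fin 3),
    LocallyIntegrableOn (comp α c ![i]) (interior (chartRange c)) ∧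
    LocallyIntegrableOn (comp η c ![i, j]) (interior (chartRange c)) ∧
    ∀ φ : E3 → ℝ, IsTestFunction (interior (chartRange c)) φ →
      ∫ y, ((fderiv ℝ φ y (stdVec i)) • comp α c ![j] y
          - (fderiv ℝ φ y (stdVec j)) • comp α c ![i] y)
        = - ∫ y, φ y • comp η c ![i, j] y

/-- Updating the only entry of a vector of length one. -/
theorem upd {V : Type*} (a Z : V) : Function.update ![a] (0 : Fin 1) Z = ![Z] := by
  ext i
  fin_cases i
  simp

/-- `[u ∧ v] = ∑ [u_i, v_j] dx^i ∧ dx^j` for one-covectors `u`, `v`, that is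
`[u ∧ v](X, Y) = [u X, v Y] - [u Y, v X]`. -/
def bracketWedge [LieGroup (𝓡 n) ∞ K] {x : M}
    (u v : (TangentSpace (𝓡∂ 3) x) [⋀^Fin 1]→ₗ[ℝ] GroupLieAlgebra (𝓡 n) K) :
    (TangentSpace (𝓡∂ 3) x) [⋀^Fin 2]→ₗ[ℝ] GroupLieAlgebra (𝓡 n) K where
  toFun X := ⁅u ![X 0], v ![X 1]⁆ - ⁅u ![X 1], v ![X 0]⁆
  map_update_add' := by
    intro _ m i X Y
    have h : ∀ w : (TangentSpace (𝓡∂ 3) x) [⋀^Fin 1]→ₗ[ℝ] GroupLieAlgebra (𝓡 n) K,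
        w ![X + Y] = w ![X] + w ![Y] := fun w => by
      have := w.map_update_add ![0] 0 X Y
      simpa only [upd] using this
    fin_cases i <;> simp [h] <;> abel
  map_update_smul' := by
    intro _ m i c X
    have h : ∀ w : (TangentSpace (𝓡∂ 3) x) [⋀^Fin 1]→ₗ[ℝ] GroupLieAlgebra (𝓡 n) K,
        w ![c • X] = c • w ![X] := fun w => by
      have := w.map_update_smul ![0] 0 c X
      simpa only [upd] using this
    fin_cases i <;> simp [h, smul_sub]
  map_eq_zero_of_eq' := by
    intro X i j hX hij
    have h : X 0 = X 1 := by
      fin_cases i <;> fin_cases j <;> simp_all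
    rw [h, sub_self]

/-- `B` is the curvature `dA + (1/2)[A ∧ A]` of the connection form `A`. -/
def IsCurvature [LieGroup (𝓡 n) ∞ K] (A : KForm M n K 1) (B : KForm M n K 2) : Prop :=
  IsExtDeriv A (fun x => B x - (1 / 2 : ℝ) • bracketWedge (A x) (A x))

/-- Smooth forms with compact support in the interior of `M`. -/
def IsTestForm (φ : KForm M n K p) : Prop :=
  (∀ (c : M) (J : Fin p → Fin 3), ContDiffOn ℝ ∞ (comp φ c J) (chartRange c)) ∧
    ∃ S : Set M, IsCompact S ∧ S ⊆ (𝓡∂ 3).interior M ∧ ∀ x, x ∉ S → φ x = 0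

/-- The square integrable one-form `δ` is the coderivative `d*B` of the square integrable two-form
`B`, without boundary conditions: `(δ, φ) = (B, dφ)` for all smooth `φ` with compact support in
the interior of `M`. -/
def IsCoderiv [MeasurableSpace M] (g : SmoothMetric M) (κ : AdInvariantInner n K)
    (B : KForm M n K 2) (δ : KForm M n K 1) : Prop :=
  MemL2 g κ B ∧ MemL2 g κ δ ∧
    ∀ (φ : KForm M n K 1) (ψ : KForm M n K 2), IsTestForm φ → IsExtDeriv φ ψ →
      l2Inner g κ δ φ = l2Inner g κ B ψ

/-- The one-form `ι` is `(ad A ∧)* B`, the pointwise adjoint of `w ↦ [A ∧ w]` applied to `B`. -/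
def IsAdWedgeAdjoint [LieGroup (𝓡 n) ∞ K] (g : SmoothMetric M) (κ : AdInvariantInner n K)
    (A : KForm M n K 1) (B : KForm M n K 2) (ι : KForm M n K 1) : Prop :=
  ∀ (x : M) (w : (TangentSpace (𝓡∂ 3) x) [⋀^Fin 1]→ₗ[ℝ] GroupLieAlgebra (𝓡 n) K),
    covInner g κ x w (ι x) = covInner g κ x (bracketWedge (A x) w) (B x)

/-- `η = d_A* B = d* B + (ad A ∧)* B`. -/
def IsCovCoderiv [MeasurableSpace M] [LieGroup (𝓡 n) ∞ K] (g : SmoothMetric M)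
    (κ : AdInvariantInner n K) (A : KForm M n K 1) (B : KForm M n K 2) (η : KForm M n K 1) :
    Prop :=
  ∃ δ ι : KForm M n K 1, IsCoderiv g κ B δ ∧ IsAdWedgeAdjoint g κ A B ι ∧
    SameForm g η (δ + ι)

/-! ### Boundary values -/

/-- The projection `(y_0, y_1, y_2) ↦ (0, y_1, y_2)` to the boundary of the half space. -/
def toBoundary (y : E3) : E3 := y - (y 0) • stdVec 0

/-- In the chart at `c`, the function `f` of the coordinates has the boundary trace `γ` (a
function on the plane `{y | y 0 = 0}`): the averages of `|f - γ|` over the collars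
`{0 ≤ y 0 < ε}` tend to zero, locally uniformly along the boundary. For Sobolev functions this is
the usual trace. -/
def HasTrace (c : M) (f γ : E3 → EuclideanSpace ℝ (Fin n)) : Prop :=
  ∀ S : Set E3, IsCompact S → S ⊆ chartRange c →
    Filter.Tendsto
      (fun ε : ℝ => ENNReal.ofReal ε⁻¹ *
        ∫⁻ y in S ∩ {y | y 0 < ε}, ‖f y - γ (toBoundary y)‖ₑ)
      (𝓝[>] 0) (𝓝 0)

/-- `θ_tan = 0` on the boundary: in every chart the components of `θ` all of whose indices belong
to the directions `1, 2` tangential to the boundary `{y | y 0 = 0}` have trace zero. -/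
def TanZero (θ : KForm M n K p) : Prop :=
  ∀ (c : M) (J : Fin p → Fin 3), (∀ k, J k ≠ 0) → HasTrace c (comp θ c J) 0

/-- `θ_norm = 0` on the boundary: in every chart the contraction of `θ` with the vector field
`grad y_0 = ∑ g^{0j} ∂_j`, which at the boundary is normal to it, has trace zero. -/
def NormZero (g : SmoothMetric M) (θ : KForm M n K (p + 1)) : Prop :=
  ∀ (c : M) (J : Fin p → Fin 3),
    HasTrace c (fun y => ∑ j : Fin 3,
      (gram g c (chartPoint c y))⁻¹ 0 j • comp θ c (Fin.cons j J) y) 0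

/-! ### Strong solutions -/

/-- `A'` is the strong `L²` derivative of `A` at time `t`. -/
def HasL2Deriv [MeasurableSpace M] (g : SmoothMetric M) (κ : AdInvariantInner n K)
    (A : ℝ → KForm M n K 1) (A' : KForm M n K 1) (t : ℝ) : Prop :=
  MemL2 g κ A' ∧
    Filter.Tendsto (fun h : ℝ => l2NormSq g κ (h⁻¹ • (A (t + h) - A t) - A')) (𝓝[≠] 0) (𝓝 0)

/-- `A` is a strong solution of the Yang-Mills heat equation on `[0, T)`, with curvature `B`.
Only the values of `A` on `[0, T)` and of `B` on `(0, T)` matter. -/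
structure IsStrongSolution [MeasurableSpace M] [LieGroup (𝓡 n) ∞ K] (g : SmoothMetric M)
    (κ : AdInvariantInner n K) (T : EReal) (A : ℝ → KForm M n K 1) (B : ℝ → KForm M n K 2) :
    Prop where
  /-- `A` takes values in `W_1`. -/
  memW1 : ∀ t : ℝ, 0 ≤ t → (t : EReal) < T → MemW1 g κ (A t)
  /-- `A` is continuous into `W_1`. -/
  continuous : ∀ t : ℝ, 0 ≤ t → (t : EReal) < T →
    Filter.Tendsto (fun s => sobolevNormSq g κ (A s - A t))
      (𝓝[{s : ℝ | 0 ≤ s ∧ (s : EReal) < T}] t) (𝓝 0)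
  /-- `B t` is the curvature of `A t`. -/
  curvature : ∀ t : ℝ, 0 < t → (t : EReal) < T → IsCurvature (A t) (B t)
  /-- `B t` belongs to `W_1`. -/
  curvature_memW1 : ∀ t : ℝ, 0 < t → (t : EReal) < T → MemW1 g κ (B t)
  /-- The strong `L²` derivative `A'(t)` exists and equals `-d_{A(t)}* B(t)`. -/
  equation : ∀ t : ℝ, 0 < t → (t : EReal) < T →
    ∃ A' : KForm M n K 1, HasL2Deriv g κ A A' t ∧ IsCovCoderiv g κ (A t) (B t) (-A')
  /-- `‖B t‖_∞` is bounded on each bounded interval `[a, b) ⊂ (0, T)`. -/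
  bounded : ∀ a b : ℝ, 0 < a → (b : EReal) ≤ T →
    ∃ C : ℝ≥0, ∀ t ∈ Set.Ico a b, supNorm g κ (B t) ≤ C
  /-- `t^{3/4} ‖B t‖_∞` is bounded on some interval `(0, b) ⊂ (0, T)`. -/
  bounded_zero : ∃ b : ℝ, 0 < b ∧ (b : EReal) ≤ T ∧
    ∃ C : ℝ≥0, ∀ t ∈ Set.Ioo 0 b, ENNReal.ofReal (t ^ (3 / 4 : ℝ)) * supNorm g κ (B t) ≤ C

end YangMillsHeat

end

/-!
The two solutions are compared by the energy method. Put `D(t) = A₁(t) - A₂(t)` and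
`f(t) = ‖D(t)‖₂²`. Since `D` is strongly differentiable in `L²`, `f` is differentiable on `(0, T)`,
and the equation gives

  `f' = 2 (D', D) = -2 (d* B₁ + (ad A₁ ∧)* B₁, D) + 2 (d* B₂ + (ad A₂ ∧)* B₂, D)`.

The main point is Green's formula `(d* B_j, D) = (B_j, dD)` (`HasWeakPartials.green`): `d*` is only
defined by testing against forms with compact support in the interior, and the boundary term
vanishes because either the normal part of `B_j` or the tangential part of `D` has trace zero. With
it, and `dD = B₁ - B₂ - ½ [A₁ ∧ A₁] + ½ [A₂ ∧ A₂]`, the terms combine pointwise into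

  `f' = -2 ‖B₁ - B₂‖₂² - ∫ ⟨B₁ + B₂, [D ∧ D]⟩ ≤ C (‖B₁‖_∞ + ‖B₂‖_∞) f`

(`energyDensity_le`). As `‖B_j(t)‖_∞ = O(t^{-3/4})` near `0`, which is integrable, `f(0) = 0` forces
`f = 0` (`nonpos_of_deriv_le_rpow_mul`).

Green's formula is proved in charts. A smooth partition of unity reduces it to integration by parts
in the coordinate half space (`IsHalfSpaceCutoff.integral_greenIntegrand`), where a collar of width
`ε` at the boundary is cut off by a function of `y 0 / ε`; the remaining form has support in the
interior, and is mollified so as to become an admissible test form. The gradient of the cutoff is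
of size `1 / ε` on a set of measure of order `ε`, and it pairs the normal components of `B_j` with
the tangential components of `D`. If the latter have trace zero, the boundedness of `B_j` makes this
term tend to zero. If the former have, Young's inequality bounds it by a small multiple of the
collar averages of `|D|²`, which stay bounded since `D` has weak derivatives in `L²`, and a large
multiple of the collar averages of `|B_j|`, which tend to zero.
-/

open scoped Manifold ContDiff ENNReal NNReal Topology
open MeasureTheory

set_option linter.unusedSectionVars false

noncomputable section

namespace YangMillsHeat

/-! ### Mollification of square integrable functions -/

/-- The correlation of two square integrable functions is continuous at the origin, because
translations act continuously on `L²`. -/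
theorem tendsto_correlation {h f : E3 → ℝ} (hh : MemLp h 2 volume) (hf : MemLp f 2 volume) :
    Filter.Tendsto (fun z : E3 => ∫ y, h y * f (y - z)) (𝓝 0) (𝓝 (∫ y, h y * f y)) := by
  let T : C(E3, C(E3, E3)) := ContinuousMap.curry ⟨fun p : E3 × E3 => p.2 - p.1, by fun_prop⟩
  have hT : ∀ z, MeasurePreserving (T z) (volume : Measure E3) volume := fun z =>
    measurePreserving_sub_right volume z
  have hc : Continuous fun z => Lp.compMeasurePreserving (T z) (hT z) (hf.toLp f) :=
    continuous_const.compMeasurePreservingLp T.continuous hT (by simp)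
  have hi : Continuous fun z =>
      inner ℝ (hh.toLp h) (Lp.compMeasurePreserving (T z) (hT z) (hf.toLp f)) :=
    continuous_const.inner hc
  have key : ∀ z, inner ℝ (hh.toLp h) (Lp.compMeasurePreserving (T z) (hT z) (hf.toLp f))
      = ∫ y, h y * f (y - z) := by
    intro z
    rw [L2.inner_def]
    apply integral_congr_ae
    have h1 := hh.coeFn_toLp
    have h2 := Lp.coeFn_compMeasurePreserving (hf.toLp f) (hT z)
    have h3 := (hT z).quasiMeasurePreserving.ae_eq_comp hf.coeFn_toLp
    filter_upwards [h1, h2, h3] with y e1 e2 e3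
    rw [e1, e2, e3]
    simp [T, mul_comm]
  have := hi.tendsto 0
  simp only [key] at this
  simpa using this

/-- Mollifications by kernels concentrating at the origin converge weakly in `L²`. -/
theorem tendsto_integral_mul_convolution {h f : E3 → ℝ} (hh : MemLp h 2 volume)
    (hf : MemLp f 2 volume) (φ : ℕ → ContDiffBump (0 : E3))
    (hφ : Filter.Tendsto (fun k => (φ k).rOut) Filter.atTop (𝓝 0)) :
    Filter.Tendsto
      (fun k => ∫ y, h y * convolution ((φ k).normed volume) f (ContinuousLinearMap.mul ℝ ℝ)
        volume y)
      Filter.atTop (𝓝 (∫ y, h y * f y)) := by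
  -- By Fubini the pairing is the average over the kernel of the correlation of `h` and `f`, which is
  -- continuous at the origin. The domination uses `|h f| ≤ h² + f²`.
  have swap : ∀ k, ∫ y, h y * convolution ((φ k).normed volume) f (ContinuousLinearMap.mul ℝ ℝ)
        volume y = ∫ z, (φ k).normed volume z * ∫ y, h y * f (y - z) := by
    intro k
    set ρ := (φ k).normed (volume : Measure E3)
    have hρ : Integrable ρ volume := (φ k).integrable_normed
    have hρ0 : ∀ z, 0 ≤ ρ z := (φ k).nonneg_normed
    have i1 : Integrable (fun p : E3 × E3 => h p.1 ^ 2 * ρ p.2)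
        ((volume : Measure E3).prod volume) := hh.integrable_sq.mul_prod hρ
    have i2 : Integrable (fun p : E3 × E3 => ρ p.2 * f (p.1 - p.2) ^ 2)
        ((volume : Measure E3).prod volume) := by
      simpa using Integrable.convolution_integrand (ContinuousLinearMap.mul ℝ ℝ) hρ
        hf.integrable_sq
    have i3 : Integrable (fun p : E3 × E3 => h p.1 * (ρ p.2 * f (p.1 - p.2)))
        ((volume : Measure E3).prod volume) := by
      refine Integrable.mono' (i1.add i2) ?_ ?_
      · have m1 : AEStronglyMeasurable (fun p : E3 × E3 => h p.1)
            ((volume : Measure E3).prod volume) := hh.1.comp_fst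
        have m2 := AEStronglyMeasurable.convolution_integrand (ContinuousLinearMap.mul ℝ ℝ)
          (μ := volume) hρ.1 hf.1
        exact m1.mul (by simpa using m2)
      · refine Filter.Eventually.of_forall fun p => ?_
        simp only [Pi.add_apply, Real.norm_eq_abs, abs_mul, abs_of_nonneg (hρ0 p.2)]
        have := hρ0 p.2
        have h3 : |h p.1| * |f (p.1 - p.2)| ≤ h p.1 ^ 2 + f (p.1 - p.2) ^ 2 := by
          nlinarith [sq_abs (h p.1), sq_abs (f (p.1 - p.2)),
            sq_nonneg (|h p.1| - |f (p.1 - p.2)|), sq_nonneg (|h p.1|), sq_nonneg (|f (p.1 - p.2)|)]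
        nlinarith
    calc _ = ∫ y, ∫ z, h y * (ρ z * f (y - z)) := by
          congr 1; ext y
          rw [integral_const_mul]
          rfl
      _ = ∫ z, ∫ y, h y * (ρ z * f (y - z)) := integral_integral_swap i3
      _ = _ := by
          congr 1; ext z
          rw [← integral_const_mul]
          congr 1; ext y; ring
  simp only [swap]
  have hc := tendsto_correlation hh hf
  set G : E3 → ℝ := fun z => ∫ y, h y * f (y - z) with hG
  set L := ∫ y, h y * f y
  have hGm : AEStronglyMeasurable G volume := by
    have m1 : AEStronglyMeasurable (fun p : E3 × E3 => h p.1 * f (p.1 - p.2))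
        ((volume : Measure E3).prod volume) := by
      have m2 := AEStronglyMeasurable.convolution_integrand (ContinuousLinearMap.mul ℝ ℝ)
          (μ := (volume : Measure E3)) (f := fun _ => (1 : ℝ)) (ν := volume)
          aestronglyMeasurable_const hf.1
      exact hh.1.comp_fst.mul (by simpa using m2)
    exact m1.prod_swap.integral_prod_right'
  rw [Metric.tendsto_atTop]
  intro ε hε
  obtain ⟨δ, hδ, hGδ⟩ := Metric.tendsto_nhds_nhds.1 hc (ε / 2) (by positivity)
  obtain ⟨N, hN⟩ := (Metric.tendsto_atTop.1 hφ) δ hδ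
  refine ⟨N, fun k hk => ?_⟩
  have hr : (φ k).rOut < δ := by
    have := hN k hk
    rw [Real.dist_eq, sub_zero, abs_of_pos (φ k).rOut_pos] at this
    exact this
  have := dist_convolution_le (μ := (volume : Measure E3)) (f := (φ k).normed volume)
    (g := fun z => G (-z)) (x₀ := 0) (R := (φ k).rOut) (ε := ε / 2) (z₀ := L) (by positivity)
    (φ k).support_normed_eq.subset (φ k).nonneg_normed (φ k).integral_normed
    (by
      exact hGm.comp_quasiMeasurePreserving
        (Measure.measurePreserving_neg (volume : Measure E3)).quasiMeasurePreserving)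
    (by
      intro x hx
      refine (hGδ ?_).le
      rw [Metric.mem_ball, dist_zero_right] at hx
      rw [dist_zero_right, norm_neg]
      exact hx.trans hr)
  have e : convolution ((φ k).normed volume) (fun z => G (-z)) (ContinuousLinearMap.lsmul ℝ ℝ)
      volume 0 = ∫ z, (φ k).normed volume z * G z := by
    simp [convolution_def]
  rw [e] at this
  linarith

/-! ### The product rule for weak derivatives -/

/-- `f₁` is the weak partial derivative `∂_i f` of the real valued function `f` in `U`. -/
def IsWeakDeriv (U : Set E3) (i : Fin 3) (f f₁ : E3 → ℝ) : Prop :=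
  ∀ φ : E3 → ℝ, IsTestFunction U φ →
    ∫ y, fderiv ℝ φ y (stdVec i) * f y = - ∫ y, φ y * f₁ y

/-- The vector field `b` has the weak divergence `-d` in `U`. -/
def HasWeakCodiv (U : Set E3) (b : Fin 3 → E3 → ℝ) (d : E3 → ℝ) : Prop :=
  ∀ φ : E3 → ℝ, IsTestFunction U φ →
    ∫ y, ∑ i, b i y * fderiv ℝ φ y (stdVec i) = ∫ y, d y * φ y

/-- Square integrability on all compact subsets of `R`. If `R` contains part of its boundary, this
controls the function up to that part. -/
def L2On (R : Set E3) (f : E3 → ℝ) : Prop :=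
  ∀ S : Set E3, IsCompact S → S ⊆ R → MemLp f 2 (volume.restrict S)

theorem L2On.mono {R R' : Set E3} {f : E3 → ℝ} (hf : L2On R f) (h : R' ⊆ R) : L2On R' f :=
  fun S hS hSR => hf S hS (hSR.trans h)

/-- Weak derivatives commute with mollification at points whose `φ.rOut`-ball lies in the set `K` on
which the function is known. -/
theorem fderiv_convolution_indicator {U K : Set E3} (hK : IsCompact K) (hKU : K ⊆ U) {i : Fin 3}
    {a a₁ : E3 → ℝ} (ha : MemLp a 2 (volume.restrict K)) (hw : IsWeakDeriv U i a a₁)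
    (φ : ContDiffBump (0 : E3)) {y : E3} (hy : Metric.closedBall y φ.rOut ⊆ K) :
    fderiv ℝ (convolution (φ.normed volume) (K.indicator a) (ContinuousLinearMap.mul ℝ ℝ) volume) y
      (stdVec i)
      = convolution (φ.normed volume) (K.indicator a₁) (ContinuousLinearMap.mul ℝ ℝ) volume y := by
  set ρ := φ.normed (volume : Measure E3) with hρ
  have hρs : ContDiff ℝ ∞ ρ := φ.contDiff_normed
  have hρc : HasCompactSupport ρ := φ.hasCompactSupport_normed
  have : IsFiniteMeasure ((volume : Measure E3).restrict K) := ⟨by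
    simpa using hK.measure_lt_top⟩
  have hai : Integrable (K.indicator a) volume :=
    (integrable_indicator_iff hK.measurableSet).2 (ha.integrable (by norm_num))
  rw [(hρc.hasFDerivAt_convolution_left (ContinuousLinearMap.mul ℝ ℝ)
    (hρs.of_le (by exact_mod_cast le_top)) hai.locallyIntegrable y).fderiv]
  have hex : ConvolutionExists (fderiv ℝ ρ) (K.indicator a)
      ((ContinuousLinearMap.mul ℝ ℝ).precompL E3) volume :=
    (hρc.fderiv ℝ).convolutionExists_left _ (hρs.continuous_fderiv (by simp)) hai.locallyIntegrable
  have e1 : (convolution (fderiv ℝ ρ) (K.indicator a) ((ContinuousLinearMap.mul ℝ ℝ).precompL E3)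
      volume y) (stdVec i) = ∫ z, fderiv ℝ ρ (y - z) (stdVec i) * K.indicator a z := by
    rw [convolution_eq_swap, ContinuousLinearMap.integral_apply]
    · simp [ContinuousLinearMap.precompL_apply]
    · exact (hex y).integrable_swap
  have e2 : convolution ρ (K.indicator a₁) (ContinuousLinearMap.mul ℝ ℝ) volume y
      = ∫ z, ρ (y - z) * K.indicator a₁ z := by
    rw [convolution_eq_swap]; simp
  -- the translated and reflected kernel is an admissible test function
  have hd : ∀ z, HasFDerivAt (fun z => ρ (y - z)) (-(fderiv ℝ ρ (y - z))) z := by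
    intro z
    have h1 : HasFDerivAt ρ (fderiv ℝ ρ (y - z)) (y - z) :=
      (hρs.differentiable (by simp)).differentiableAt.hasFDerivAt
    have h2 : HasFDerivAt (fun z : E3 => y - z) (-ContinuousLinearMap.id ℝ E3) z := by
      simpa using (hasFDerivAt_id z).const_sub y
    refine (h1.comp z h2).congr_fderiv ?_
    ext v; simp
  have hsub : tsupport (fun z => ρ (y - z)) ⊆ K := by
    refine (closure_minimal ?_ Metric.isClosed_closedBall).trans hy
    intro z hz
    have : y - z ∈ Function.support ρ := hz
    rw [hρ, φ.support_normed_eq, Metric.mem_ball, dist_zero_right] at this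
    rw [Metric.mem_closedBall, dist_comm, dist_eq_norm]
    exact this.le
  have hz : ∀ z, z ∉ K → ρ (y - z) = 0 := by
    intro z hzK
    by_contra h
    exact hzK (hsub (subset_tsupport _ h))
  have hz' : ∀ z, z ∉ K → fderiv ℝ ρ (y - z) = 0 := by
    intro z hzK
    have h0 : fderiv ℝ (fun z => ρ (y - z)) z = 0 := by
      apply image_eq_zero_of_notMem_tsupport
      exact fun h => hzK (hsub (tsupport_fderiv_subset ℝ h))
    rw [(hd z).fderiv] at h0
    simpa using h0
  have ht : IsTestFunction U (fun z => ρ (y - z)) := by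
    refine ⟨hρs.comp (contDiff_const.sub contDiff_id), ?_, hsub.trans hKU⟩
    exact HasCompactSupport.intro hK hz
  have := hw _ ht
  rw [e1, e2]
  calc ∫ z, fderiv ℝ ρ (y - z) (stdVec i) * K.indicator a z
      = - ∫ z, fderiv ℝ (fun z => ρ (y - z)) z (stdVec i) * a z := by
        rw [← integral_neg]
        congr 1; ext z
        rw [(hd z).fderiv]
        by_cases hzK : z ∈ K
        · simp [hzK]
        · simp [hzK, hz' z hzK]
    _ = ∫ z, ρ (y - z) * a₁ z := by rw [this, neg_neg]
    _ = _ := by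
        congr 1; ext z
        by_cases hzK : z ∈ K
        · simp [hzK]
        · simp [hzK, hz z hzK]

/-- Multiplication by a continuous function vanishing off `K` extends a square integrable function
on `K` to one on the whole space. -/
theorem MemLp.mul_bounded_of_zero {K : Set E3} (hK : IsCompact K) {f g : E3 → ℝ}
    (hf : MemLp f 2 (volume.restrict K)) (hg : Continuous g) (h0 : ∀ y, y ∉ K → g y = 0) :
    MemLp (fun y => f y * g y) 2 volume := by
  obtain ⟨C, hC⟩ := hK.exists_bound_of_continuousOn hg.continuousOn
  have h1 : MemLp (fun y => g y * f y) 2 (volume.restrict K) := by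
    refine MemLp.of_le_mul (c := C) hf (hg.aestronglyMeasurable.mul hf.1) ?_
    filter_upwards [ae_restrict_mem hK.measurableSet] with y hy
    rw [norm_mul]
    gcongr
    exact hC y hy
  have := (memLp_indicator_iff_restrict hK.measurableSet).2 h1
  refine this.ae_eq (Filter.Eventually.of_forall fun y => ?_)
  by_cases hy : y ∈ K
  · simp [hy, mul_comm]
  · simp [hy, h0 y hy]

theorem integrable_mul_of_memLp_of_continuous {K : Set E3} (hK : IsCompact K) {f g : E3 → ℝ}
    (hf : MemLp f 2 volume) (h0 : ∀ y, y ∉ K → f y = 0) (hg : Continuous g) :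
    Integrable (fun y => f y * g y) volume := by
  have : IsFiniteMeasure ((volume : Measure E3).restrict K) := ⟨by
    simpa using hK.measure_lt_top⟩
  have h1 : IntegrableOn f K volume := (hf.restrict K).integrable (by norm_num)
  have h2 := h1.mul_continuousOn hg.continuousOn hK
  refine ((integrable_indicator_iff hK.measurableSet).2 h2).congr
    (Filter.Eventually.of_forall fun y => ?_)
  by_cases hy : y ∈ K
  · simp [hy]
  · simp [hy, h0 y hy]

/-- The weak product rule `div (a b) = ⟨b, ∇a⟩ - d a` for a field `b` of weak divergence `-d`,
tested against `χ`. It follows by testing the divergence of `b` against `χ` times a mollification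
of `a`. -/
theorem HasWeakCodiv.integral_product_rule {U : Set E3} (hU : IsOpen U) {χ : E3 → ℝ}
    (hχ : IsTestFunction U χ)
    {a d : E3 → ℝ} {a₁ b : Fin 3 → E3 → ℝ} (ha : L2On U a) (ha₁ : ∀ i, L2On U (a₁ i))
    (hb : ∀ i, L2On U (b i)) (hd : L2On U d) (hw : ∀ i, IsWeakDeriv U i a (a₁ i))
    (hbd : HasWeakCodiv U b d) :
    ∑ i, ((∫ y, b i y * fderiv ℝ χ y (stdVec i) * a y) + ∫ y, b i y * χ y * a₁ i y)
      = ∫ y, d y * χ y * a y := by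
  obtain ⟨hχs, hχc, hχU⟩ := hχ
  -- `K` is a compact neighbourhood of the support of `χ`, and mollification at scale at most `δ` at
  -- points of the support does not leave it; so the functions may be cut off outside `K`.
  obtain ⟨K, hK, hχK, hKU⟩ := exists_compact_between hχc.isCompact hU hχU
  obtain ⟨δ, hδ, hδK⟩ := hχc.isCompact.exists_cthickening_subset_open isOpen_interior hχK
  have hχ0 : ∀ y, y ∉ K → χ y = 0 := fun y hy =>
    image_eq_zero_of_notMem_tsupport fun h => hy (interior_subset (hχK h))
  have hχ0' : ∀ i, ∀ y, y ∉ K → fderiv ℝ χ y (stdVec i) = 0 := fun i y hy => by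
    rw [image_eq_zero_of_notMem_tsupport
      (fun h => hy (interior_subset (hχK (tsupport_fderiv_subset ℝ h))))]
    rfl
  have hdχ : ∀ i, Continuous fun y => fderiv ℝ χ y (stdVec i) := fun i =>
    (hχs.continuous_fderiv (by simp)).clm_apply continuous_const
  let φ : ℕ → ContDiffBump (0 : E3) := fun k =>
    ⟨δ / (k + 1) / 2, δ / (k + 1), by positivity, half_lt_self (by positivity)⟩
  have hφle : ∀ k, (φ k).rOut ≤ δ := fun k => div_le_self hδ.le (by simp)
  have hφ : Filter.Tendsto (fun k => (φ k).rOut) Filter.atTop (𝓝 0) := by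
    have := (tendsto_one_div_add_atTop_nhds_zero_nat (𝕜 := ℝ)).const_mul δ
    simpa [φ, div_eq_mul_inv] using this
  set m : (E3 → ℝ) → ℕ → E3 → ℝ := fun f k =>
    convolution ((φ k).normed volume) (K.indicator f) (ContinuousLinearMap.mul ℝ ℝ) volume with hm
  have hind : ∀ {f : E3 → ℝ}, L2On U f → MemLp (K.indicator f) 2 volume := fun hf =>
    (memLp_indicator_iff_restrict hK.measurableSet).2 (hf K hK hKU)
  have hli : ∀ {f : E3 → ℝ}, L2On U f → LocallyIntegrable (K.indicator f) volume := fun hf =>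
    (hind hf).locallyIntegrable (by norm_num)
  have hms : ∀ k, ContDiff ℝ ∞ (m a k) := fun k =>
    (φ k).hasCompactSupport_normed.contDiff_convolution_left (n := ⊤) _ (φ k).contDiff_normed (hli ha)
  have hmc : ∀ {f : E3 → ℝ}, L2On U f → ∀ k, Continuous (m f k) := fun hf k =>
    (φ k).hasCompactSupport_normed.continuous_convolution_left _ (φ k).continuous_normed (hli hf)
  have hlim : ∀ {f h : E3 → ℝ}, L2On U f → MemLp h 2 volume → (∀ y, y ∉ K → h y = 0) →
      Filter.Tendsto (fun k => ∫ y, h y * m f k y) Filter.atTop (𝓝 (∫ y, h y * f y)) := by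
    intro f h hf hh h0
    have := tendsto_integral_mul_convolution hh (hind hf) φ hφ
    convert this using 3 with y
    ext y
    by_cases hy : y ∈ K
    · simp [hy]
    · simp [hy, h0 y hy]
  have M1 : ∀ i, MemLp (fun y => b i y * fderiv ℝ χ y (stdVec i)) 2 volume := fun i =>
    MemLp.mul_bounded_of_zero hK (hb i K hK hKU) (hdχ i) (hχ0' i)
  have M2 : ∀ i, MemLp (fun y => b i y * χ y) 2 volume := fun i =>
    MemLp.mul_bounded_of_zero hK (hb i K hK hKU) hχs.continuous hχ0
  have M3 : MemLp (fun y => d y * χ y) 2 volume :=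
    MemLp.mul_bounded_of_zero hK (hd K hK hKU) hχs.continuous hχ0
  have Z1 : ∀ i, ∀ y, y ∉ K → b i y * fderiv ℝ χ y (stdVec i) = 0 := fun i y hy => by
    rw [hχ0' i y hy, mul_zero]
  have Z2 : ∀ i, ∀ y, y ∉ K → b i y * χ y = 0 := fun i y hy => by rw [hχ0 y hy, mul_zero]
  have Z3 : ∀ y, y ∉ K → d y * χ y = 0 := fun y hy => by rw [hχ0 y hy, mul_zero]
  -- the claim for the mollification `m a k` of `a`: test the divergence against `χ (m a k)`
  have hk : ∀ k, ∑ i, ((∫ y, b i y * fderiv ℝ χ y (stdVec i) * m a k y)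
      + ∫ y, b i y * χ y * m (a₁ i) k y) = ∫ y, d y * χ y * m a k y := by
    intro k
    have ht : IsTestFunction U (fun y => χ y * m a k y) :=
      ⟨hχs.mul (hms k), hχc.mul_right, (tsupport_mul_subset_left).trans hχU⟩
    have hder : ∀ i y, fderiv ℝ (fun y => χ y * m a k y) y (stdVec i)
        = fderiv ℝ χ y (stdVec i) * m a k y + χ y * m (a₁ i) k y := by
      intro i y
      have h1 : HasFDerivAt χ (fderiv ℝ χ y) y :=
        (hχs.differentiable (by simp)).differentiableAt.hasFDerivAt
      have h2 : HasFDerivAt (m a k) (fderiv ℝ (m a k) y) y :=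
        ((hms k).differentiable (by simp)).differentiableAt.hasFDerivAt
      rw [show (fun y => χ y * m a k y) = χ * m a k from rfl, (h1.mul h2).fderiv]
      by_cases hy : y ∈ tsupport χ
      · have : fderiv ℝ (m a k) y (stdVec i) = m (a₁ i) k y := by
          apply fderiv_convolution_indicator hK hKU (ha K hK hKU) (hw i)
          refine Set.Subset.trans ?_ (hδK.trans interior_subset)
          exact (Metric.closedBall_subset_closedBall (hφle k)).trans
            (Metric.closedBall_subset_cthickening hy δ)
        simp [this]; ring
      · have : χ y = 0 := image_eq_zero_of_notMem_tsupport hy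
        simp [this]; ring
    have := hbd _ ht
    simp only [hder] at this
    rw [integral_finsetSum] at this
    · calc _ = ∑ i, ∫ y, b i y * (fderiv ℝ χ y (stdVec i) * m a k y + χ y * m (a₁ i) k y) := by
            refine Finset.sum_congr rfl fun i _ => ?_
            rw [← integral_add]
            · congr 1; ext y; ring
            · exact integrable_mul_of_memLp_of_continuous hK (M1 i) (Z1 i) (hmc ha k)
            · exact integrable_mul_of_memLp_of_continuous hK (M2 i) (Z2 i) (hmc (ha₁ i) k)
        _ = _ := by
            rw [this]
            congr 1; ext y; ring
    · intro i _
      have := (integrable_mul_of_memLp_of_continuous hK (M1 i) (Z1 i) (hmc ha k)).add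
        (integrable_mul_of_memLp_of_continuous hK (M2 i) (Z2 i) (hmc (ha₁ i) k))
      refine this.congr (Filter.Eventually.of_forall fun y => ?_)
      simp only [Pi.add_apply]; ring
  have hL : Filter.Tendsto (fun k => ∑ i, ((∫ y, b i y * fderiv ℝ χ y (stdVec i) * m a k y)
      + ∫ y, b i y * χ y * m (a₁ i) k y)) Filter.atTop
      (𝓝 (∑ i, ((∫ y, b i y * fderiv ℝ χ y (stdVec i) * a y) + ∫ y, b i y * χ y * a₁ i y))) :=
    tendsto_finsetSum _ fun i _ => (hlim ha (M1 i) (Z1 i)).add (hlim (ha₁ i) (M2 i) (Z2 i))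
  have hR := hlim ha M3 Z3
  simp only [hk] at hL
  exact tendsto_nhds_unique hL hR

/-! ### Integration by parts in the half space -/

/-- `χ` is a cutoff function in the relatively open subset `R` of the half space `{0 ≤ y 0}`, with
support in the compact set `S`, smooth in the interior and with bounded derivatives there. The
support may touch the boundary `{y 0 = 0}`. -/
structure IsHalfSpaceCutoff (R S : Set E3) (χ : E3 → ℝ) : Prop where
  coord_nonneg : ∀ y ∈ R, 0 ≤ y 0
  mem_interior : ∀ y ∈ R, 0 < y 0 → y ∈ interior R
  isCompact : IsCompact S
  subset : S ⊆ R
  eq_zero : ∀ y, y ∉ S → χ y = 0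
  smooth : ContDiffOn ℝ ∞ χ (interior R)
  nonneg : ∀ y, 0 ≤ χ y
  le_one : ∀ y, χ y ≤ 1
  deriv_bounded : ∃ C : ℝ, ∀ y ∈ interior R, ∀ i, |fderiv ℝ χ y (stdVec i)| ≤ C

/-- The cutoff near the boundary: it vanishes for `y 0 ≤ ε` and equals `1` for `2 ε ≤ y 0`. -/
def collarCutoff (ε : ℝ) (y : E3) : ℝ := Real.smoothTransition (y 0 / ε - 1)

/-- The normal derivative of `collarCutoff`. -/
def collarWeight (ε : ℝ) (y : E3) : ℝ := deriv Real.smoothTransition (y 0 / ε - 1) / ε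

theorem collarCutoff_contDiff (ε : ℝ) : ContDiff ℝ ∞ (collarCutoff ε) := by
  unfold collarCutoff
  refine Real.smoothTransition.contDiff.comp ?_
  fun_prop

theorem fderiv_collarCutoff (ε : ℝ) (y : E3) (i : Fin 3) :
    fderiv ℝ (collarCutoff ε) y (stdVec i) = if i = 0 then collarWeight ε y else 0 := by
  have h1 : HasDerivAt Real.smoothTransition (deriv Real.smoothTransition (y 0 / ε - 1))
      (y 0 / ε - 1) :=
    ((Real.smoothTransition.contDiff (n := 1)).differentiable (by simp)).differentiableAt.hasDerivAt
  have h2 : HasFDerivAt (fun y : E3 => y 0 / ε - 1)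
      (ε⁻¹ • (EuclideanSpace.proj (0 : Fin 3) : E3 →L[ℝ] ℝ)) y := by
    have := ((EuclideanSpace.proj (0 : Fin 3) : E3 →L[ℝ] ℝ).hasFDerivAt (x := y)).const_smul ε⁻¹
    have := this.sub_const 1
    refine this.congr_of_eventuallyEq (Filter.Eventually.of_forall fun z => ?_)
    simp [div_eq_inv_mul]
  have h3 : HasFDerivAt (collarCutoff ε) _ y := h1.comp_hasFDerivAt y h2
  rw [h3.fderiv]
  by_cases hi : i = 0
  · subst hi
    simp [stdVec, collarWeight, div_eq_mul_inv]
  · simp [stdVec, hi, Ne.symm hi]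

theorem deriv_smoothTransition_eq_zero {x : ℝ} (hx : x ≤ 0 ∨ 1 ≤ x) :
    deriv Real.smoothTransition x = 0 := by
  have hc : Continuous (deriv Real.smoothTransition) :=
    (Real.smoothTransition.contDiff (n := 1)).continuous_deriv (by simp)
  rcases hx with hx | hx
  · have h1 : ∀ x ∈ Set.Iio (0 : ℝ), deriv Real.smoothTransition x = 0 := by
      intro x hx
      have : Real.smoothTransition =ᶠ[𝓝 x] fun _ => 0 := by
        filter_upwards [Iio_mem_nhds hx] with z hz
        exact Real.smoothTransition.zero_of_nonpos (le_of_lt hz)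
      rw [this.deriv_eq]; simp
    have h2 : Set.Iic (0 : ℝ) ⊆ {x | deriv Real.smoothTransition x = 0} := by
      rw [← closure_Iio]
      exact closure_minimal h1 (isClosed_eq hc continuous_const)
    exact h2 hx
  · have h1 : ∀ x ∈ Set.Ioi (1 : ℝ), deriv Real.smoothTransition x = 0 := by
      intro x hx
      have : Real.smoothTransition =ᶠ[𝓝 x] fun _ => 1 := by
        filter_upwards [Ioi_mem_nhds hx] with z hz
        exact Real.smoothTransition.one_of_one_le (le_of_lt hz)
      rw [this.deriv_eq]; simp
    have h2 : Set.Ici (1 : ℝ) ⊆ {x | deriv Real.smoothTransition x = 0} := by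
      rw [← closure_Ioi]
      exact closure_minimal h1 (isClosed_eq hc continuous_const)
    exact h2 hx

/-- The collar weights are of size `1 / ε`. -/
theorem exists_collarWeight_bound :
    ∃ C : ℝ, 0 ≤ C ∧ ∀ ε : ℝ, 0 < ε → ∀ y : E3, collarWeight ε y ≤ C * ε⁻¹ := by
  have hc : Continuous (deriv Real.smoothTransition) :=
    (Real.smoothTransition.contDiff (n := 1)).continuous_deriv (by simp)
  obtain ⟨C, hC⟩ := (isCompact_Icc (a := (0 : ℝ)) (b := 1)).exists_bound_of_continuousOn
    hc.continuousOn
  have hC0 : 0 ≤ C := (norm_nonneg _).trans (hC 0 (by simp))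
  refine ⟨C, hC0, fun ε hε y => ?_⟩
  rw [collarWeight, div_eq_mul_inv]
  gcongr
  by_cases h : y 0 / ε - 1 ∈ Set.Icc (0 : ℝ) 1
  · exact (le_abs_self _).trans (hC _ h)
  · rw [deriv_smoothTransition_eq_zero]
    · exact hC0
    · by_contra! h'
      exact h ⟨h'.1.le, h'.2.le⟩

theorem collarWeight_nonneg {ε : ℝ} (hε : 0 < ε) (y : E3) : 0 ≤ collarWeight ε y :=
  div_nonneg (Real.smoothTransition.monotone.deriv_nonneg) hε.le

theorem collarWeight_eq_zero {ε : ℝ} (hε : 0 < ε) {y : E3} (hy : y 0 ≤ ε ∨ 2 * ε ≤ y 0) :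
    collarWeight ε y = 0 := by
  rw [collarWeight, deriv_smoothTransition_eq_zero, zero_div]
  refine hy.imp (fun h => ?_) (fun h => ?_)
  · rw [sub_nonpos, div_le_one hε]; exact h
  · rw [le_sub_iff_add_le, le_div_iff₀ hε]; linarith

theorem collarCutoff_eq_zero {ε : ℝ} (hε : 0 < ε) {y : E3} (hy : y 0 ≤ ε) :
    collarCutoff ε y = 0 := by
  apply Real.smoothTransition.zero_of_nonpos
  rw [sub_nonpos, div_le_one hε]; exact hy

theorem collarCutoff_eq_one {ε : ℝ} (hε : 0 < ε) {y : E3} (hy : 2 * ε ≤ y 0) :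
    collarCutoff ε y = 1 := by
  apply Real.smoothTransition.one_of_one_le
  rw [le_sub_iff_add_le, le_div_iff₀ hε]; linarith

theorem abs_collarCutoff_le_one (ε : ℝ) (y : E3) : |collarCutoff ε y| ≤ 1 := by
  rw [abs_of_nonneg (show 0 ≤ collarCutoff ε y from Real.smoothTransition.nonneg _)]
  exact Real.smoothTransition.le_one _

theorem collarWeight_continuous (ε : ℝ) : Continuous (collarWeight ε) := by
  have hc : Continuous (deriv Real.smoothTransition) :=
    (Real.smoothTransition.contDiff (n := 1)).continuous_deriv (by simp)
  unfold collarWeight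
  fun_prop

namespace IsHalfSpaceCutoff

variable {R S : Set E3} {χ : E3 → ℝ}

theorem mem_interior_of_mem (h : IsHalfSpaceCutoff R S χ) {y : E3} (hy : y ∈ S ∩ {y | 0 < y 0}) :
    y ∈ interior R := h.mem_interior y (h.subset hy.1) hy.2

theorem measurableSet (h : IsHalfSpaceCutoff R S χ) : MeasurableSet (S ∩ {y : E3 | 0 < y 0}) :=
  h.isCompact.measurableSet.inter
    (isOpen_lt continuous_const (by fun_prop : Continuous fun y : E3 => y 0)).measurableSet

/-- Cutting off the collar moves the support into the interior, so that `χ` becomes a test function. -/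
theorem isTestFunction (h : IsHalfSpaceCutoff R S χ) {ε : ℝ} (hε : 0 < ε) :
    IsTestFunction (interior R) (fun y => χ y * collarCutoff ε y) := by
  have hcl : IsClosed (S ∩ {y : E3 | ε ≤ y 0}) := h.isCompact.isClosed.inter
    (isClosed_le continuous_const (by fun_prop : Continuous fun y : E3 => y 0))
  have h0 : ∀ y, y ∉ S ∩ {y : E3 | ε ≤ y 0} → χ y * collarCutoff ε y = 0 := by
    intro y hy
    by_cases hyS : y ∈ S
    · have : y 0 < ε := by
        by_contra! hh
        exact hy ⟨hyS, hh⟩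
      rw [collarCutoff_eq_zero hε this.le, mul_zero]
    · rw [h.eq_zero y hyS, zero_mul]
  have hsub : S ∩ {y : E3 | ε ≤ y 0} ⊆ interior R := fun y hy =>
    h.mem_interior_of_mem ⟨hy.1, lt_of_lt_of_le hε hy.2⟩
  refine ⟨?_, ?_, ?_⟩
  · rw [contDiff_iff_contDiffAt]
    intro y
    by_cases hy : y ∈ interior R
    · exact (h.smooth.contDiffAt (isOpen_interior.mem_nhds hy)).mul
        (collarCutoff_contDiff ε).contDiffAt
    · have : (fun y => χ y * collarCutoff ε y) =ᶠ[𝓝 y] fun _ => 0 := by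
        filter_upwards [hcl.isOpen_compl.mem_nhds (fun hh => hy (hsub hh))] with z hz
        exact h0 z hz
      exact contDiffAt_const.congr_of_eventuallyEq this
  · exact HasCompactSupport.intro (h.isCompact.inter_right (isClosed_le continuous_const
      (by fun_prop : Continuous fun y : E3 => y 0))) h0
  · refine (closure_minimal ?_ hcl).trans hsub
    intro y hy
    by_contra hh
    exact hy (h0 y hh)

/-- The collar cutoff depends on `y 0` only: its derivative `collarWeight ε` appears for `i = 0` alone. -/
theorem fderiv_mul_collarCutoff (h : IsHalfSpaceCutoff R S χ) (ε : ℝ) {y : E3}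
    (hy : y ∈ interior R) (i : Fin 3) :
    fderiv ℝ (fun y => χ y * collarCutoff ε y) y (stdVec i)
      = fderiv ℝ χ y (stdVec i) * collarCutoff ε y
        + if i = 0 then χ y * collarWeight ε y else 0 := by
  have h1 : HasFDerivAt χ (fderiv ℝ χ y) y :=
    ((h.smooth.contDiffAt (isOpen_interior.mem_nhds hy)).differentiableAt (by simp)).hasFDerivAt
  have h2 : HasFDerivAt (collarCutoff ε) (fderiv ℝ (collarCutoff ε) y) y :=
    ((collarCutoff_contDiff ε).differentiable (by simp)).differentiableAt.hasFDerivAt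
  rw [show (fun y => χ y * collarCutoff ε y) = χ * collarCutoff ε from rfl, (h1.mul h2).fderiv]
  have := fderiv_collarCutoff ε y i
  simp only [add_apply, smul_apply, smul_eq_mul, this]
  split_ifs <;> ring

theorem memLp (h : IsHalfSpaceCutoff R S χ) {f : E3 → ℝ} (hf : L2On R f) :
    MemLp f 2 (volume.restrict (S ∩ {y : E3 | 0 < y 0})) :=
  (hf S h.isCompact h.subset).mono_measure
    (Measure.restrict_mono Set.inter_subset_left le_rfl)

theorem aestronglyMeasurable (h : IsHalfSpaceCutoff R S χ) :
    AEStronglyMeasurable χ (volume.restrict (S ∩ {y : E3 | 0 < y 0})) :=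
  (h.smooth.continuousOn.mono fun _ hy => h.mem_interior_of_mem hy).aestronglyMeasurable
    h.measurableSet

theorem aestronglyMeasurable_fderiv (h : IsHalfSpaceCutoff R S χ) (i : Fin 3) :
    AEStronglyMeasurable (fun y => fderiv ℝ χ y (stdVec i))
      (volume.restrict (S ∩ {y : E3 | 0 < y 0})) := by
  refine ContinuousOn.aestronglyMeasurable ?_ h.measurableSet
  refine ContinuousOn.mono ?_ fun _ hy => h.mem_interior_of_mem hy
  exact (h.smooth.continuousOn_fderiv_of_isOpen isOpen_interior (by simp)).clm_apply
    continuousOn_const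

/-- Products of two square integrable functions with a bounded function are integrable. -/
theorem integrable_mul (h : IsHalfSpaceCutoff R S χ) {f k m : E3 → ℝ} (hf : L2On R f)
    (hk : L2On R k)
    (hm : AEStronglyMeasurable m (volume.restrict (S ∩ {y : E3 | 0 < y 0}))) {C : ℝ}
    (hC : ∀ y ∈ S ∩ {y : E3 | 0 < y 0}, |m y| ≤ C) :
    Integrable (fun y => f y * m y * k y) (volume.restrict (S ∩ {y : E3 | 0 < y 0})) := by
  have h1 : Integrable (fun y => f y * k y) (volume.restrict (S ∩ {y : E3 | 0 < y 0})) :=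
    (h.memLp hf).integrable_mul (h.memLp hk)
  have := h1.bdd_mul (c := C) hm (by
    filter_upwards [ae_restrict_mem h.measurableSet] with y hy
    exact hC y hy)
  exact this.congr (Filter.Eventually.of_forall fun y => by ring)

theorem abs_le_one (h : IsHalfSpaceCutoff R S χ) (y : E3) : |χ y| ≤ 1 := by
  rw [abs_of_nonneg (h.nonneg y)]; exact h.le_one y

end IsHalfSpaceCutoff

/-- The integrand of the integration by parts formula for the field `b` and the function `a`, cut
off by `χ`. -/
def greenIntegrand (χ a d : E3 → ℝ) (a₁ b : Fin 3 → E3 → ℝ) (y : E3) : ℝ :=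
  ∑ i, (b i y * fderiv ℝ χ y (stdVec i) * a y + b i y * χ y * a₁ i y) - d y * χ y * a y

namespace IsHalfSpaceCutoff

variable {R S : Set E3} {χ : E3 → ℝ}

theorem integrable_greenIntegrand (h : IsHalfSpaceCutoff R S χ)
    {a d : E3 → ℝ} {a₁ b : Fin 3 → E3 → ℝ} (ha : L2On R a) (ha₁ : ∀ i, L2On R (a₁ i))
    (hb : ∀ i, L2On R (b i)) (hd : L2On R d) :
    Integrable (greenIntegrand χ a d a₁ b) (volume.restrict (S ∩ {y : E3 | 0 < y 0})) := by
  obtain ⟨C, hC⟩ := h.deriv_bounded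
  refine Integrable.sub (integrable_finsetSum _ fun i _ => Integrable.add ?_ ?_) ?_
  · exact h.integrable_mul (hb i) ha (h.aestronglyMeasurable_fderiv i)
      fun y hy => hC y (h.mem_interior_of_mem hy) i
  · exact h.integrable_mul (hb i) (ha₁ i) h.aestronglyMeasurable fun y _ => h.abs_le_one y
  · exact h.integrable_mul hd ha h.aestronglyMeasurable fun y _ => h.abs_le_one y

/-- The product rule tested against `χ` cut off near the boundary: the boundary enters through an
integral over a thin collar. -/
theorem integral_collar (h : IsHalfSpaceCutoff R S χ)
    {a d : E3 → ℝ} {a₁ b : Fin 3 → E3 → ℝ} (ha : L2On R a) (ha₁ : ∀ i, L2On R (a₁ i))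
    (hb : ∀ i, L2On R (b i)) (hd : L2On R d) (hw : ∀ i, IsWeakDeriv (interior R) i a (a₁ i))
    (hbd : HasWeakCodiv (interior R) b d) {ε : ℝ} (hε : 0 < ε) :
    (∫ y in S ∩ {y : E3 | 0 < y 0}, greenIntegrand χ a d a₁ b y * collarCutoff ε y)
      = - ∫ y in S ∩ {y : E3 | 0 < y 0}, b 0 y * (χ y * collarWeight ε y) * a y := by
  have ht := h.isTestFunction hε
  have key := hbd.integral_product_rule isOpen_interior ht (ha.mono interior_subset)
    (fun i => (ha₁ i).mono interior_subset) (fun i => (hb i).mono interior_subset)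
    (hd.mono interior_subset) hw
  set χε : E3 → ℝ := fun y => χ y * collarCutoff ε y with hχε
  set S' := S ∩ {y : E3 | 0 < y 0} with hS'
  have hz : ∀ y, y ∉ S' → χε y = 0 ∧ fderiv ℝ χε y = 0 := by
    intro y hy
    have hcl : IsClosed (S ∩ {y : E3 | ε ≤ y 0}) := h.isCompact.isClosed.inter
      (isClosed_le continuous_const (by fun_prop : Continuous fun y : E3 => y 0))
    have hy' : y ∉ S ∩ {y : E3 | ε ≤ y 0} := fun hh => hy ⟨hh.1, lt_of_lt_of_le hε hh.2⟩
    have : χε =ᶠ[𝓝 y] fun _ => 0 := by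
      filter_upwards [hcl.isOpen_compl.mem_nhds hy'] with z hz
      by_cases hzS : z ∈ S
      · have : z 0 < ε := by
          by_contra! hh
          exact hz ⟨hzS, hh⟩
        simp [hχε, collarCutoff_eq_zero hε this.le]
      · simp [hχε, h.eq_zero z hzS]
    exact ⟨this.eq_of_nhds, by rw [this.fderiv_eq]; simp⟩
  have r1 : ∀ f : E3 → ℝ, (∀ y, y ∉ S' → f y = 0) → ∫ y, f y = ∫ y in S', f y := fun f hf =>
    (setIntegral_eq_integral_of_forall_compl_eq_zero hf).symm
  obtain ⟨C, hC⟩ := h.deriv_bounded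
  have hζ1 : ∀ y, |collarCutoff ε y| ≤ 1 := abs_collarCutoff_le_one ε
  have mζ : AEStronglyMeasurable (collarCutoff ε) (volume.restrict S') :=
    (collarCutoff_contDiff ε).continuous.aestronglyMeasurable
  obtain ⟨Cw, hCw0, hCw⟩ := exists_collarWeight_bound
  have bχε : ∀ y ∈ S', |χε y| ≤ 1 := fun y _ => by
    rw [abs_mul]
    exact mul_le_one₀ (h.abs_le_one y) (abs_nonneg _) (hζ1 y)
  have mχε : AEStronglyMeasurable χε (volume.restrict S') := h.aestronglyMeasurable.mul mζ
  have mw : AEStronglyMeasurable (fun y => χ y * collarWeight ε y) (volume.restrict S') :=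
    h.aestronglyMeasurable.mul (collarWeight_continuous ε).aestronglyMeasurable
  have bw : ∀ y ∈ S', |χ y * collarWeight ε y| ≤ Cw * ε⁻¹ := fun y _ => by
    rw [abs_mul, abs_of_nonneg (collarWeight_nonneg hε y)]
    calc _ ≤ 1 * collarWeight ε y := by
          gcongr
          · exact collarWeight_nonneg hε y
          · exact h.abs_le_one y
      _ ≤ _ := by rw [one_mul]; exact hCw ε hε y
  have iw := h.integrable_mul (hb 0) ha mw bw
  have i1 : ∀ i, Integrable (fun y => b i y * fderiv ℝ χε y (stdVec i) * a y)
      (volume.restrict S') := by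
    intro i
    refine h.integrable_mul (hb i) ha (C := C * 1 + Cw * ε⁻¹) ?_ ?_
    · have := (ht.1.continuous_fderiv (by simp)).clm_apply (continuous_const (y := stdVec i))
      exact this.aestronglyMeasurable
    · intro y hy
      rw [h.fderiv_mul_collarCutoff ε (h.mem_interior_of_mem hy)]
      refine (abs_add_le _ _).trans (add_le_add ?_ ?_)
      · rw [abs_mul]
        have hCy := hC y (h.mem_interior_of_mem hy) i
        exact mul_le_mul hCy (hζ1 y) (abs_nonneg _) ((abs_nonneg _).trans hCy)
      · split_ifs
        · exact bw y hy
        · simp only [abs_zero]; positivity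
  have i2 : ∀ i, Integrable (fun y => b i y * χε y * a₁ i y) (volume.restrict S') := fun i =>
    h.integrable_mul (hb i) (ha₁ i) mχε bχε
  have i3 : Integrable (fun y => d y * χε y * a y) (volume.restrict S') :=
    h.integrable_mul hd ha mχε bχε
  have k1 : ∀ i, ∫ y, b i y * fderiv ℝ χε y (stdVec i) * a y
      = ∫ y in S', b i y * fderiv ℝ χε y (stdVec i) * a y := fun i =>
    r1 _ fun y hy => by simp [(hz y hy).2]
  have k2 : ∀ i, ∫ y, b i y * χε y * a₁ i y = ∫ y in S', b i y * χε y * a₁ i y := fun i =>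
    r1 _ fun y hy => by simp [(hz y hy).1]
  have k3 : ∫ y, d y * χε y * a y = ∫ y in S', d y * χε y * a y :=
    r1 _ fun y hy => by simp [(hz y hy).1]
  have key' : ∑ i, ((∫ y in S', b i y * fderiv ℝ χε y (stdVec i) * a y)
      + ∫ y in S', b i y * χε y * a₁ i y) = ∫ y in S', d y * χε y * a y := by
    simp only [← k1, ← k2, ← k3]
    exact key
  have e : ∀ y ∈ S', greenIntegrand χ a d a₁ b y * collarCutoff ε y
      = ∑ i, (b i y * fderiv ℝ χε y (stdVec i) * a y + b i y * χε y * a₁ i y)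
        - d y * χε y * a y - b 0 y * (χ y * collarWeight ε y) * a y := by
    intro y hy
    have hyi := h.mem_interior_of_mem hy
    simp only [hχε, greenIntegrand, h.fderiv_mul_collarCutoff ε hyi, Fin.sum_univ_three]
    simp
    ring
  have hm : MeasurableSet S' := h.measurableSet
  rw [setIntegral_congr_fun hm e, integral_sub, integral_sub, integral_finsetSum]
  · rw [Finset.sum_congr rfl fun i _ => integral_add (i1 i) (i2 i), key']; ring
  · exact fun i _ => (i1 i).add (i2 i)
  · exact integrable_finsetSum _ fun i _ => (i1 i).add (i2 i)
  · exact i3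
  · exact (integrable_finsetSum _ fun i _ => (i1 i).add (i2 i)).sub i3
  · exact iw

/-- Functions with vanishing trace have vanishing collar integrals. -/
theorem tendsto_collar_integral (h : IsHalfSpaceCutoff R S χ) {f : E3 → ℝ}
    (htr : Filter.Tendsto (fun ε : ℝ => ENNReal.ofReal ε⁻¹ * ∫⁻ y in S ∩ {y | y 0 < ε}, ‖f y‖ₑ)
      (𝓝[>] 0) (𝓝 0)) :
    Filter.Tendsto (fun ε : ℝ => ∫ y in S ∩ {y : E3 | 0 < y 0}, |f y| * (χ y * collarWeight ε y))
      (𝓝[>] 0) (𝓝 0) := by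
  obtain ⟨Cw, hCw0, hCw⟩ := exists_collarWeight_bound
  rw [tendsto_zero_iff_enorm_tendsto_zero]
  -- The weight vanishes where `y 0 ≥ 2 ε`; it is compared with the collar of width `3 ε`.
  have h3 : Filter.Tendsto (fun ε : ℝ => 3 * ε) (𝓝[>] 0) (𝓝[>] 0) := by
    refine tendsto_nhdsWithin_iff.2 ⟨?_, ?_⟩
    · have : Filter.Tendsto (fun ε : ℝ => 3 * ε) (𝓝 0) (𝓝 (3 * 0)) :=
        (continuous_const.mul continuous_id).tendsto 0
      rw [mul_zero] at this
      exact this.mono_left nhdsWithin_le_nhds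
    · filter_upwards [self_mem_nhdsWithin] with ε hε
      exact mul_pos (by norm_num : (0 : ℝ) < 3) hε
  have h4 := ENNReal.Tendsto.const_mul (a := ENNReal.ofReal (3 * Cw)) (htr.comp h3)
    (Or.inr ENNReal.ofReal_ne_top)
  rw [mul_zero] at h4
  refine tendsto_of_tendsto_of_tendsto_of_le_of_le' tendsto_const_nhds h4
    (Filter.Eventually.of_forall fun _ => zero_le) ?_
  filter_upwards [self_mem_nhdsWithin] with ε hε
  have hε : 0 < ε := hε
  refine (enorm_integral_le_lintegral_enorm _).trans ?_
  have hm3 : MeasurableSet {y : E3 | y 0 < 3 * ε} :=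
    (isOpen_lt (by fun_prop : Continuous fun y : E3 => y 0) continuous_const).measurableSet
  calc ∫⁻ y in S ∩ {y : E3 | 0 < y 0}, ‖|f y| * (χ y * collarWeight ε y)‖ₑ
      ≤ ∫⁻ y in S, ENNReal.ofReal (Cw * ε⁻¹) * {y : E3 | y 0 < 3 * ε}.indicator (fun y => ‖f y‖ₑ) y := by
        refine (lintegral_mono_set Set.inter_subset_left).trans (lintegral_mono fun y => ?_)
        rw [enorm_mul, show ‖|f y|‖ₑ = ‖f y‖ₑ by simp [Real.enorm_eq_ofReal_abs]]
        by_cases hy : y 0 < 3 * ε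
        · rw [Set.indicator_of_mem (by exact hy), mul_comm]
          gcongr
          rw [Real.enorm_eq_ofReal_abs]
          apply ENNReal.ofReal_le_ofReal
          rw [abs_mul, abs_of_nonneg (collarWeight_nonneg hε y)]
          calc _ ≤ 1 * collarWeight ε y := by
                gcongr
                · exact collarWeight_nonneg hε y
                · exact h.abs_le_one y
            _ ≤ _ := by rw [one_mul]; exact hCw ε hε y
        · rw [collarWeight_eq_zero hε (Or.inr (by linarith))]
          simp
    _ = ENNReal.ofReal (Cw * ε⁻¹) * ∫⁻ y in S ∩ {y | y 0 < 3 * ε}, ‖f y‖ₑ := by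
        rw [lintegral_const_mul' _ _ ENNReal.ofReal_ne_top, lintegral_indicator hm3,
          Measure.restrict_restrict hm3, Set.inter_comm]
    _ = _ := by
        rw [Function.comp_apply, ← mul_assoc, ← ENNReal.ofReal_mul (by positivity)]
        congr 2
        field_simp

/-- A uniform bound for the integrals of `a²` over thin collars, for a weakly differentiable `a`:
the product rule for the field `(a, 0, 0)`, whose divergence is `∂_0 a`. -/
theorem exists_collar_bound (h : IsHalfSpaceCutoff R S χ)
    {a : E3 → ℝ} {a₁ : Fin 3 → E3 → ℝ} (ha : L2On R a) (ha₁ : ∀ i, L2On R (a₁ i))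
    (hw : ∀ i, IsWeakDeriv (interior R) i a (a₁ i)) :
    ∃ C : ℝ, ∀ ε : ℝ, 0 < ε →
      ∫ y in S ∩ {y : E3 | 0 < y 0}, a y * (χ y * collarWeight ε y) * a y ≤ C := by
  have h0 : L2On R (fun _ => 0) := fun _ _ _ => MemLp.zero'
  let b : Fin 3 → E3 → ℝ := ![a, fun _ => 0, fun _ => 0]
  have hb : ∀ i, L2On R (b i) := by
    intro i; fin_cases i
    · exact ha
    · exact h0
    · exact h0
  have hd : L2On R (fun y => - a₁ 0 y) := fun K hK hKR => (ha₁ 0 K hK hKR).neg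
  have hbd : HasWeakCodiv (interior R) b (fun y => - a₁ 0 y) := by
    intro φ hφ
    have := hw 0 φ hφ
    simp only [Fin.sum_univ_three, b]
    simp only [Matrix.cons_val_zero, Matrix.cons_val_one, Matrix.cons_val, zero_mul, add_zero,
      neg_mul, integral_neg]
    calc _ = ∫ y, fderiv ℝ φ y (stdVec 0) * a y := by congr 1; ext y; ring
      _ = _ := by rw [this]; congr 2; ext y; ring
  have hi := h.integrable_greenIntegrand ha ha₁ hb hd
  refine ⟨∫ y in S ∩ {y : E3 | 0 < y 0}, |greenIntegrand χ a (fun y => - a₁ 0 y) a₁ b y|,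
    fun ε hε => ?_⟩
  have := h.integral_collar ha ha₁ hb hd hw hbd hε
  have e : (∫ y in S ∩ {y : E3 | 0 < y 0}, a y * (χ y * collarWeight ε y) * a y)
      = - ∫ y in S ∩ {y : E3 | 0 < y 0},
        greenIntegrand χ a (fun y => - a₁ 0 y) a₁ b y * collarCutoff ε y := by
    rw [this, neg_neg]; rfl
  rw [e]
  refine (neg_le_abs _).trans ((abs_integral_le_integral_abs).trans ?_)
  refine integral_mono_of_nonneg (Filter.Eventually.of_forall fun _ => abs_nonneg _) hi.abs
    (Filter.Eventually.of_forall fun y => ?_)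
  simp only [abs_mul]
  exact mul_le_of_le_one_right (abs_nonneg _) (abs_collarCutoff_le_one ε y)

/-- Integration by parts in the half space without boundary term: the normal component of the
bounded field `b`, or the function `a`, has trace zero. -/
theorem integral_greenIntegrand (h : IsHalfSpaceCutoff R S χ)
    {a d : E3 → ℝ} {a₁ b : Fin 3 → E3 → ℝ} (ha : L2On R a) (ha₁ : ∀ i, L2On R (a₁ i))
    (hb : ∀ i, L2On R (b i)) (hd : L2On R d) (hw : ∀ i, IsWeakDeriv (interior R) i a (a₁ i))
    (hbd : HasWeakCodiv (interior R) b d) {Cb : ℝ} (hCb : ∀ᵐ y ∂(volume.restrict S), |b 0 y| ≤ Cb)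
    (htr : (∃ f ∈ ({b 0, a} : Set (E3 → ℝ)),
      Filter.Tendsto (fun ε : ℝ => ENNReal.ofReal ε⁻¹ * ∫⁻ y in S ∩ {y | y 0 < ε}, ‖f y‖ₑ)
        (𝓝[>] 0) (𝓝 0))) :
    ∫ y in S ∩ {y : E3 | 0 < y 0}, greenIntegrand χ a d a₁ b y = 0 := by
  set S' := S ∩ {y : E3 | 0 < y 0} with hS'
  have hCb' : ∀ᵐ y ∂(volume.restrict S'), |b 0 y| ≤ Cb :=
    ae_restrict_of_ae_restrict_of_subset Set.inter_subset_left hCb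
  obtain ⟨Cw, hCw0, hCw⟩ := exists_collarWeight_bound
  have mw : ∀ ε, AEStronglyMeasurable (fun y => χ y * collarWeight ε y) (volume.restrict S') :=
    fun ε => h.aestronglyMeasurable.mul (collarWeight_continuous ε).aestronglyMeasurable
  have bw0 : ∀ ε, 0 < ε → ∀ y, 0 ≤ χ y * collarWeight ε y := fun ε hε y =>
    mul_nonneg (h.nonneg y) (collarWeight_nonneg hε y)
  have bw : ∀ ε, 0 < ε → ∀ y ∈ S', |χ y * collarWeight ε y| ≤ Cw * ε⁻¹ := fun ε hε y _ => by
    rw [abs_mul, abs_of_nonneg (collarWeight_nonneg hε y)]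
    calc _ ≤ 1 * collarWeight ε y := by
          gcongr
          · exact collarWeight_nonneg hε y
          · exact h.abs_le_one y
      _ ≤ _ := by rw [one_mul]; exact hCw ε hε y
  have : IsFiniteMeasure (volume.restrict S') := by
    refine ⟨?_⟩
    rw [Measure.restrict_apply_univ]
    exact (measure_mono Set.inter_subset_left).trans_lt h.isCompact.measure_lt_top
  have L1 : ∀ f : E3 → ℝ, L2On R f → ∀ ε, 0 < ε →
      Integrable (fun y => |f y| * (χ y * collarWeight ε y)) (volume.restrict S') := by
    intro f hf ε hε
    have := ((h.memLp hf).integrable (by norm_num)).abs.bdd_mul (c := Cw * ε⁻¹) (mw ε) (by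
      filter_upwards [ae_restrict_mem h.measurableSet] with y hy
      exact bw ε hε y hy)
    exact this.congr (Filter.Eventually.of_forall fun y => by simp only; ring)
  -- the collar term tends to zero
  have collar : Filter.Tendsto (fun ε => ∫ y in S', b 0 y * (χ y * collarWeight ε y) * a y)
      (𝓝[>] 0) (𝓝 0) := by
    obtain ⟨f, hf, hft⟩ := htr
    rcases hf with rfl | hf
    · -- Young's inequality and the collar bound for `a`
      have hlim := h.tendsto_collar_integral hft
      obtain ⟨C, hC⟩ := h.exists_collar_bound ha ha₁ hw
      rw [Metric.tendsto_nhds]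
      intro η hη
      -- `δ` makes the first term in `|b₀ a| ≤ δ a² + δ⁻¹ |Cb| |b₀|` at most `η / 2` on all collars
      set δ := η / (2 * (|C| + 1)) with hδ
      have hδ0 : 0 < δ := by positivity
      have h1 : ∀ᶠ ε in 𝓝[>] (0 : ℝ), δ⁻¹ * |Cb| *
          ∫ y in S', |b 0 y| * (χ y * collarWeight ε y) < η / 2 := by
        have := hlim.const_mul (δ⁻¹ * |Cb|)
        rw [mul_zero] at this
        exact this.eventually (gt_mem_nhds (by positivity))
      filter_upwards [h1, self_mem_nhdsWithin] with ε h1 hε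
      have hε : 0 < ε := hε
      rw [Real.dist_eq, sub_zero]
      have ia := h.integrable_mul ha ha (mw ε) (bw ε hε)
      calc |∫ y in S', b 0 y * (χ y * collarWeight ε y) * a y|
          ≤ ∫ y in S', |b 0 y * (χ y * collarWeight ε y) * a y| := abs_integral_le_integral_abs
        _ ≤ ∫ y in S', (δ * (a y * (χ y * collarWeight ε y) * a y)
              + δ⁻¹ * |Cb| * (|b 0 y| * (χ y * collarWeight ε y))) := by
            refine integral_mono_ae (h.integrable_mul (hb 0) ha (mw ε) (bw ε hε)).abs
              ((ia.const_mul _).add ((L1 _ (hb 0) ε hε).const_mul _)) ?_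
            filter_upwards [hCb'] with y hy
            have w0 := bw0 ε hε y
            rw [abs_mul, abs_mul, abs_of_nonneg w0]
            have hy' : |b 0 y| ≤ |Cb| := hy.trans (le_abs_self _)
            have y1 : |b 0 y| * |a y| ≤ δ * a y ^ 2 + δ⁻¹ * |b 0 y| ^ 2 := by
              have hs := sq_nonneg (δ * |a y| - |b 0 y|)
              have e : δ * a y ^ 2 + δ⁻¹ * |b 0 y| ^ 2 - |b 0 y| * |a y|
                  = δ⁻¹ * ((δ * |a y| - |b 0 y|) ^ 2 + δ * |a y| * |b 0 y|) := by
                rw [← sq_abs (a y)]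
                field_simp
                ring
              have : 0 ≤ δ⁻¹ * ((δ * |a y| - |b 0 y|) ^ 2 + δ * |a y| * |b 0 y|) := by positivity
              linarith
            have y2 : |b 0 y| ^ 2 ≤ |Cb| * |b 0 y| := by
              rw [sq]; gcongr
            have y3 : |b 0 y| * |a y| ≤ δ * a y ^ 2 + δ⁻¹ * (|Cb| * |b 0 y|) :=
              y1.trans (by gcongr)
            calc |b 0 y| * (χ y * collarWeight ε y) * |a y|
                = (|b 0 y| * |a y|) * (χ y * collarWeight ε y) := by ring
              _ ≤ (δ * a y ^ 2 + δ⁻¹ * (|Cb| * |b 0 y|)) * (χ y * collarWeight ε y) := by gcongr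
              _ = _ := by ring
        _ = δ * (∫ y in S', a y * (χ y * collarWeight ε y) * a y)
              + δ⁻¹ * |Cb| * ∫ y in S', |b 0 y| * (χ y * collarWeight ε y) := by
            rw [integral_add (ia.const_mul _) ((L1 _ (hb 0) ε hε).const_mul _),
              integral_const_mul, integral_const_mul]
        _ < η := by
            have : δ * (∫ y in S', a y * (χ y * collarWeight ε y) * a y) ≤ η / 2 := by
              calc _ ≤ δ * (|C| + 1) := by
                    gcongr
                    exact (hC ε hε).trans ((le_abs_self C).trans (by linarith))
                _ = η / 2 := by rw [hδ]; field_simp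
            linarith
    · rw [Set.mem_singleton_iff] at hf
      subst hf
      have hlim := (h.tendsto_collar_integral hft).const_mul |Cb|
      rw [mul_zero] at hlim
      refine squeeze_zero_norm' ?_ hlim
      filter_upwards [self_mem_nhdsWithin] with ε hε
      have hε : 0 < ε := hε
      rw [Real.norm_eq_abs, ← integral_const_mul]
      refine abs_integral_le_integral_abs.trans ?_
      refine integral_mono_ae (h.integrable_mul (hb 0) ha (mw ε) (bw ε hε)).abs
        ((L1 _ ha ε hε).const_mul _) ?_
      filter_upwards [hCb'] with y hy
      have w0 := bw0 ε hε y
      rw [abs_mul, abs_mul, abs_of_nonneg w0]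
      have hy' : |b 0 y| ≤ |Cb| := hy.trans (le_abs_self _)
      calc |b 0 y| * (χ y * collarWeight ε y) * |f y|
          ≤ |Cb| * (χ y * collarWeight ε y) * |f y| := by gcongr
        _ = _ := by ring
  have hi := h.integrable_greenIntegrand ha ha₁ hb hd
  have main : Filter.Tendsto
      (fun ε => ∫ y in S', greenIntegrand χ a d a₁ b y * collarCutoff ε y) (𝓝[>] 0)
      (𝓝 (∫ y in S', greenIntegrand χ a d a₁ b y)) := by
    refine tendsto_integral_filter_of_dominated_convergence
      (fun y => |greenIntegrand χ a d a₁ b y|) ?_ ?_ hi.abs ?_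
    · exact Filter.Eventually.of_forall fun ε =>
        hi.1.mul (collarCutoff_contDiff ε).continuous.aestronglyMeasurable
    · refine Filter.Eventually.of_forall fun ε => Filter.Eventually.of_forall fun y => ?_
      rw [norm_mul]
      exact mul_le_of_le_one_right (abs_nonneg _) (abs_collarCutoff_le_one ε y)
    · filter_upwards [ae_restrict_mem h.measurableSet] with y hy
      refine tendsto_const_nhds.congr' ?_
      have hy0 : 0 < y 0 := hy.2
      have : Set.Ioo 0 (y 0 / 2) ∈ 𝓝[>] (0 : ℝ) := Ioo_mem_nhdsGT (by positivity)
      filter_upwards [this] with ε hε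
      rw [collarCutoff_eq_one hε.1 (by linarith [hε.2]), mul_one]
  have main' : Filter.Tendsto
      (fun ε => ∫ y in S', greenIntegrand χ a d a₁ b y * collarCutoff ε y) (𝓝[>] 0) (𝓝 0) := by
    have := collar.neg
    rw [neg_zero] at this
    refine this.congr' ?_
    filter_upwards [self_mem_nhdsWithin] with ε hε
    exact (h.integral_collar ha ha₁ hb hd hw hbd hε).symm
  exact tendsto_nhds_unique main main'

end IsHalfSpaceCutoff

/-! ### Inner products of multilinear maps in frames -/

section FrameAlgebra

variable {V W : Type*} [AddCommGroup V] [Module ℝ V] [AddCommGroup W] [Module ℝ W] {p : ℕ}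

/-- The matrix of the bilinear form `γ` in the frame `e`. -/
def gramOf (γ : V →ₗ[ℝ] V →ₗ[ℝ] ℝ) (e : Fin 3 → V) : Matrix (Fin 3) (Fin 3) ℝ :=
  Matrix.of fun i j => γ (e i) (e j)

/-- The contraction of `κ (u, v)` with `p` copies of the inverse of the form `γ`, computed in the
frame `e`. -/
def frameInner (γ : V →ₗ[ℝ] V →ₗ[ℝ] ℝ) (κ : W →ₗ[ℝ] W →ₗ[ℝ] ℝ) (e : Fin 3 → V)
    (u v : V [⋀^Fin p]→ₗ[ℝ] W) : ℝ :=
  ∑ I : Fin p → Fin 3, ∑ J : Fin p → Fin 3,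
    (∏ k, (gramOf γ e)⁻¹ (I k) (J k)) * κ (u fun k => e (I k)) (v fun k => e (J k))

/-- The Gram matrix transforms by congruence. -/
theorem gramOf_basis_change (γ : V →ₗ[ℝ] V →ₗ[ℝ] ℝ) (e e' : Module.Basis (Fin 3) ℝ V) :
    gramOf γ e' = (e.toMatrix e').transpose * gramOf γ e * e.toMatrix e' := by
  ext i j
  have h : ∀ j, e' j = ∑ k, e.toMatrix e' k j • e k := fun j => (e.sum_toMatrix_smul_self e' j).symm
  simp only [gramOf, Matrix.of_apply, Matrix.mul_apply, Matrix.transpose_apply]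
  rw [h i, h j]
  simp only [map_sum, map_smul, LinearMap.sum_apply, LinearMap.smul_apply, smul_eq_mul,
    Finset.mul_sum, Finset.sum_mul]
  refine Finset.sum_congr rfl fun k _ => Finset.sum_congr rfl fun l _ => ?_
  ring

theorem gramOf_inv_basis_change (γ : V →ₗ[ℝ] V →ₗ[ℝ] ℝ) (e e' : Module.Basis (Fin 3) ℝ V) :
    e.toMatrix e' * (gramOf γ e')⁻¹ * (e.toMatrix e').transpose = (gramOf γ e)⁻¹ := by
  have h1 : e.toMatrix e' * e'.toMatrix e = 1 := e.toMatrix_mul_toMatrix_flip e'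
  have hu : IsUnit (e.toMatrix e').det := by
    rw [← Matrix.isUnit_iff_isUnit_det]
    exact IsUnit.of_mul_eq_one _ h1
  have hut : IsUnit (e.toMatrix e').transpose.det := by rwa [Matrix.det_transpose]
  rw [gramOf_basis_change γ e e', Matrix.mul_inv_rev, Matrix.mul_inv_rev, ← Matrix.mul_assoc,
    Matrix.mul_nonsing_inv _ hu, Matrix.one_mul, Matrix.mul_assoc, Matrix.nonsing_inv_mul _ hut,
    Matrix.mul_one]

/-- Multilinear expansion of a form on combinations of frame vectors. -/
theorem map_frame_expand (u : V [⋀^Fin p]→ₗ[ℝ] W) (e : Fin 3 → V) (P : Fin p → Fin 3 → ℝ) :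
    u (fun k => ∑ i, P k i • e i) = ∑ I : Fin p → Fin 3, (∏ k, P k (I k)) • u fun k => e (I k) := by
  have := u.toMultilinearMap.map_sum (fun k i => P k i • e i)
  simp only [AlternatingMap.coe_multilinearMap] at this
  rw [this]
  refine Finset.sum_congr rfl fun I _ => ?_
  exact u.toMultilinearMap.map_smul_univ (fun k => P k (I k)) (fun k => e (I k))

theorem sum_prod_matrix (A : Fin p → Fin 3 → Fin 3 → ℝ) :
    ∑ I : Fin p → Fin 3, ∑ J : Fin p → Fin 3, ∏ k, A k (I k) (J k)
      = ∏ k, ∑ i, ∑ j, A k i j := by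
  simp only [Fintype.prod_sum]

theorem sum_comm_pairs {ι κ : Type*} [Fintype ι] [Fintype κ] (F : ι → ι → κ → κ → ℝ) :
    ∑ i, ∑ j, ∑ k, ∑ l, F i j k l = ∑ k, ∑ l, ∑ i, ∑ j, F i j k l := by
  calc _ = ∑ i, ∑ k, ∑ l, ∑ j, F i j k l := by
        refine Finset.sum_congr rfl fun i _ => ?_
        rw [Finset.sum_comm]
        exact Finset.sum_congr rfl fun k _ => Finset.sum_comm
    _ = _ := by
        rw [Finset.sum_comm]
        exact Finset.sum_congr rfl fun k _ => Finset.sum_comm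

/-- The contraction does not depend on the frame. -/
theorem frameInner_basis_change (γ : V →ₗ[ℝ] V →ₗ[ℝ] ℝ) (κ : W →ₗ[ℝ] W →ₗ[ℝ] ℝ)
    (e e' : Module.Basis (Fin 3) ℝ V) (u v : V [⋀^Fin p]→ₗ[ℝ] W) :
    frameInner γ κ e' u v = frameInner γ κ e u v := by
  have h : ∀ j, e' j = ∑ k, e.toMatrix e' k j • e k := fun j => (e.sum_toMatrix_smul_self e' j).symm
  set P := e.toMatrix e'
  set G' := (gramOf γ e')⁻¹ with hG'
  have hu : ∀ (w : V [⋀^Fin p]→ₗ[ℝ] W) (I : Fin p → Fin 3), w (fun k => e' (I k))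
      = ∑ I' : Fin p → Fin 3, (∏ k, P (I' k) (I k)) • w fun k => e (I' k) := by
    intro w I
    simp only [h]
    exact map_frame_expand w e fun k i => P i (I k)
  have hG : ∀ i' j', ∑ i, ∑ j, P i' i * G' i j * P j' j = (gramOf γ e)⁻¹ i' j' := by
    intro i' j'
    rw [← gramOf_inv_basis_change γ e e']
    simp only [Matrix.mul_apply, Matrix.transpose_apply, Finset.sum_mul]
    exact Finset.sum_comm
  unfold frameInner
  simp only [hu, map_sum, map_smul, LinearMap.sum_apply, LinearMap.smul_apply, smul_eq_mul,
    ← hG, ← sum_prod_matrix]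
  simp only [Finset.mul_sum, Finset.sum_mul, Finset.prod_mul_distrib]
  calc _ = ∑ I : Fin p → Fin 3, ∑ J : Fin p → Fin 3, ∑ I' : Fin p → Fin 3, ∑ J' : Fin p → Fin 3,
        (∏ k, P (I' k) (I k)) * (∏ k, G' (I k) (J k)) * (∏ k, P (J' k) (J k)) *
          κ (u fun k => e (I' k)) (v fun k => e (J' k)) := by
        refine Finset.sum_congr rfl fun I _ => Finset.sum_congr rfl fun J _ => ?_
        rw [Finset.sum_comm]
        refine Finset.sum_congr rfl fun I' _ => Finset.sum_congr rfl fun J' _ => ?_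
        ring
    _ = _ := by
        rw [sum_comm_pairs]

/-- Positive definiteness of a symmetric bilinear form. -/
structure IsPosForm (γ : V →ₗ[ℝ] V →ₗ[ℝ] ℝ) : Prop where
  symm : ∀ X Y, γ X Y = γ Y X
  pos : ∀ X, X ≠ 0 → 0 < γ X X

namespace IsPosForm

variable {γ : V →ₗ[ℝ] V →ₗ[ℝ] ℝ} {κ : W →ₗ[ℝ] W →ₗ[ℝ] ℝ}

theorem nonneg (h : IsPosForm γ) (X : V) : 0 ≤ γ X X := by
  by_cases hX : X = 0
  · simp [hX]
  · exact (h.pos X hX).le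

theorem eq_zero (h : IsPosForm γ) {X : V} (hX : γ X X = 0) : X = 0 := by
  by_contra h0
  exact (h.pos X h0).ne' hX

/-- Frames which are orthonormal for a positive definite form exist. -/
theorem exists_orthonormal (h : IsPosForm γ) {N : ℕ} (e : Module.Basis (Fin N) ℝ V) :
    ∃ e' : Module.Basis (Fin N) ℝ V, ∀ i j, γ (e' i) (e' j) = if i = j then 1 else 0 := by
  have : FiniteDimensional ℝ V := Module.Basis.finiteDimensional_of_finite e
  have hs : LinearMap.IsSymm γ := ⟨fun X Y => by simpa using h.symm X Y⟩
  obtain ⟨v, hv⟩ := LinearMap.BilinForm.exists_orthogonal_basis hs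
  have hd : Module.finrank ℝ V = N := by simpa using Module.finrank_eq_card_basis e
  let v' : Module.Basis (Fin N) ℝ V := v.reindex (finCongr hd)
  have hv' : ∀ i j, i ≠ j → γ (v' i) (v' j) = 0 := by
    intro i j hij
    simp only [v', Module.Basis.reindex_apply]
    exact hv (fun hh => hij ((finCongr hd).symm.injective hh))
  have hp : ∀ i, 0 < γ (v' i) (v' i) := fun i => h.pos _ (v'.ne_zero i)
  let w : Fin N → ℝˣ := fun i => Units.mk0 ((√(γ (v' i) (v' i)))⁻¹)
    (inv_ne_zero (Real.sqrt_pos.2 (hp i)).ne')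
  refine ⟨v'.unitsSMul w, fun i j => ?_⟩
  rw [Module.Basis.unitsSMul_apply, Module.Basis.unitsSMul_apply]
  simp only [w, Units.smul_mk0, map_smul, LinearMap.smul_apply, smul_eq_mul]
  split_ifs with hij
  · subst hij
    have := Real.mul_self_sqrt (hp i).le
    have h0 := (Real.sqrt_pos.2 (hp i)).ne'
    field_simp
    rw [sq, this]
  · rw [hv' i j hij]; simp

theorem frameInner_orthonormal {e : Fin 3 → V} (he : ∀ i j, γ (e i) (e j) = if i = j then 1 else 0)
    (u v : V [⋀^Fin p]→ₗ[ℝ] W) :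
    frameInner γ κ e u v
      = ∑ I : Fin p → Fin 3, κ (u fun k => e (I k)) (v fun k => e (I k)) := by
  have hg : gramOf γ e = 1 := by
    ext i j
    simp [gramOf, he, Matrix.one_apply]
  unfold frameInner
  rw [hg, inv_one]
  refine Finset.sum_congr rfl fun I _ => ?_
  rw [Finset.sum_eq_single I]
  · simp
  · intro J _ hJ
    obtain ⟨k, hk⟩ := Function.ne_iff.1 hJ
    rw [Finset.prod_eq_zero (Finset.mem_univ k) (by simp [Ne.symm hk]), zero_mul]
  · simp

/-- The Cauchy-Schwarz inequality for a linear combination. -/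
theorem sum_smul_le {ι : Type*} [Fintype ι] (hn : ∀ w, 0 ≤ κ w w) (hs : ∀ w z, κ w z = κ z w)
    (c : ι → ℝ) (w : ι → W) :
    κ (∑ i, c i • w i) (∑ i, c i • w i) ≤ (∑ i, c i ^ 2) * ∑ i, κ (w i) (w i) := by
  have cs : ∀ x y, κ x y ≤ √(κ x x) * √(κ y y) := by
    intro x y
    rw [← Real.sqrt_mul (hn x)]
    apply Real.le_sqrt_of_sq_le
    exact LinearMap.BilinForm.apply_sq_le_of_symm κ hn ⟨fun X Y => by simpa using hs X Y⟩ x y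
  have cs' : ∀ i j, c i * (c j * κ (w i) (w j))
      ≤ (|c i| * √(κ (w i) (w i))) * (|c j| * √(κ (w j) (w j))) := by
    intro i j
    have h1 : |κ (w i) (w j)| ≤ √(κ (w i) (w i)) * √(κ (w j) (w j)) := by
      rw [abs_le]
      refine ⟨?_, cs _ _⟩
      have := cs (-(w i)) (w j)
      simp only [map_neg, LinearMap.neg_apply, neg_neg] at this
      linarith
    calc c i * (c j * κ (w i) (w j)) ≤ |c i * (c j * κ (w i) (w j))| := le_abs_self _
      _ = |c i| * (|c j| * |κ (w i) (w j)|) := by rw [abs_mul, abs_mul]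
      _ ≤ |c i| * (|c j| * (√(κ (w i) (w i)) * √(κ (w j) (w j)))) := by gcongr
      _ = _ := by ring
  calc κ (∑ i, c i • w i) (∑ i, c i • w i)
      = ∑ i, ∑ j, c i * (c j * κ (w i) (w j)) := by
        simp only [map_sum, map_smul, LinearMap.sum_apply, LinearMap.smul_apply, smul_eq_mul,
          Finset.mul_sum]
        rw [Finset.sum_comm]
        refine Finset.sum_congr rfl fun i _ => Finset.sum_congr rfl fun j _ => ?_
        ring
    _ ≤ ∑ i, ∑ j, (|c i| * √(κ (w i) (w i))) * (|c j| * √(κ (w j) (w j))) :=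
        Finset.sum_le_sum fun i _ => Finset.sum_le_sum fun j _ => cs' i j
    _ = (∑ i, |c i| * √(κ (w i) (w i))) ^ 2 := by
        rw [sq, Finset.sum_mul_sum]
    _ ≤ (∑ i, |c i| ^ 2) * ∑ i, √(κ (w i) (w i)) ^ 2 := Finset.sum_mul_sq_le_sq_mul_sq _ _ _
    _ = _ := by
        simp only [sq_abs, Real.sq_sqrt (hn _)]

theorem orthonormal_expand {N : ℕ} {e : Module.Basis (Fin N) ℝ V}
    (he : ∀ i j, γ (e i) (e j) = if i = j then 1 else 0) (X : V) :
    X = ∑ i, γ (e i) X • e i := by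
  conv_lhs => rw [← e.sum_repr X]
  refine Finset.sum_congr rfl fun i _ => ?_
  congr 1
  have h : γ (e i) X = γ (e i) (∑ j, e.repr X j • e j) := by rw [e.sum_repr]
  rw [h, map_sum]
  simp only [map_smul, he, smul_eq_mul]
  simp

theorem orthonormal_sq {N : ℕ} {e : Module.Basis (Fin N) ℝ V}
    (he : ∀ i j, γ (e i) (e j) = if i = j then 1 else 0) (X : V) :
    ∑ i, γ (e i) X ^ 2 = γ X X := by
  have h2 : γ X X = γ (∑ i, γ (e i) X • e i) X := by rw [← orthonormal_expand he X]
  rw [h2]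
  simp only [map_sum, map_smul, LinearMap.sum_apply, LinearMap.smul_apply, smul_eq_mul, sq]

/-- The value of a multilinear map is bounded by the lengths of the arguments. -/
theorem frameInner_eval_le (h : IsPosForm γ) (hn : ∀ w, 0 ≤ κ w w) (hs : ∀ w z, κ w z = κ z w)
    (e : Module.Basis (Fin 3) ℝ V) (u : V [⋀^Fin p]→ₗ[ℝ] W) (X : Fin p → V) :
    κ (u X) (u X) ≤ (∏ k, γ (X k) (X k)) * frameInner γ κ e u u := by
  obtain ⟨e', he'⟩ := h.exists_orthonormal e
  rw [frameInner_basis_change γ κ e' e, frameInner_orthonormal he']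
  have hX : u X = ∑ I : Fin p → Fin 3, (∏ k, γ (e' (I k)) (X k)) • u fun k => e' (I k) := by
    rw [← map_frame_expand u e' fun k i => γ (e' i) (X k)]
    congr 1; ext k
    exact orthonormal_expand he' (X k)
  rw [hX]
  refine (sum_smul_le hn hs _ _).trans (le_of_eq ?_)
  congr 1
  simp only [← Finset.prod_pow]
  rw [← Fintype.prod_sum (fun k i => γ (e' i) (X k) ^ 2)]
  exact Finset.prod_congr rfl fun k _ => orthonormal_sq he' (X k)

theorem frameInner_nonneg (h : IsPosForm γ) (hn : ∀ w, 0 ≤ κ w w)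
    (e : Module.Basis (Fin 3) ℝ V) (u : V [⋀^Fin p]→ₗ[ℝ] W) : 0 ≤ frameInner γ κ e u u := by
  obtain ⟨e', he'⟩ := h.exists_orthonormal e
  rw [frameInner_basis_change γ κ e' e, frameInner_orthonormal he']
  exact Finset.sum_nonneg fun I _ => hn _

theorem frameInner_symm (h : IsPosForm γ) (hs : ∀ w z, κ w z = κ z w)
    (e : Module.Basis (Fin 3) ℝ V) (u v : V [⋀^Fin p]→ₗ[ℝ] W) :
    frameInner γ κ e u v = frameInner γ κ e v u := by
  obtain ⟨e', he'⟩ := h.exists_orthonormal e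
  rw [frameInner_basis_change γ κ e' e, frameInner_basis_change γ κ e' e,
    frameInner_orthonormal he', frameInner_orthonormal he']
  exact Finset.sum_congr rfl fun I _ => hs _ _

theorem eq_zero_of_frameInner (h : IsPosForm γ) (hκ : IsPosForm κ)
    (e : Module.Basis (Fin 3) ℝ V) {u : V [⋀^Fin p]→ₗ[ℝ] W} (hu : frameInner γ κ e u u = 0) :
    u = 0 := by
  ext X
  apply hκ.eq_zero
  have := h.frameInner_eval_le hκ.nonneg hκ.symm e u X
  rw [hu, mul_zero] at this
  exact le_antisymm this (hκ.nonneg _)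

/-- Contraction of a bilinear form with the inverse of `γ` does not depend on the frame. -/
theorem sum_inv_gramOf (β : V →ₗ[ℝ] V →ₗ[ℝ] ℝ)
    (e e' : Module.Basis (Fin 3) ℝ V) (he' : ∀ i j, γ (e' i) (e' j) = if i = j then 1 else 0) :
    ∑ i, ∑ j, (gramOf γ e)⁻¹ i j * β (e i) (e j) = ∑ i, β (e' i) (e' i) := by
  have hg : gramOf γ e' = 1 := by
    ext i j
    simp [gramOf, he', Matrix.one_apply]
  have hx : ∀ j, e j = ∑ k, e'.toMatrix e k j • e' k :=
    fun j => (e'.sum_toMatrix_smul_self e j).symm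
  have hi := gramOf_inv_basis_change γ e' e
  rw [hg, inv_one] at hi
  have hi' : ∀ k l, ∑ i, ∑ j, e'.toMatrix e k i * (gramOf γ e)⁻¹ i j * e'.toMatrix e l j
      = if k = l then 1 else 0 := by
    intro k l
    have := congrFun (congrFun hi k) l
    rw [Matrix.one_apply] at this
    rw [← this]
    simp only [Matrix.mul_apply, Matrix.transpose_apply, Finset.sum_mul]
    exact Finset.sum_comm
  have e1 : ∀ i j, β (e i) (e j)
      = ∑ k, ∑ l, e'.toMatrix e k i * e'.toMatrix e l j * β (e' k) (e' l) := by
    intro i j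
    rw [hx i, hx j]
    simp only [map_sum, map_smul, LinearMap.sum_apply, LinearMap.smul_apply, smul_eq_mul,
      Finset.mul_sum]
    rw [Finset.sum_comm]
    refine Finset.sum_congr rfl fun k _ => Finset.sum_congr rfl fun l _ => ?_
    ring
  calc _ = ∑ i, ∑ j, ∑ k, ∑ l,
        (e'.toMatrix e k i * (gramOf γ e)⁻¹ i j * e'.toMatrix e l j) * β (e' k) (e' l) := by
        simp only [e1, Finset.mul_sum]
        refine Finset.sum_congr rfl fun i _ => Finset.sum_congr rfl fun j _ =>
          Finset.sum_congr rfl fun k _ => Finset.sum_congr rfl fun l _ => ?_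
        ring
    _ = ∑ k, ∑ l, (if k = l then 1 else 0) * β (e' k) (e' l) := by
        rw [sum_comm_pairs]
        simp only [← hi', Finset.sum_mul]
    _ = _ := by simp

/-- Linear functionals are bounded for the norm of a positive definite form. -/
theorem exists_functional_bound (h : IsPosForm γ) {N : ℕ} (e : Module.Basis (Fin N) ℝ V)
    (l : V →ₗ[ℝ] ℝ) : ∃ C : ℝ, 0 ≤ C ∧ ∀ X, l X ^ 2 ≤ C * γ X X := by
  obtain ⟨f, hf⟩ := h.exists_orthonormal e
  refine ⟨∑ i, l (f i) ^ 2, Finset.sum_nonneg fun i _ => sq_nonneg _, fun X => ?_⟩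
  have h1 : l X = ∑ i, l (f i) * γ (f i) X := by
    conv_lhs => rw [orthonormal_expand hf X]
    simp [mul_comm]
  rw [h1, ← orthonormal_sq hf X]
  exact Finset.sum_mul_sq_le_sq_mul_sq _ _ _

/-- Bilinear maps are bounded for the norm of a positive definite form. -/
theorem exists_bilinear_bound (h : IsPosForm γ) {N : ℕ} (e : Module.Basis (Fin N) ℝ V)
    (b : V →ₗ[ℝ] V →ₗ[ℝ] V) :
    ∃ C : ℝ, 0 ≤ C ∧ ∀ X Y, γ (b X Y) (b X Y) ≤ C * (γ X X * γ Y Y) := by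
  obtain ⟨f, hf⟩ := h.exists_orthonormal e
  refine ⟨∑ q : Fin N × Fin N, γ (b (f q.1) (f q.2)) (b (f q.1) (f q.2)),
    Finset.sum_nonneg fun q _ => h.nonneg _, fun X Y => ?_⟩
  have h1 : b X Y = ∑ q : Fin N × Fin N, (γ (f q.1) X * γ (f q.2) Y) • b (f q.1) (f q.2) := by
    conv_lhs => rw [orthonormal_expand hf X, orthonormal_expand hf Y]
    rw [Fintype.sum_prod_type]
    simp only [map_sum, map_smul, LinearMap.sum_apply, LinearMap.smul_apply, Finset.smul_sum,
      smul_smul]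
    rw [Finset.sum_comm]
    refine Finset.sum_congr rfl fun i _ => Finset.sum_congr rfl fun j _ => ?_
    rw [mul_comm]
  rw [h1]
  refine (sum_smul_le h.nonneg h.symm _ _).trans (le_of_eq ?_)
  have h2 : ∑ q : Fin N × Fin N, (γ (f q.1) X * γ (f q.2) Y) ^ 2 = γ X X * γ Y Y := by
    rw [← orthonormal_sq hf X, ← orthonormal_sq hf Y, Fintype.sum_prod_type, Finset.sum_mul_sum]
    simp only [mul_pow]
  rw [h2, mul_comm]

theorem frameInner_one {e : Fin 3 → V} (he : ∀ i j, γ (e i) (e j) = if i = j then 1 else 0)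
    (u : V [⋀^Fin 1]→ₗ[ℝ] W) :
    frameInner γ κ e u u = ∑ i, κ (u ![e i]) (u ![e i]) := by
  rw [frameInner_orthonormal he]
  have := Fintype.prod_sum (fun (_ : Fin 1) i => κ (u ![e i]) (u ![e i]))
  simp only [Finset.univ_unique, Finset.prod_singleton] at this
  rw [this]
  refine Finset.sum_congr rfl fun I _ => ?_
  have h1 : (fun k => e (I k)) = ![e (I default)] := by
    ext k; fin_cases k; rfl
  rw [h1]

/-- The bracket wedge of two one-covectors is bounded by the product of their norms. -/
theorem frameInner_wedge_le (h : IsPosForm γ) (hn : ∀ w, 0 ≤ κ w w)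
    {b : W →ₗ[ℝ] W →ₗ[ℝ] W} {C : ℝ}
    (hb : ∀ X Y, κ (b X Y) (b X Y) ≤ C * (κ X X * κ Y Y))
    (e : Module.Basis (Fin 3) ℝ V) (u v : V [⋀^Fin 1]→ₗ[ℝ] W) (w : V [⋀^Fin 2]→ₗ[ℝ] W)
    (hw : ∀ X, w X = b (u ![X 0]) (v ![X 1]) - b (u ![X 1]) (v ![X 0])) :
    frameInner γ κ e w w ≤ 4 * C * (frameInner γ κ e u u * frameInner γ κ e v v) := by
  obtain ⟨f, hf⟩ := h.exists_orthonormal e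
  rw [frameInner_basis_change γ κ f e, frameInner_basis_change γ κ f e,
    frameInner_basis_change γ κ f e, frameInner_one hf, frameInner_one hf,
    frameInner_orthonormal hf]
  set U : Fin 3 → ℝ := fun i => κ (u ![f i]) (u ![f i]) with hU
  set Z : Fin 3 → ℝ := fun i => κ (v ![f i]) (v ![f i]) with hZ
  have hsub : ∀ X Y, κ (X - Y) (X - Y) ≤ 2 * κ X X + 2 * κ Y Y := by
    intro X Y
    have h1 := hn (X + Y)
    simp only [map_add, map_sub, LinearMap.add_apply, LinearMap.sub_apply] at h1 ⊢
    linarith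
  have e1 : ∑ I : Fin 2 → Fin 3, U (I 0) * Z (I 1) = (∑ i, U i) * ∑ i, Z i := by
    have := Fintype.prod_sum (fun (k : Fin 2) i => (![U, Z] k) i)
    simpa [Fin.prod_univ_two] using this.symm
  have e2 : ∑ I : Fin 2 → Fin 3, U (I 1) * Z (I 0) = (∑ i, U i) * ∑ i, Z i := by
    have := Fintype.prod_sum (fun (k : Fin 2) i => (![Z, U] k) i)
    simp [Fin.prod_univ_two] at this
    rw [mul_comm, this]
    exact Finset.sum_congr rfl fun I _ => mul_comm _ _
  calc ∑ I : Fin 2 → Fin 3, κ (w fun k => f (I k)) (w fun k => f (I k))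
      ≤ ∑ I : Fin 2 → Fin 3, (2 * C * (U (I 0) * Z (I 1)) + 2 * C * (U (I 1) * Z (I 0))) := by
        refine Finset.sum_le_sum fun I _ => ?_
        rw [hw]
        refine (hsub _ _).trans ?_
        have h1 := hb (u ![f (I 0)]) (v ![f (I 1)])
        have h2 := hb (u ![f (I 1)]) (v ![f (I 0)])
        simp only [hU, hZ]
        linarith
    _ = _ := by
        rw [Finset.sum_add_distrib, ← Finset.mul_sum, ← Finset.mul_sum, e1, e2]
        ring

end IsPosForm

/-- `frameInner` as a bilinear form. -/
def frameForm (γ : V →ₗ[ℝ] V →ₗ[ℝ] ℝ) (κ : W →ₗ[ℝ] W →ₗ[ℝ] ℝ) (e : Fin 3 → V) :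
    V [⋀^Fin p]→ₗ[ℝ] W →ₗ[ℝ] V [⋀^Fin p]→ₗ[ℝ] W →ₗ[ℝ] ℝ :=
  LinearMap.mk₂ ℝ (frameInner γ κ e)
    (fun u u' v => by simp [frameInner, mul_add, Finset.sum_add_distrib])
    (fun c u v => by
      simp only [frameInner, AlternatingMap.smul_apply, map_smul, LinearMap.smul_apply,
        smul_eq_mul, Finset.mul_sum]
      exact Finset.sum_congr rfl fun I _ => Finset.sum_congr rfl fun J _ => by ring)
    (fun u v v' => by simp [frameInner, mul_add, Finset.sum_add_distrib])
    (fun c u v => by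
      simp only [frameInner, AlternatingMap.smul_apply, map_smul, smul_eq_mul, Finset.mul_sum]
      exact Finset.sum_congr rfl fun I _ => Finset.sum_congr rfl fun J _ => by ring)

end FrameAlgebra

/-! ### Charts and coordinate frames -/

section Charts

variable {M : Type*} [TopologicalSpace M] [ChartedSpace (EuclideanHalfSpace 3) M]

theorem range_halfSpace : Set.range (𝓡∂ 3) = {y : E3 | 0 ≤ y 0} :=
  range_modelWithCornersEuclideanHalfSpace 3

theorem chartRange_nonneg (c : M) : ∀ y ∈ chartRange c, 0 ≤ y 0 := by
  intro y hy
  have : y ∈ Set.range (𝓡∂ 3) := extChartAt_target_subset_range c hy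
  rwa [range_halfSpace] at this

theorem exists_chartRange_eq (c : M) : ∃ V : Set E3, IsOpen V ∧ chartRange c = V ∩ {y | 0 ≤ y 0} := by
  refine ⟨_, (chartAt (EuclideanHalfSpace 3) c).open_target.preimage (𝓡∂ 3).continuous_symm, ?_⟩
  rw [← range_halfSpace]
  exact extChartAt_target (I := 𝓡∂ 3) c

theorem interior_chartRange (c : M) : interior (chartRange c) = chartRange c ∩ {y | 0 < y 0} := by
  obtain ⟨V, hV, h⟩ := exists_chartRange_eq c
  rw [h, interior_inter, hV.interior_eq, interior_halfSpace]
  ext y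
  simp only [Set.mem_inter_iff, Set.mem_ofPred_eq]
  exact ⟨fun h => ⟨⟨h.1, h.2.le⟩, h.2⟩, fun h => ⟨h.1.1, h.2⟩⟩

theorem mem_interior_chartRange (c : M) : ∀ y ∈ chartRange c, 0 < y 0 → y ∈ interior (chartRange c) := by
  intro y hy h0
  rw [interior_chartRange]; exact ⟨hy, h0⟩

theorem measurableSet_chartRange (c : M) : MeasurableSet (chartRange c) := by
  obtain ⟨V, hV, h⟩ := exists_chartRange_eq c
  rw [h]
  exact hV.measurableSet.inter
    (isClosed_le continuous_const (by fun_prop : Continuous fun y : E3 => y 0)).measurableSet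

theorem volume_boundary : volume {y : E3 | y 0 = 0} = 0 := by
  have := Measure.addHaar_submodule (volume : Measure E3)
    (LinearMap.ker (EuclideanSpace.proj (0 : Fin 3) : E3 →L[ℝ] ℝ).toLinearMap) (by
      intro h
      have : stdVec 0 ∈ LinearMap.ker (EuclideanSpace.proj (0 : Fin 3) : E3 →L[ℝ] ℝ).toLinearMap := by
        rw [h]; trivial
      simp [stdVec] at this)
  convert this using 2
  ext y; simp

theorem chartRange_ae_interior (c : M) : chartRange c =ᵐ[volume] interior (chartRange c) := by
  rw [interior_chartRange]
  have h0 : ∀ᵐ y ∂(volume : Measure E3), y 0 ≠ 0 := by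
    rw [ae_iff]; simpa using volume_boundary
  filter_upwards [h0] with y hy
  refine propext ⟨fun h => ⟨h, lt_of_le_of_ne (chartRange_nonneg c y h) (Ne.symm hy)⟩, fun h => h.1⟩

theorem uniqueDiffOn_chartRange (c : M) : UniqueDiffOn ℝ (chartRange c) :=
  uniqueDiffOn_extChartAt_target c

theorem chartPoint_mem (c : M) {y : E3} (hy : y ∈ chartRange c) :
    chartPoint c y ∈ (extChartAt (𝓡∂ 3) c).source := (extChartAt (𝓡∂ 3) c).map_target hy

theorem extChartAt_chartPoint (c : M) {y : E3} (hy : y ∈ chartRange c) :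
    extChartAt (𝓡∂ 3) c (chartPoint c y) = y := (extChartAt (𝓡∂ 3) c).right_inv hy

theorem continuousOn_chartPoint (c : M) : ContinuousOn (chartPoint c) (chartRange c) :=
  continuousOn_extChartAt_symm c

variable [IsManifold (𝓡∂ 3) ∞ M]

/-- The linear isomorphism from coordinate vectors in the chart at `c` to tangent vectors. -/
def frameEquiv (c : M) {x : M} (hx : x ∈ (extChartAt (𝓡∂ 3) c).source) :
    E3 ≃ₗ[ℝ] TangentSpace (𝓡∂ 3) x :=
  LinearEquiv.ofLinearMap (M := E3) (M₂ := E3) (tangentCoordChange (𝓡∂ 3) c x x).toLinearMap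
    (tangentCoordChange (𝓡∂ 3) x c x).toLinearMap
    (by
      ext1 v
      exact (tangentCoordChange_comp ⟨⟨mem_extChartAt_source x, hx⟩, mem_extChartAt_source x⟩).trans
        (tangentCoordChange_self (mem_extChartAt_source x)))
    (by
      ext1 v
      exact (tangentCoordChange_comp ⟨⟨hx, mem_extChartAt_source x⟩, hx⟩).trans
        (tangentCoordChange_self hx))

/-- The coordinate vector fields of a chart form a basis of the tangent space. -/
def frameBasis (c : M) {x : M} (hx : x ∈ (extChartAt (𝓡∂ 3) c).source) :
    Module.Basis (Fin 3) ℝ (TangentSpace (𝓡∂ 3) x) :=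
  (EuclideanSpace.basisFun (Fin 3) ℝ).toBasis.map (frameEquiv c hx)

theorem frameBasis_apply (c : M) {x : M} (hx : x ∈ (extChartAt (𝓡∂ 3) c).source) (i : Fin 3) :
    frameBasis c hx i = frame c x i := by
  simp only [frameBasis, Module.Basis.map_apply, OrthonormalBasis.coe_toBasis,
    EuclideanSpace.basisFun_apply]
  rfl

theorem coe_frameBasis (c : M) {x : M} (hx : x ∈ (extChartAt (𝓡∂ 3) c).source) :
    ⇑(frameBasis c hx) = frame c x := funext (frameBasis_apply c hx)

/-- The coordinate vector fields of two charts are related by the derivative of the coordinate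
change. -/
theorem frame_change (c c' : M) {x : M} (hx : x ∈ (extChartAt (𝓡∂ 3) c).source)
    (hx' : x ∈ (extChartAt (𝓡∂ 3) c').source) (i : Fin 3) :
    frame c x i = ∑ k, (tangentCoordChange (𝓡∂ 3) c c' x (stdVec i)) k • frame c' x k := by
  have h1 : frame c x i = frameEquiv c' hx' (tangentCoordChange (𝓡∂ 3) c c' x (stdVec i)) :=
    (tangentCoordChange_comp ⟨⟨hx, hx'⟩, mem_extChartAt_source x⟩).symm
  have h2 : ∀ v : E3, v = ∑ k, v k • stdVec k := by
    intro v
    have := (EuclideanSpace.basisFun (Fin 3) ℝ).sum_repr v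
    simpa [stdVec] using this.symm
  rw [h1, h2 (tangentCoordChange (𝓡∂ 3) c c' x (stdVec i)), map_sum]
  refine Finset.sum_congr rfl fun k _ => ?_
  rw [map_smul, ← h2]
  rfl

theorem frame_eq_symmL (c : M) {x : M} (hx : x ∈ (extChartAt (𝓡∂ 3) c).source) (i : Fin 3) :
    frame c x i = (trivializationAt E3 (TangentSpace (𝓡∂ 3)) c).symmL ℝ x (stdVec i) := by
  rw [TangentBundle.symmL_trivializationAt_eq_core (by rwa [extChartAt_source] at hx)]
  rfl

theorem frame_eq_mfderivWithin (c : M) {x : M} (hx : x ∈ (extChartAt (𝓡∂ 3) c).source) (i : Fin 3) :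
    frame c x i = mfderivWithin 𝓘(ℝ, E3) (𝓡∂ 3) (extChartAt (𝓡∂ 3) c).symm (Set.range (𝓡∂ 3))
      (extChartAt (𝓡∂ 3) c x) (stdVec i) := by
  rw [frame_eq_symmL c hx, TangentBundle.symmL_trivializationAt (by rwa [extChartAt_source] at hx)]
  rfl

theorem contMDiffOn_frame (c : M) (i : Fin 3) :
    ContMDiffOn (𝓡∂ 3) (𝓡∂ 3).tangent ∞
      (fun x => (Bundle.TotalSpace.mk' E3 x (frame c x i) : TangentBundle (𝓡∂ 3) M))
      (extChartAt (𝓡∂ 3) c).source := by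
  have h := (trivializationAt E3 (TangentSpace (𝓡∂ 3)) c).contMDiffOn_localFrame_baseSet
    (n := ∞) (I := 𝓡∂ 3) (EuclideanSpace.basisFun (Fin 3) ℝ).toBasis i
  rw [TangentBundle.trivializationAt_baseSet, ← extChartAt_source (𝓡∂ 3)] at h
  refine h.congr fun x hx => ?_
  have hx' : x ∈ (trivializationAt E3 (TangentSpace (𝓡∂ 3)) c).baseSet := by
    rwa [TangentBundle.trivializationAt_baseSet, ← extChartAt_source (𝓡∂ 3)]
  rw [Bundle.Trivialization.localFrame_apply_of_mem_baseSet _ _ hx', frame_eq_symmL c hx]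
  simp only [Bundle.Trivialization.basisAt, Module.Basis.map_apply, OrthonormalBasis.coe_toBasis,
    EuclideanSpace.basisFun_apply, Bundle.Trivialization.linearEquivAt_symm_apply]
  exact congrArg _ (Bundle.Trivialization.symmL_apply (R := ℝ)
    (trivializationAt E3 (TangentSpace (𝓡∂ 3)) c) hx' (stdVec i))

/-- The Riemannian metric at a point as a bilinear form. -/
def metricForm (g : SmoothMetric M) (x : M) :
    TangentSpace (𝓡∂ 3) x →ₗ[ℝ] TangentSpace (𝓡∂ 3) x →ₗ[ℝ] ℝ :=
  LinearMap.mk₂ ℝ (fun X Y => g.inner x X Y) (fun X X' Y => by simp) (fun a X Y => by simp)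
    (fun X Y Y' => by simp) (fun a X Y => by simp)

theorem isPosForm_metricForm (g : SmoothMetric M) (x : M) : IsPosForm (metricForm g x) :=
  ⟨fun X Y => g.symm x X Y, fun X hX => g.pos x X hX⟩

theorem gramOf_metricForm (g : SmoothMetric M) (c x : M) :
    gramOf (metricForm g x) (frame c x) = gram g c x := rfl

theorem gram_symm (g : SmoothMetric M) (c x : M) (i j : Fin 3) : gram g c x i j = gram g c x j i :=
  g.symm x _ _

theorem gram_posDef (g : SmoothMetric M) (c : M) {x : M}
    (hx : x ∈ (extChartAt (𝓡∂ 3) c).source) : (gram g c x).PosDef := by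
  rw [Matrix.posDef_iff_dotProduct_mulVec]
  refine ⟨?_, fun v hv => ?_⟩
  · ext i j
    simpa using gram_symm g c x j i
  · have h0 : ∑ i, v i • frame c x i ≠ 0 := by
      intro h
      have := Fintype.linearIndependent_iff.1 (frameBasis c hx).linearIndependent v
        (by simpa only [frameBasis_apply] using h)
      exact hv (funext this)
    have := (isPosForm_metricForm g x).pos _ h0
    simp only [map_sum, map_smul, LinearMap.sum_apply, LinearMap.smul_apply, smul_eq_mul] at this
    simp only [dotProduct, Matrix.mulVec, star_trivial, Finset.mul_sum]
    refine this.trans_eq ?_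
    simp only [Finset.mul_sum]
    rw [Finset.sum_comm]
    refine Finset.sum_congr rfl fun i _ => Finset.sum_congr rfl fun j _ => ?_
    rw [← gramOf_metricForm]
    simp only [gramOf, Matrix.of_apply]
    ring

theorem gram_det_pos (g : SmoothMetric M) (c : M) {x : M}
    (hx : x ∈ (extChartAt (𝓡∂ 3) c).source) : 0 < (gram g c x).det := (gram_posDef g c hx).det_pos

theorem contMDiffOn_gram (g : SmoothMetric M) (c : M) (i j : Fin 3) :
    ContMDiffOn (𝓡∂ 3) 𝓘(ℝ, ℝ) ∞ (fun x => gram g c x i j) (extChartAt (𝓡∂ 3) c).source := by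
  intro x hx
  have h : ContMDiffWithinAt (𝓡∂ 3) ((𝓡∂ 3).prod 𝓘(ℝ)) ∞
      (fun m ↦ Bundle.TotalSpace.mk' ℝ (E := Bundle.Trivial M ℝ) m
        (g.inner m (frame c m i) (frame c m j))) (extChartAt (𝓡∂ 3) c).source x := by
    apply ContMDiffWithinAt.clm_bundle_apply₂ (F₁ := E3) (F₂ := E3)
    · exact g.contMDiff.contMDiffAt.contMDiffWithinAt
    · exact contMDiffOn_frame c i x hx
    · exact contMDiffOn_frame c j x hx
  simp only [Bundle.contMDiffWithinAt_totalSpace] at h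
  exact h.2

theorem contDiffOn_comp_chartPoint {F : Type*} [NormedAddCommGroup F] [NormedSpace ℝ F] (c : M)
    {f : M → F} (hf : ContMDiffOn (𝓡∂ 3) 𝓘(ℝ, F) ∞ f (extChartAt (𝓡∂ 3) c).source) :
    ContDiffOn ℝ ∞ (fun y => f (chartPoint c y)) (chartRange c) := by
  rw [← contMDiffOn_iff_contDiffOn]
  exact hf.comp (contMDiffOn_extChartAt_symm c) fun y hy => chartPoint_mem c hy

theorem contDiffOn_gram (g : SmoothMetric M) (c : M) (i j : Fin 3) :
    ContDiffOn ℝ ∞ (fun y => gram g c (chartPoint c y) i j) (chartRange c) :=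
  contDiffOn_comp_chartPoint c (contMDiffOn_gram g c i j)

theorem continuousOn_gram (g : SmoothMetric M) (c : M) :
    ContinuousOn (fun y => gram g c (chartPoint c y)) (chartRange c) :=
  continuousOn_pi.2 fun i => continuousOn_pi.2 fun j => (contDiffOn_gram g c i j).continuousOn

theorem continuousOn_gram_det (g : SmoothMetric M) (c : M) :
    ContinuousOn (fun y => (gram g c (chartPoint c y)).det) (chartRange c) :=
  continuous_id.matrix_det.comp_continuousOn (continuousOn_gram g c)

theorem continuousOn_gram_inv (g : SmoothMetric M) (c : M) (i j : Fin 3) :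
    ContinuousOn (fun y => (gram g c (chartPoint c y))⁻¹ i j) (chartRange c) := by
  have h1 : ContinuousOn (fun y => (gram g c (chartPoint c y)).det⁻¹ *
      (gram g c (chartPoint c y)).adjugate i j) (chartRange c) := by
    refine ((continuousOn_gram_det g c).inv₀ fun y hy =>
      (gram_det_pos g c (chartPoint_mem c hy)).ne').mul ?_
    exact (continuous_id.matrix_adjugate.matrix_elem i j).comp_continuousOn (continuousOn_gram g c)
  refine h1.congr fun y hy => ?_
  rw [Matrix.inv_def, Matrix.smul_apply, smul_eq_mul, Ring.inverse_eq_inv']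

theorem continuousOn_sqrt_gram_det (g : SmoothMetric M) (c : M) :
    ContinuousOn (fun y => √(gram g c (chartPoint c y)).det) (chartRange c) :=
  (continuousOn_gram_det g c).sqrt

theorem continuousOn_christoffel (g : SmoothMetric M) (c : M) (l i j : Fin 3) :
    ContinuousOn (christoffel g c l i j) (chartRange c) := by
  have hD : ∀ k a b : Fin 3, ContinuousOn (fun y => fderivWithin ℝ
      (fun z => gram g c (chartPoint c z) a b) (chartRange c) y (stdVec k)) (chartRange c) :=
    fun k a b => ((contDiffOn_gram g c a b).continuousOn_fderivWithin (uniqueDiffOn_chartRange c)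
      (by simp)).clm_apply continuousOn_const
  unfold christoffel
  refine continuousOn_const.mul (continuousOn_finsetSum _ fun m _ => ?_)
  exact (continuousOn_gram_inv g c l m).mul (((hD _ _ _).add (hD _ _ _)).sub (hD _ _ _))

/-- The derivative of a function along a coordinate vector field is the partial derivative of its
coordinate expression. -/
theorem mfderiv_frame {f : M → ℝ} (c : M) {y : E3} (hy : y ∈ chartRange c)
    (hf : MDifferentiableAt (𝓡∂ 3) 𝓘(ℝ, ℝ) f (chartPoint c y)) (i : Fin 3) :
    (mfderiv (𝓡∂ 3) 𝓘(ℝ, ℝ) f (chartPoint c y) (frame c (chartPoint c y) i) : ℝ)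
      = fderivWithin ℝ (fun z => f (chartPoint c z)) (chartRange c) y (stdVec i) := by
  have hx := chartPoint_mem c hy
  have hs : MDifferentiableWithinAt 𝓘(ℝ, E3) (𝓡∂ 3) (extChartAt (𝓡∂ 3) c).symm
      (Set.range (𝓡∂ 3)) y := mdifferentiableWithinAt_extChartAt_symm hy
  have hu : UniqueMDiffWithinAt 𝓘(ℝ, E3) (Set.range (𝓡∂ 3)) y :=
    ((𝓡∂ 3).uniqueDiffOn.uniqueMDiffOn) y (extChartAt_target_subset_range c hy)
  have h1 := mfderiv_comp_mfderivWithin (I' := 𝓡∂ 3) y hf hs hu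
  have h2 : fderivWithin ℝ (fun z => f (chartPoint c z)) (chartRange c) y
      = fderivWithin ℝ (fun z => f (chartPoint c z)) (Set.range (𝓡∂ 3)) y := by
    apply fderivWithin_congr_set
    have := extChartAt_target_eventuallyEq_of_mem (I := 𝓡∂ 3) (x := c) hy
    exact this
  rw [h2, ← mfderivWithin_eq_fderivWithin]
  have h3 := frame_eq_mfderivWithin c hx i
  rw [extChartAt_chartPoint c hy] at h3
  rw [h3]
  have h4 := congrArg (fun L : E3 →L[ℝ] ℝ => L (stdVec i)) h1
  exact h4.symm

end Charts

/-! ### The Riemannian volume in charts -/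

section Volume

variable {M : Type*} [TopologicalSpace M] [ChartedSpace (EuclideanHalfSpace 3) M]
  [IsManifold (𝓡∂ 3) ∞ M]

/-- The density of the Riemannian volume in the chart at `c`. -/
def volDensity (g : SmoothMetric M) (c : M) (y : E3) : ℝ := √(gram g c (chartPoint c y)).det

theorem volDensity_nonneg (g : SmoothMetric M) (c : M) (y : E3) : 0 ≤ volDensity g c y :=
  Real.sqrt_nonneg _

theorem volDensity_pos (g : SmoothMetric M) (c : M) {y : E3} (hy : y ∈ chartRange c) :
    0 < volDensity g c y := Real.sqrt_pos.2 (gram_det_pos g c (chartPoint_mem c hy))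

theorem continuousOn_volDensity (g : SmoothMetric M) (c : M) :
    ContinuousOn (volDensity g c) (chartRange c) := continuousOn_sqrt_gram_det g c

/-- The matrix of the coordinate change between two charts. -/
def jacobian (c c' x : M) : Matrix (Fin 3) (Fin 3) ℝ :=
  Matrix.of fun k i => (tangentCoordChange (𝓡∂ 3) c c' x (stdVec i)) k

theorem det_tangentCoordChange (c c' x : M) :
    (tangentCoordChange (𝓡∂ 3) c c' x).det = (jacobian c c' x).det := by
  have : (jacobian c c' x) = LinearMap.toMatrix (EuclideanSpace.basisFun (Fin 3) ℝ).toBasis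
      (EuclideanSpace.basisFun (Fin 3) ℝ).toBasis (tangentCoordChange (𝓡∂ 3) c c' x).toLinearMap := by
    ext k i
    rw [LinearMap.toMatrix_apply]
    simp [jacobian, stdVec]
  rw [this, LinearMap.det_toMatrix]

theorem gram_change (g : SmoothMetric M) (c c' : M) {x : M}
    (hx : x ∈ (extChartAt (𝓡∂ 3) c).source) (hx' : x ∈ (extChartAt (𝓡∂ 3) c').source) :
    gram g c x = (jacobian c c' x).transpose * gram g c' x * jacobian c c' x := by
  ext i j
  simp only [← gramOf_metricForm, gramOf, Matrix.of_apply, Matrix.mul_apply,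
    Matrix.transpose_apply, frame_change c c' hx hx', map_sum, map_smul, LinearMap.sum_apply,
    LinearMap.smul_apply, smul_eq_mul, Finset.mul_sum, Finset.sum_mul, jacobian]
  refine Finset.sum_congr rfl fun k _ => Finset.sum_congr rfl fun l _ => ?_
  ring

/-- The transformation rule of the density `√(det g_ij)`, by which the local volumes agree on
overlaps. -/
theorem sqrt_gram_det_change (g : SmoothMetric M) (c c' : M) {x : M}
    (hx : x ∈ (extChartAt (𝓡∂ 3) c).source) (hx' : x ∈ (extChartAt (𝓡∂ 3) c').source) :
    √(gram g c x).det = |(tangentCoordChange (𝓡∂ 3) c c' x).det| * √(gram g c' x).det := by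
  rw [gram_change g c c' hx hx', Matrix.det_mul, Matrix.det_mul, Matrix.det_transpose,
    det_tangentCoordChange]
  rw [show (jacobian c c' x).det * (gram g c' x).det * (jacobian c c' x).det
    = (jacobian c c' x).det ^ 2 * (gram g c' x).det by ring, Real.sqrt_mul (sq_nonneg _),
    Real.sqrt_sq_eq_abs]

variable [MeasurableSpace M] [BorelSpace M]

theorem measurableSet_source (c : M) : MeasurableSet (extChartAt (𝓡∂ 3) c).source :=
  (isOpen_extChartAt_source c).measurableSet

/-- The inverse of a chart, as a map on the chart range, is a measurable embedding. -/
theorem measurableEmbedding_chartPoint (c : M) :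
    MeasurableEmbedding (fun y : chartRange c => chartPoint c y) where
  injective y z h := Subtype.ext <| by
    rw [← extChartAt_chartPoint c y.2, ← extChartAt_chartPoint c z.2]
    exact congrArg _ h
  measurable := (continuousOn_iff_continuous_domRestrict.1 (continuousOn_chartPoint c)).measurable
  measurableSet_image' := by
    intro s hs
    have h1 : Measurable (fun x : (extChartAt (𝓡∂ 3) c).source => extChartAt (𝓡∂ 3) c x) :=
      (continuousOn_iff_continuous_domRestrict.1 (continuousOn_extChartAt c)).measurable
    have h2 := (measurableSet_source c).subtype_image
      (h1 ((measurableSet_chartRange c).subtype_image hs))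
    convert h2 using 1
    ext x
    constructor
    · rintro ⟨y, hy, rfl⟩
      refine ⟨⟨_, chartPoint_mem c y.2⟩, ?_, rfl⟩
      exact ⟨y, hy, (extChartAt_chartPoint c y.2).symm⟩
    · rintro ⟨⟨z, hz⟩, ⟨y, hy, h⟩, rfl⟩
      refine ⟨y, hy, ?_⟩
      have h' : (y : E3) = extChartAt (𝓡∂ 3) c z := h
      simp only [h']
      exact (extChartAt (𝓡∂ 3) c).left_inv hz

/-- The coordinate measure `√(det g) dy` of the chart at `c`. -/
def coordVolume (g : SmoothMetric M) (c : M) : Measure E3 :=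
  ((volume : Measure E3).restrict (chartRange c)).withDensity
    (fun y => ENNReal.ofReal (volDensity g c y))

theorem aemeasurable_volDensity (g : SmoothMetric M) (c : M) :
    AEMeasurable (fun y => ENNReal.ofReal (volDensity g c y))
      ((volume : Measure E3).restrict (chartRange c)) :=
  ((continuousOn_volDensity g c).aemeasurable (measurableSet_chartRange c)).ennreal_ofReal

theorem coordVolume_absolutelyContinuous (g : SmoothMetric M) (c : M) :
    coordVolume g c ≪ (volume : Measure E3).restrict (chartRange c) :=
  withDensity_absolutelyContinuous _ _

theorem absolutelyContinuous_coordVolume (g : SmoothMetric M) (c : M) :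
    (volume : Measure E3).restrict (chartRange c) ≪ coordVolume g c := by
  refine withDensity_absolutelyContinuous' (aemeasurable_volDensity g c) ?_
  filter_upwards [ae_restrict_mem (measurableSet_chartRange c)] with y hy
  simpa using volDensity_pos g c hy

theorem coordVolume_restrict (g : SmoothMetric M) (c : M) :
    (coordVolume g c).restrict (chartRange c) = coordVolume g c := by
  rw [coordVolume, restrict_withDensity (measurableSet_chartRange c), Measure.restrict_restrict
    (measurableSet_chartRange c), Set.inter_self]

theorem map_comap_coordVolume (g : SmoothMetric M) (c : M) :
    ((coordVolume g c).comap ((↑) : chartRange c → E3)).map (↑) = coordVolume g c := by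
  rw [map_comap_subtype_coe (measurableSet_chartRange c), coordVolume_restrict]

theorem chartVolume_eq_map (g : SmoothMetric M) (c : M) :
    chartVolume g c = ((coordVolume g c).comap ((↑) : chartRange c → E3)).map
      (fun y : chartRange c => chartPoint c y) := by
  have h1 : chartVolume g c = (coordVolume g c).map (chartPoint c) := rfl
  have h2 : AEMeasurable (chartPoint c) (coordVolume g c) :=
    ((continuousOn_chartPoint c).aemeasurable (measurableSet_chartRange c)).mono_ac
      (coordVolume_absolutelyContinuous g c)
  rw [h1]
  conv_lhs => rw [← map_comap_coordVolume]
  rw [AEMeasurable.map_map_of_aemeasurable (by rwa [map_comap_coordVolume])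
    measurable_subtype_coe.aemeasurable]
  rfl

theorem ae_chartVolume_iff (g : SmoothMetric M) (c : M) {P : M → Prop} :
    (∀ᵐ x ∂(chartVolume g c), P x)
      ↔ ∀ᵐ y ∂(volume : Measure E3).restrict (chartRange c), P (chartPoint c y) := by
  rw [chartVolume_eq_map, (measurableEmbedding_chartPoint c).ae_map_iff,
    ← (MeasurableEmbedding.subtype_coe (measurableSet_chartRange c)).ae_map_iff
      (p := fun y => P (chartPoint c y)), map_comap_coordVolume]
  exact ⟨fun h => (absolutelyContinuous_coordVolume g c).ae_le h,
    fun h => (coordVolume_absolutelyContinuous g c).ae_le h⟩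

theorem lintegral_chartVolume (g : SmoothMetric M) (c : M) (F : M → ℝ≥0∞) :
    ∫⁻ x, F x ∂(chartVolume g c)
      = ∫⁻ y in chartRange c, ENNReal.ofReal (volDensity g c y) * F (chartPoint c y) := by
  rw [chartVolume_eq_map, (measurableEmbedding_chartPoint c).lintegral_map,
    ← (MeasurableEmbedding.subtype_coe (measurableSet_chartRange c)).lintegral_map
      (f := fun y => F (chartPoint c y)), map_comap_coordVolume, coordVolume]
  rw [lintegral_withDensity_eq_lintegral_mul_non_measurable₀ _ (aemeasurable_volDensity g c)
    (by simp)]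
  rfl

theorem integral_chartVolume (g : SmoothMetric M) (c : M) (F : M → ℝ) :
    ∫ x, F x ∂(chartVolume g c)
      = ∫ y in chartRange c, volDensity g c y * F (chartPoint c y) := by
  rw [chartVolume_eq_map, (measurableEmbedding_chartPoint c).integral_map,
    ← (MeasurableEmbedding.subtype_coe (measurableSet_chartRange c)).integral_map
      (g := fun y => F (chartPoint c y)), map_comap_coordVolume, coordVolume]
  rw [integral_withDensity_eq_integral_toReal_smul₀ (aemeasurable_volDensity g c) (by simp)]
  simp [ENNReal.toReal_ofReal (volDensity_nonneg g c _)]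

theorem aestronglyMeasurable_chartVolume_iff (g : SmoothMetric M) (c : M) {F : M → ℝ} :
    AEStronglyMeasurable F (chartVolume g c)
      ↔ AEStronglyMeasurable (fun y => F (chartPoint c y))
        ((volume : Measure E3).restrict (chartRange c)) := by
  rw [chartVolume_eq_map, (measurableEmbedding_chartPoint c).aestronglyMeasurable_map_iff,
    show (F ∘ fun y : chartRange c => chartPoint c y)
      = (fun y => F (chartPoint c y)) ∘ ((↑) : chartRange c → E3) from rfl,
    ← (MeasurableEmbedding.subtype_coe (measurableSet_chartRange c)).aestronglyMeasurable_map_iff,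
    map_comap_coordVolume]
  exact ⟨fun h => h.mono_ac (absolutelyContinuous_coordVolume g c),
    fun h => h.mono_ac (coordVolume_absolutelyContinuous g c)⟩

theorem chartVolume_apply (g : SmoothMetric M) (c : M) {A : Set M} (hA : MeasurableSet A) :
    chartVolume g c A
      = ∫⁻ y in chartRange c ∩ chartPoint c ⁻¹' A, ENNReal.ofReal (volDensity g c y) := by
  have hm : MeasurableSet (chartRange c ∩ chartPoint c ⁻¹' A) := by
    have h2 := (measurableSet_chartRange c).subtype_image
      ((measurableEmbedding_chartPoint c).measurable hA)
    convert h2 using 1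
    ext y
    exact ⟨fun h => ⟨⟨y, h.1⟩, h.2, rfl⟩, by rintro ⟨z, hz, rfl⟩; exact ⟨z.2, hz⟩⟩
  rw [← lintegral_indicator_one hA, lintegral_chartVolume, ← lintegral_indicator hm,
    ← lintegral_indicator (measurableSet_chartRange c)]
  refine lintegral_congr fun y => ?_
  by_cases h1 : y ∈ chartRange c <;> by_cases h2 : chartPoint c y ∈ A <;> simp [h1, h2]

theorem chartVolume_apply_compl_source (g : SmoothMetric M) (c : M) :
    chartVolume g c (extChartAt (𝓡∂ 3) c).sourceᶜ = 0 := by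
  rw [chartVolume_apply g c (measurableSet_source c).compl]
  have : chartRange c ∩ chartPoint c ⁻¹' (extChartAt (𝓡∂ 3) c).sourceᶜ = ∅ := by
    ext y
    simp only [Set.mem_inter_iff, Set.mem_preimage, Set.mem_compl_iff, Set.mem_empty_iff_false,
      iff_false, not_and, not_not]
    exact fun h => chartPoint_mem c h
  rw [this]
  simp

/-- The volumes of two charts agree where both are defined. -/
theorem chartVolume_apply_eq (g : SmoothMetric M) (c c' : M) {A : Set M} (hA : MeasurableSet A)
    (h : A ⊆ (extChartAt (𝓡∂ 3) c).source) (h' : A ⊆ (extChartAt (𝓡∂ 3) c').source) :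
    chartVolume g c A = chartVolume g c' A := by
  have hm : MeasurableSet (chartRange c ∩ chartPoint c ⁻¹' A) := by
    have h2 := (measurableSet_chartRange c).subtype_image
      ((measurableEmbedding_chartPoint c).measurable hA)
    convert h2 using 1
    ext y
    exact ⟨fun h => ⟨⟨y, h.1⟩, h.2, rfl⟩, by rintro ⟨z, hz, rfl⟩; exact ⟨z.2, hz⟩⟩
  rw [chartVolume_apply g c hA, chartVolume_apply g c' hA]
  have himg : chartRange c' ∩ chartPoint c' ⁻¹' A
      = (fun y => extChartAt (𝓡∂ 3) c' (chartPoint c y)) '' (chartRange c ∩ chartPoint c ⁻¹' A) := by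
    ext z
    constructor
    · rintro ⟨hz, hzA⟩
      have hz' : chartPoint c' z ∈ A := hzA
      refine ⟨extChartAt (𝓡∂ 3) c (chartPoint c' z), ⟨?_, ?_⟩, ?_⟩
      · exact (extChartAt (𝓡∂ 3) c).map_source (h hz')
      · have : chartPoint c (extChartAt (𝓡∂ 3) c (chartPoint c' z)) = chartPoint c' z :=
          (extChartAt (𝓡∂ 3) c).left_inv (h hz')
        simpa only [Set.mem_preimage, this] using hz'
      · have : chartPoint c (extChartAt (𝓡∂ 3) c (chartPoint c' z)) = chartPoint c' z :=
          (extChartAt (𝓡∂ 3) c).left_inv (h hz')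
        simp only [this]
        exact extChartAt_chartPoint c' hz
    · rintro ⟨y, ⟨hy, hyA⟩, rfl⟩
      have hy' : chartPoint c y ∈ A := hyA
      refine ⟨(extChartAt (𝓡∂ 3) c').map_source (h' hy'), ?_⟩
      have : chartPoint c' (extChartAt (𝓡∂ 3) c' (chartPoint c y)) = chartPoint c y :=
        (extChartAt (𝓡∂ 3) c').left_inv (h' hy')
      simpa only [Set.mem_preimage, this] using hy'
  -- Change of variables by the transition map. At boundary points its derivative is one-sided, which
  -- is all that the formula asks for.
  rw [himg, lintegral_image_eq_lintegral_abs_det_fderiv_mul volume hm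
    (f' := fun y => tangentCoordChange (𝓡∂ 3) c c' (chartPoint c y))]
  · refine setLIntegral_congr_fun hm fun y hy => ?_
    have hyA : chartPoint c y ∈ A := hy.2
    have hz : chartPoint c' (extChartAt (𝓡∂ 3) c' (chartPoint c y)) = chartPoint c y :=
      (extChartAt (𝓡∂ 3) c').left_inv (h' hyA)
    simp only [volDensity, hz]
    rw [sqrt_gram_det_change g c c' (h hyA) (h' hyA), ENNReal.ofReal_mul (abs_nonneg _)]
  · intro y hy
    have hyA : chartPoint c y ∈ A := hy.2
    have := hasFDerivWithinAt_tangentCoordChange (I := 𝓡∂ 3) (x := c) (y := c')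
      (z := chartPoint c y) ⟨h hyA, h' hyA⟩
    rw [extChartAt_chartPoint c hy.1] at this
    exact this.mono fun z hz => extChartAt_target_subset_range c hz.1
  · intro y hy z hz hyz
    have hyA : chartPoint c y ∈ A := hy.2
    have hzA : chartPoint c z ∈ A := hz.2
    have := (extChartAt (𝓡∂ 3) c').injOn (h' hyA) (h' hzA) hyz
    rw [← extChartAt_chartPoint c hy.1, ← extChartAt_chartPoint c hz.1, this]

theorem chartVolume_le_vol (g : SmoothMetric M) (c : M) : chartVolume g c ≤ vol g :=
  le_iSup (fun c => chartVolume g c) c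

/-- On the domain of a chart, the Riemannian volume is the volume of the chart. -/
theorem vol_restrict_source (g : SmoothMetric M) (c : M) :
    (vol g).restrict (extChartAt (𝓡∂ 3) c).source = chartVolume g c := by
  have hs := measurableSet_source c
  have key : vol g ≤ chartVolume g c + (vol g).restrict (extChartAt (𝓡∂ 3) c).sourceᶜ := by
    refine iSup_le fun c' => Measure.le_iff.2 fun A hA => ?_
    rw [← measure_inter_add_sdiff A hs, Measure.add_apply, Measure.restrict_apply hA]
    refine add_le_add ?_ (chartVolume_le_vol g c' _)
    have hs' := measurableSet_source c'
    rw [← measure_inter_add_sdiff (A ∩ (extChartAt (𝓡∂ 3) c).source) hs']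
    have h0 : chartVolume g c' ((A ∩ (extChartAt (𝓡∂ 3) c).source)
        \ (extChartAt (𝓡∂ 3) c').source) = 0 :=
      measure_mono_null (fun x hx => hx.2) (chartVolume_apply_compl_source g c')
    rw [h0, add_zero]
    rw [chartVolume_apply_eq g c' c ((hA.inter hs).inter hs') (fun x hx => hx.2)
      (fun x hx => hx.1.2)]
    exact measure_mono fun x hx => hx.1.1
  ext A hA
  rw [Measure.restrict_apply hA]
  apply le_antisymm
  · refine (key _).trans ?_
    rw [Measure.add_apply, Measure.restrict_apply (hA.inter hs)]
    rw [show A ∩ (extChartAt (𝓡∂ 3) c).source ∩ (extChartAt (𝓡∂ 3) c).sourceᶜ = ∅ by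
      ext x; simp]
    rw [measure_empty, add_zero]
    exact measure_mono Set.inter_subset_left
  · have h0 : chartVolume g c (A \ (extChartAt (𝓡∂ 3) c).source) = 0 :=
      measure_mono_null (fun x hx => hx.2) (chartVolume_apply_compl_source g c)
    rw [← measure_inter_add_sdiff A hs, h0, add_zero]
    exact chartVolume_le_vol g c _

/-- A property holds almost everywhere if it does in coordinates. -/
theorem ae_vol_iff [CompactSpace M] (g : SmoothMetric M) {P : M → Prop} :
    (∀ᵐ x ∂(vol g), P x)
      ↔ ∀ c : M, ∀ᵐ y ∂(volume : Measure E3).restrict (chartRange c), P (chartPoint c y) := by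
  simp only [← ae_chartVolume_iff g]
  refine ⟨fun h c => ae_mono (chartVolume_le_vol g c) h, fun h => ?_⟩
  obtain ⟨t, ht⟩ := isCompact_univ.elim_finite_subcover
    (fun c : M => (extChartAt (𝓡∂ 3) c).source) (fun c => isOpen_extChartAt_source c)
    (fun x _ => Set.mem_iUnion.2 ⟨x, mem_extChartAt_source x⟩)
  rw [← Measure.restrict_univ (μ := vol g), ← Set.univ_subset_iff.1 ht]
  rw [ae_restrict_biUnion_finset_iff]
  intro c _
  rw [vol_restrict_source]
  exact h c

theorem aestronglyMeasurable_vol_iff [CompactSpace M] (g : SmoothMetric M) {F : M → ℝ} :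
    AEStronglyMeasurable F (vol g)
      ↔ ∀ c : M, AEStronglyMeasurable (fun y => F (chartPoint c y))
        ((volume : Measure E3).restrict (chartRange c)) := by
  simp only [← aestronglyMeasurable_chartVolume_iff g]
  refine ⟨fun h c => h.mono_measure (chartVolume_le_vol g c), fun h => ?_⟩
  obtain ⟨t, ht⟩ := isCompact_univ.elim_finite_subcover
    (fun c : M => (extChartAt (𝓡∂ 3) c).source) (fun c => isOpen_extChartAt_source c)
    (fun x _ => Set.mem_iUnion.2 ⟨x, mem_extChartAt_source x⟩)
  have ht' : ⋃ c : t, (extChartAt (𝓡∂ 3) (c : M)).source = Set.univ := by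
    rw [← Set.univ_subset_iff]
    refine ht.trans fun x hx => ?_
    obtain ⟨c, hc, hx⟩ := Set.mem_iUnion₂.1 hx
    exact Set.mem_iUnion.2 ⟨⟨c, hc⟩, hx⟩
  rw [← Measure.restrict_univ (μ := vol g), ← ht', aestronglyMeasurable_iUnion_iff]
  intro c
  rw [vol_restrict_source]
  exact h c

/-- The integral of a function which vanishes off a chart domain, in coordinates. -/
theorem integral_vol_eq (g : SmoothMetric M) (c : M) {F : M → ℝ}
    (hF : ∀ x, x ∉ (extChartAt (𝓡∂ 3) c).source → F x = 0) :
    ∫ x, F x ∂(vol g) = ∫ y in chartRange c, volDensity g c y * F (chartPoint c y) := by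
  rw [← integral_chartVolume, ← vol_restrict_source,
    setIntegral_eq_integral_of_forall_compl_eq_zero hF]

/-- Integrability of a function vanishing off a chart domain can be tested in the chart. -/
theorem integrable_vol_of_chart (g : SmoothMetric M) (c : M) {F : M → ℝ}
    (hF : ∀ x, x ∉ (extChartAt (𝓡∂ 3) c).source → F x = 0)
    (hi : IntegrableOn (fun y => volDensity g c y * F (chartPoint c y)) (chartRange c)) :
    Integrable F (vol g) := by
  have h1 : IntegrableOn F (extChartAt (𝓡∂ 3) c).source (vol g) := by
    rw [IntegrableOn, vol_restrict_source, chartVolume_eq_map,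
      (measurableEmbedding_chartPoint c).integrable_map_iff,
      show (F ∘ fun y : chartRange c => chartPoint c y)
        = (fun y => F (chartPoint c y)) ∘ ((↑) : chartRange c → E3) from rfl,
      ← (MeasurableEmbedding.subtype_coe (measurableSet_chartRange c)).integrable_map_iff,
      map_comap_coordVolume, coordVolume,
      integrable_withDensity_iff_integrable_smul₀' (aemeasurable_volDensity g c) (by simp)]
    simpa [ENNReal.toReal_ofReal (volDensity_nonneg g c _), IntegrableOn] using hi
  exact (integrableOn_iff_integrable_of_support_subset
    fun x hx => by_contra fun h => hx (hF x h)).1 h1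

/-- Since `chartVolume g c ≤ vol g`, an integral in coordinates is at most the integral over `M`. -/
theorem setLIntegral_vol_le (g : SmoothMetric M) (c : M) (F : M → ℝ≥0∞) :
    ∫⁻ y in chartRange c, ENNReal.ofReal (volDensity g c y) * F (chartPoint c y)
      ≤ ∫⁻ x, F x ∂(vol g) := by
  rw [← lintegral_chartVolume]
  exact lintegral_mono' (chartVolume_le_vol g c) le_rfl

end Volume

/-! ### Pointwise inner products of forms -/

section PointwiseInner

variable {M : Type*} [TopologicalSpace M] [ChartedSpace (EuclideanHalfSpace 3) M]
  [IsManifold (𝓡∂ 3) ∞ M]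
  {n : ℕ} {K : Type*} [TopologicalSpace K] [ChartedSpace (EuclideanSpace ℝ (Fin n)) K] [Group K]
  {p : ℕ}

theorem isPosForm_inner (κ : AdInvariantInner n K) : IsPosForm κ.inner := ⟨κ.symm, κ.pos⟩

/-- The standard basis of the Lie algebra, regarded as the model space. -/
def lieBasis (n : ℕ) (K : Type*) [TopologicalSpace K] [ChartedSpace (EuclideanSpace ℝ (Fin n)) K]
    [Group K] : Module.Basis (Fin n) ℝ (GroupLieAlgebra (𝓡 n) K) :=
  (EuclideanSpace.basisFun (Fin n) ℝ).toBasis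

theorem lieBasis_repr (w : EuclideanSpace ℝ (Fin n)) (m : Fin n) :
    (lieBasis n K).repr w m = w m :=
  EuclideanSpace.basisFun_repr (ι := Fin n) (𝕜 := ℝ) w m

theorem inner_expand (κ : AdInvariantInner n K) (a b : EuclideanSpace ℝ (Fin n)) :
    κ.inner a b = ∑ m, ∑ l, a m * b l * κ.inner (lieBasis n K m) (lieBasis n K l) := by
  conv_lhs => rw [← (lieBasis n K).sum_repr a, ← (lieBasis n K).sum_repr b]
  simp only [map_sum, map_smul, LinearMap.sum_apply, LinearMap.smul_apply, smul_eq_mul,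
    lieBasis_repr, Finset.mul_sum]
  rw [Finset.sum_comm]
  refine Finset.sum_congr rfl fun m _ => Finset.sum_congr rfl fun l _ => ?_
  ring

theorem covInner_eq_frameInner (g : SmoothMetric M) (κ : AdInvariantInner n K) (c : M) {x : M}
    (hx : x ∈ (extChartAt (𝓡∂ 3) c).source)
    (u v : (TangentSpace (𝓡∂ 3) x) [⋀^Fin p]→ₗ[ℝ] GroupLieAlgebra (𝓡 n) K) :
    covInner g κ x u v
      = (1 / (p.factorial : ℝ)) * frameInner (metricForm g x) κ.inner (frame c x) u v := by
  have h := frameInner_basis_change (metricForm g x) κ.inner (frameBasis c hx)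
    (frameBasis x (mem_extChartAt_source x)) u v
  rw [coe_frameBasis, coe_frameBasis] at h
  rw [← h]
  rfl

/-- The inner product of forms at a point, as a bilinear form. -/
def covForm (p : ℕ) (g : SmoothMetric M) (κ : AdInvariantInner n K) (x : M) :
    ((TangentSpace (𝓡∂ 3) x) [⋀^Fin p]→ₗ[ℝ] GroupLieAlgebra (𝓡 n) K) →ₗ[ℝ]
      ((TangentSpace (𝓡∂ 3) x) [⋀^Fin p]→ₗ[ℝ] GroupLieAlgebra (𝓡 n) K) →ₗ[ℝ] ℝ :=
  (1 / (p.factorial : ℝ)) • frameForm (metricForm g x) κ.inner (frame x x)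

theorem covForm_apply (g : SmoothMetric M) (κ : AdInvariantInner n K) (x : M)
    (u v : (TangentSpace (𝓡∂ 3) x) [⋀^Fin p]→ₗ[ℝ] GroupLieAlgebra (𝓡 n) K) :
    covForm p g κ x u v = covInner g κ x u v := rfl

theorem covInner_eq_basis (g : SmoothMetric M) (κ : AdInvariantInner n K) (x : M)
    (u v : (TangentSpace (𝓡∂ 3) x) [⋀^Fin p]→ₗ[ℝ] GroupLieAlgebra (𝓡 n) K) :
    covInner g κ x u v = (1 / (p.factorial : ℝ)) *
      frameInner (metricForm g x) κ.inner (frameBasis x (mem_extChartAt_source x)) u v := by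
  rw [coe_frameBasis]; rfl

theorem factorial_inv_pos (p : ℕ) : 0 < 1 / (p.factorial : ℝ) := by positivity

theorem isPosForm_covForm (g : SmoothMetric M) (κ : AdInvariantInner n K) (x : M) :
    IsPosForm (covForm p g κ x) := by
  have hγ := isPosForm_metricForm g x
  have hκ := isPosForm_inner κ
  refine ⟨fun u v => ?_, fun u hu => ?_⟩
  · rw [covForm_apply, covForm_apply, covInner_eq_basis, covInner_eq_basis,
      hγ.frameInner_symm hκ.symm]
  · rw [covForm_apply, covInner_eq_basis]
    refine mul_pos (factorial_inv_pos p) (lt_of_le_of_ne (hγ.frameInner_nonneg hκ.nonneg _ u) ?_)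
    intro h
    exact hu (hγ.eq_zero_of_frameInner hκ _ h.symm)

variable (g : SmoothMetric M) (κ : AdInvariantInner n K) (x : M)
  (u v w : (TangentSpace (𝓡∂ 3) x) [⋀^Fin p]→ₗ[ℝ] GroupLieAlgebra (𝓡 n) K)

theorem covInner_nonneg : 0 ≤ covInner g κ x u u := (isPosForm_covForm g κ x).nonneg u

theorem covInner_comm : covInner g κ x u v = covInner g κ x v u := (isPosForm_covForm g κ x).symm u v

theorem covInner_add_left : covInner g κ x (u + v) w = covInner g κ x u w + covInner g κ x v w := by
  simp only [← covForm_apply, map_add, LinearMap.add_apply]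

theorem covInner_sub_left : covInner g κ x (u - v) w = covInner g κ x u w - covInner g κ x v w := by
  simp only [← covForm_apply, map_sub, LinearMap.sub_apply]

theorem covInner_smul_left (r : ℝ) : covInner g κ x (r • u) v = r * covInner g κ x u v := by
  simp only [← covForm_apply, map_smul, LinearMap.smul_apply, smul_eq_mul]

theorem covInner_add_right : covInner g κ x u (v + w) = covInner g κ x u v + covInner g κ x u w := by
  simp only [← covForm_apply, map_add]

theorem covInner_sub_right : covInner g κ x u (v - w) = covInner g κ x u v - covInner g κ x u w := by
  simp only [← covForm_apply, map_sub]

theorem covInner_smul_right (r : ℝ) : covInner g κ x u (r • v) = r * covInner g κ x u v := by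
  simp only [← covForm_apply, map_smul, smul_eq_mul]

/-- The Cauchy–Schwarz inequality. -/
theorem covInner_sq_le :
    covInner g κ x u v ^ 2 ≤ covInner g κ x u u * covInner g κ x v v :=
  LinearMap.BilinForm.apply_sq_le_of_symm (covForm p g κ x) (isPosForm_covForm g κ x).nonneg
    ⟨fun X Y => by simpa using (isPosForm_covForm g κ x).symm X Y⟩ u v

/-- The weighted inequality of arithmetic and geometric means. -/
theorem abs_covInner_le {r : ℝ} (hr : 0 < r) :
    |covInner g κ x u v| ≤ (r * covInner g κ x u u + r⁻¹ * covInner g κ x v v) / 2 := by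
  have h1 := covInner_sq_le g κ x u v
  have hu := covInner_nonneg g κ x u
  have hv := covInner_nonneg g κ x v
  have hri : 0 < r⁻¹ := inv_pos.2 hr
  refine abs_le_of_sq_le_sq ?_ (by positivity)
  have h2 : r * r⁻¹ = 1 := mul_inv_cancel₀ hr.ne'
  nlinarith [sq_nonneg (r * covInner g κ x u u - r⁻¹ * covInner g κ x v v)]

/-- The value of a form on coordinate vector fields is bounded by its norm. -/
theorem inner_frame_le (c : M) (hx : x ∈ (extChartAt (𝓡∂ 3) c).source) (J : Fin p → Fin 3) :
    κ.inner (u fun k => frame c x (J k)) (u fun k => frame c x (J k))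
      ≤ (∏ k, gram g c x (J k) (J k)) * (p.factorial * covInner g κ x u u) := by
  have hκ := isPosForm_inner κ
  have h := (isPosForm_metricForm g x).frameInner_eval_le hκ.nonneg hκ.symm (frameBasis c hx) u
    (fun k => frame c x (J k))
  rw [coe_frameBasis] at h
  refine h.trans_eq ?_
  rw [covInner_eq_frameInner g κ c hx]
  have : (p.factorial : ℝ) ≠ 0 := by positivity
  field_simp
  rw [mul_comm]
  rfl

/-- `|∇_X θ|² ≤ |X|² |∇θ|²` for a tensor `N = ∇θ`. -/
theorem covInner_tensor_le (N : TangentSpace (𝓡∂ 3) x →ₗ[ℝ]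
      (TangentSpace (𝓡∂ 3) x) [⋀^Fin p]→ₗ[ℝ] GroupLieAlgebra (𝓡 n) K) (X : TangentSpace (𝓡∂ 3) x) :
    covInner g κ x (N X) (N X) ≤ g.inner x X X * tensorNormSq g κ x N := by
  have hγ := isPosForm_metricForm g x
  have hc := isPosForm_covForm (p := p) g κ x
  obtain ⟨e, he⟩ := hγ.exists_orthonormal (frameBasis x (mem_extChartAt_source x))
  have h1 : tensorNormSq g κ x N = ∑ i, covForm p g κ x (N (e i)) (N (e i)) := by
    have := IsPosForm.sum_inv_gramOf ((covForm p g κ x).compl₁₂ N N)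
      (frameBasis x (mem_extChartAt_source x)) e he
    rw [coe_frameBasis] at this
    exact this
  rw [h1]
  have h2 : N X = ∑ i, metricForm g x (e i) X • N (e i) := by
    conv_lhs => rw [IsPosForm.orthonormal_expand he X]
    simp
  rw [← covForm_apply]
  conv_lhs => rw [h2]
  refine (IsPosForm.sum_smul_le hc.nonneg hc.symm _ _).trans_eq ?_
  rw [IsPosForm.orthonormal_sq he]
  rfl

theorem tensorNormSq_nonneg (N : TangentSpace (𝓡∂ 3) x →ₗ[ℝ]
      (TangentSpace (𝓡∂ 3) x) [⋀^Fin p]→ₗ[ℝ] GroupLieAlgebra (𝓡 n) K) :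
    0 ≤ tensorNormSq g κ x N := by
  have hγ := isPosForm_metricForm g x
  obtain ⟨e, he⟩ := hγ.exists_orthonormal (frameBasis x (mem_extChartAt_source x))
  have := IsPosForm.sum_inv_gramOf ((covForm p g κ x).compl₁₂ N N)
      (frameBasis x (mem_extChartAt_source x)) e he
  rw [coe_frameBasis] at this
  refine le_of_le_of_eq ?_ this.symm
  exact Finset.sum_nonneg fun i _ => (isPosForm_covForm g κ x).nonneg _

end PointwiseInner

section BracketBound

variable {M : Type*} [TopologicalSpace M] [ChartedSpace (EuclideanHalfSpace 3) M]
  [IsManifold (𝓡∂ 3) ∞ M]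
  {n : ℕ} {K : Type*} [TopologicalSpace K] [ChartedSpace (EuclideanSpace ℝ (Fin n)) K] [Group K]
  [LieGroup (𝓡 n) ∞ K]

/-- The Lie bracket as a bilinear map. -/
def lieBilin (n : ℕ) (K : Type*) [TopologicalSpace K] [ChartedSpace (EuclideanSpace ℝ (Fin n)) K]
    [Group K] [LieGroup (𝓡 n) ∞ K] : GroupLieAlgebra (𝓡 n) K →ₗ[ℝ] GroupLieAlgebra (𝓡 n) K →ₗ[ℝ]
      GroupLieAlgebra (𝓡 n) K :=
  LinearMap.mk₂ ℝ (fun X Y => ⁅X, Y⁆) (fun X X' Y => add_lie X X' Y) (fun a X Y => smul_lie a X Y)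
    (fun X Y Y' => lie_add X Y Y') (fun a X Y => lie_smul a X Y)

/-- The pointwise bound `|[u ∧ v]|² ≤ C |u|² |v|²`. The constant does not depend on the point, since
the inner products may be computed in an orthonormal frame, where only the structure constants of
the Lie algebra enter. -/
theorem exists_bracketWedge_bound (g : SmoothMetric M) (κ : AdInvariantInner n K) :
    ∃ C : ℝ, 0 ≤ C ∧ ∀ (x : M)
      (u v : (TangentSpace (𝓡∂ 3) x) [⋀^Fin 1]→ₗ[ℝ] GroupLieAlgebra (𝓡 n) K),
      covInner g κ x (bracketWedge u v) (bracketWedge u v)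
        ≤ C * (covInner g κ x u u * covInner g κ x v v) := by
  have hκ := isPosForm_inner κ
  obtain ⟨C, hC, hb⟩ := hκ.exists_bilinear_bound (lieBasis n K) (lieBilin n K)
  refine ⟨2 * C, by positivity, fun x u v => ?_⟩
  have h := (isPosForm_metricForm g x).frameInner_wedge_le hκ.nonneg hb
    (frameBasis x (mem_extChartAt_source x)) u v (bracketWedge u v) (fun X => rfl)
  rw [covInner_eq_basis, covInner_eq_basis, covInner_eq_basis]
  norm_num
  linarith

end BracketBound

/-! ### Measurable and square integrable forms -/

section L2Forms

variable {M : Type*} [TopologicalSpace M] [ChartedSpace (EuclideanHalfSpace 3) M]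
  [IsManifold (𝓡∂ 3) ∞ M]
  {n : ℕ} {K : Type*} [TopologicalSpace K] [ChartedSpace (EuclideanSpace ℝ (Fin n)) K] [Group K]
  {p : ℕ}

theorem MeasurableForm.add {θ η : KForm M n K p} (hθ : MeasurableForm θ) (hη : MeasurableForm η) :
    MeasurableForm (θ + η) := fun c J => (hθ c J).add (hη c J)

theorem MeasurableForm.smul {θ : KForm M n K p} (hθ : MeasurableForm θ) (r : ℝ) :
    MeasurableForm (r • θ) := fun c J => (hθ c J).const_smul r

theorem MeasurableForm.coord {θ : KForm M n K p} (hθ : MeasurableForm θ) (c : M)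
    (J : Fin p → Fin 3) (m : Fin n) :
    AEStronglyMeasurable (fun y => comp θ c J y m)
      ((volume : Measure E3).restrict (chartRange c)) :=
  (EuclideanSpace.proj (𝕜 := ℝ) m).continuous.comp_aestronglyMeasurable (hθ c J)

theorem covInner_chartPoint (g : SmoothMetric M) (κ : AdInvariantInner n K) (θ η : KForm M n K p)
    (c : M) {y : E3} (hy : y ∈ chartRange c) :
    covInner g κ (chartPoint c y) (θ (chartPoint c y)) (η (chartPoint c y))
      = (1 / (p.factorial : ℝ)) * ∑ I : Fin p → Fin 3, ∑ J : Fin p → Fin 3,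
        (∏ k, (gram g c (chartPoint c y))⁻¹ (I k) (J k)) *
          κ.inner (comp θ c I y) (comp η c J y) := by
  rw [covInner_eq_frameInner g κ c (chartPoint_mem c hy)]
  rfl

variable [MeasurableSpace M] [BorelSpace M] [CompactSpace M]

theorem aestronglyMeasurable_covInner (g : SmoothMetric M) (κ : AdInvariantInner n K)
    {θ η : KForm M n K p} (hθ : MeasurableForm θ) (hη : MeasurableForm η) :
    AEStronglyMeasurable (fun x => covInner g κ x (θ x) (η x)) (vol g) := by
  refine (aestronglyMeasurable_vol_iff g).2 fun c => ?_
  have h : AEStronglyMeasurable (fun y => (1 / (p.factorial : ℝ)) * ∑ I : Fin p → Fin 3,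
      ∑ J : Fin p → Fin 3, (∏ k, (gram g c (chartPoint c y))⁻¹ (I k) (J k)) *
        κ.inner (comp θ c I y) (comp η c J y)) ((volume : Measure E3).restrict (chartRange c)) := by
    refine (Finset.aestronglyMeasurable_fun_sum _ fun I _ =>
      Finset.aestronglyMeasurable_fun_sum _ fun J _ => ?_).const_mul _
    refine AEStronglyMeasurable.mul ?_ ?_
    · exact (continuousOn_finsetProd _ fun k _ =>
        continuousOn_gram_inv g c (I k) (J k)).aestronglyMeasurable (measurableSet_chartRange c)
    · simp only [inner_expand κ (comp θ c I _)]
      exact Finset.aestronglyMeasurable_fun_sum _ fun m _ =>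
        Finset.aestronglyMeasurable_fun_sum _ fun l _ =>
          ((hθ.coord c I m).mul (hη.coord c J l)).mul_const _
  refine h.congr ?_
  filter_upwards [ae_restrict_mem (measurableSet_chartRange c)] with y hy
  rw [covInner_chartPoint g κ θ η c hy]

variable {g : SmoothMetric M} {κ : AdInvariantInner n K}

theorem MemL2.integrable_self {θ : KForm M n K p} (hθ : MemL2 g κ θ) :
    Integrable (fun x => covInner g κ x (θ x) (θ x)) (vol g) := by
  refine ⟨aestronglyMeasurable_covInner g κ hθ.1 hθ.1, ?_⟩
  rw [hasFiniteIntegral_iff_ofReal (Filter.Eventually.of_forall fun x => covInner_nonneg g κ x _)]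
  exact hθ.2

theorem MemL2.l2NormSq_eq {θ : KForm M n K p} (hθ : MemL2 g κ θ) :
    l2NormSq g κ θ = ENNReal.ofReal (l2Inner g κ θ θ) :=
  (ofReal_integral_eq_lintegral_ofReal hθ.integrable_self
    (Filter.Eventually.of_forall fun x => covInner_nonneg g κ x _)).symm

theorem l2Inner_nonneg (θ : KForm M n K p) : 0 ≤ l2Inner g κ θ θ :=
  integral_nonneg fun x => covInner_nonneg g κ x _

theorem MemL2.integrable {θ η : KForm M n K p} (hθ : MemL2 g κ θ) (hη : MemL2 g κ η) :
    Integrable (fun x => covInner g κ x (θ x) (η x)) (vol g) := by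
  refine Integrable.mono' ((hθ.integrable_self.add hη.integrable_self).div_const 2)
    (aestronglyMeasurable_covInner g κ hθ.1 hη.1) (Filter.Eventually.of_forall fun x => ?_)
  have := abs_covInner_le g κ x (θ x) (η x) one_pos
  simpa using this

theorem memL2_of_integrable {θ : KForm M n K p} (hm : MeasurableForm θ)
    (hi : Integrable (fun x => covInner g κ x (θ x) (θ x)) (vol g)) : MemL2 g κ θ :=
  ⟨hm, (hasFiniteIntegral_iff_ofReal
    (Filter.Eventually.of_forall fun x => covInner_nonneg g κ x _)).1 hi.2⟩

theorem MemL2.add {θ η : KForm M n K p} (hθ : MemL2 g κ θ) (hη : MemL2 g κ η) :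
    MemL2 g κ (θ + η) := by
  refine memL2_of_integrable (hθ.1.add hη.1) ?_
  have := ((hθ.integrable_self.add (hθ.integrable hη)).add (hη.integrable hθ)).add
    hη.integrable_self
  refine this.congr (Filter.Eventually.of_forall fun x => ?_)
  simp only [Pi.add_apply, covInner_add_left, covInner_add_right]
  ring

theorem MemL2.smul {θ : KForm M n K p} (hθ : MemL2 g κ θ) (r : ℝ) : MemL2 g κ (r • θ) := by
  refine memL2_of_integrable (hθ.1.smul r) ?_
  refine (hθ.integrable_self.const_mul (r * r)).congr (Filter.Eventually.of_forall fun x => ?_)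
  simp only [Pi.smul_apply, covInner_smul_left, covInner_smul_right]
  ring

theorem MemL2.sub {θ η : KForm M n K p} (hθ : MemL2 g κ θ) (hη : MemL2 g κ η) :
    MemL2 g κ (θ - η) := by
  rw [show θ - η = θ + (-1 : ℝ) • η by simp [sub_eq_add_neg]]
  exact hθ.add (hη.smul _)

theorem sameForm_zero_of_l2Inner {θ : KForm M n K p} (hθ : MemL2 g κ θ) (h : l2Inner g κ θ θ = 0) :
    SameForm g θ 0 := by
  have := (integral_eq_zero_iff_of_nonneg (fun x => covInner_nonneg g κ x _)
    hθ.integrable_self).1 h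
  filter_upwards [this] with x hx
  exact (isPosForm_covForm g κ x).eq_zero hx

/-- The pointwise norm is bounded by the supremum norm. -/
theorem covInner_le_of_supNorm_le {θ : KForm M n K p} {C : ℝ} (hC : 0 ≤ C)
    (h : supNorm g κ θ ≤ ENNReal.ofReal C) :
    ∀ᵐ x ∂(vol g), covInner g κ x (θ x) (θ x) ≤ C ^ 2 := by
  have := ae_le_essSup (μ := vol g) (f := fun x => ENNReal.ofReal (√(covInner g κ x (θ x) (θ x))))
  filter_upwards [this] with x hx
  have h1 := hx.trans h
  rw [ENNReal.ofReal_le_ofReal_iff hC] at h1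
  exact (Real.sqrt_le_left hC).1 h1

theorem MemW1.memL2 {θ : KForm M n K p} (hθ : MemW1 g κ θ) : MemL2 g κ θ := by
  refine ⟨hθ.1, lt_of_le_of_lt ?_ hθ.2⟩
  exact le_iInf₂ fun _ _ => le_add_self

theorem l2NormSq_le_sobolevNormSq (θ : KForm M n K p) : l2NormSq g κ θ ≤ sobolevNormSq g κ θ :=
  le_iInf₂ fun _ _ => le_add_self

end L2Forms

/-! ### Components of square integrable forms -/

section Components

variable {M : Type*} [TopologicalSpace M] [ChartedSpace (EuclideanHalfSpace 3) M]
  [IsManifold (𝓡∂ 3) ∞ M]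
  {n : ℕ} {K : Type*} [TopologicalSpace K] [ChartedSpace (EuclideanSpace ℝ (Fin n)) K] [Group K]
  {p : ℕ} [MeasurableSpace M] [BorelSpace M] [CompactSpace M]
  {g : SmoothMetric M} {κ : AdInvariantInner n K}

/-- The coordinates of `ℝ^n` are controlled by the given inner product of the Lie algebra. -/
theorem exists_coord_bound (κ : AdInvariantInner n K) :
    ∃ C : ℝ, 0 ≤ C ∧ ∀ (m : Fin n) (w : EuclideanSpace ℝ (Fin n)), w m ^ 2 ≤ C * κ.inner w w := by
  choose C hC hb using fun m => (isPosForm_inner κ).exists_functional_bound (lieBasis n K)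
    ((lieBasis n K).coord m)
  refine ⟨∑ m, C m, Finset.sum_nonneg fun m _ => hC m, fun m w => ?_⟩
  have h0 : (lieBasis n K).coord m w = w m := lieBasis_repr (K := K) w m
  have h1 := hb m w
  rw [h0] at h1
  refine h1.trans ?_
  exact mul_le_mul_of_nonneg_right (Finset.single_le_sum (fun i _ => hC i) (Finset.mem_univ m))
    ((isPosForm_inner κ).nonneg w)

/-- A function whose square is bounded, up to a continuous factor, by an integrable density is
square integrable on compact sets. -/
theorem L2On.of_sq_le {c : M} {f : E3 → ℝ} {G : E3 → ℝ} {F : M → ℝ}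
    (hf : AEStronglyMeasurable f ((volume : Measure E3).restrict (chartRange c)))
    (hG : ContinuousOn G (chartRange c)) (hF0 : ∀ x, 0 ≤ F x)
    (hF : ∫⁻ x, ENNReal.ofReal (F x) ∂(vol g) < ⊤)
    (hle : ∀ y ∈ chartRange c, f y ^ 2 ≤ G y * F (chartPoint c y)) :
    L2On (chartRange c) f := by
  intro S hS hSR
  have hSm : MeasurableSet S := hS.measurableSet
  obtain ⟨C, hC⟩ := hS.exists_bound_of_continuousOn (f := fun y => G y * (volDensity g c y)⁻¹)
    ((hG.mono hSR).mul (((continuousOn_volDensity g c).mono hSR).inv₀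
      fun y hy => (volDensity_pos g c (hSR hy)).ne'))
  have hfS : AEStronglyMeasurable f (volume.restrict S) := hf.mono_measure (Measure.restrict_mono_set _ hSR)
  rw [memLp_two_iff_integrable_sq hfS]
  refine ⟨hfS.pow 2, ?_⟩
  rw [hasFiniteIntegral_iff_ofReal (Filter.Eventually.of_forall fun x => sq_nonneg _)]
  calc ∫⁻ y in S, ENNReal.ofReal (f y ^ 2)
      ≤ ∫⁻ y in S, ENNReal.ofReal C *
          (ENNReal.ofReal (volDensity g c y) * ENNReal.ofReal (F (chartPoint c y))) := by
        refine setLIntegral_mono' hSm fun y hy => ?_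
        have hd := volDensity_pos g c (hSR hy)
        have hC' := (le_abs_self _).trans (hC y hy)
        have hC0 : 0 ≤ C := (norm_nonneg _).trans (hC y hy)
        rw [← ENNReal.ofReal_mul hd.le, ← ENNReal.ofReal_mul hC0]
        apply ENNReal.ofReal_le_ofReal
        refine (hle y (hSR hy)).trans ?_
        rw [← mul_assoc]
        refine mul_le_mul_of_nonneg_right ?_ (hF0 _)
        rwa [← div_eq_mul_inv, div_le_iff₀ hd] at hC'
    _ = ENNReal.ofReal C * ∫⁻ y in S,
          (ENNReal.ofReal (volDensity g c y) * ENNReal.ofReal (F (chartPoint c y))) := by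
        rw [lintegral_const_mul' _ _ ENNReal.ofReal_ne_top]
    _ ≤ ENNReal.ofReal C * ∫⁻ x, ENNReal.ofReal (F x) ∂(vol g) := by
        gcongr
        exact (lintegral_mono_set hSR).trans (setLIntegral_vol_le g c fun x => ENNReal.ofReal (F x))
    _ < ⊤ := ENNReal.mul_lt_top ENNReal.ofReal_lt_top hF

/-- The components of square integrable forms are square integrable on compact subsets of the chart
range, the boundary included. -/
theorem MemL2.l2On {θ : KForm M n K p} (hθ : MemL2 g κ θ) (c : M) (J : Fin p → Fin 3) (m : Fin n) :
    L2On (chartRange c) (fun y => comp θ c J y m) := by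
  obtain ⟨C, hC, hb⟩ := exists_coord_bound κ
  refine L2On.of_sq_le (g := g) (hθ.1.coord c J m)
    (G := fun y => C * ((∏ k, gram g c (chartPoint c y) (J k) (J k)) * p.factorial))
    (F := fun x => covInner g κ x (θ x) (θ x)) ?_ (fun x => covInner_nonneg g κ x _) hθ.2 ?_
  · exact continuousOn_const.mul ((continuousOn_finsetProd _ fun k _ =>
      (contDiffOn_gram g c _ _).continuousOn).mul continuousOn_const)
  · intro y hy
    refine (hb m _).trans ?_
    rw [mul_assoc, mul_assoc]
    exact mul_le_mul_of_nonneg_left (inner_frame_le g κ _ _ c (chartPoint_mem c hy) J) hC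

/-- The components of a form in `W_1` have square integrable weak derivatives, up to the
boundary. -/
theorem MemW1.exists_weakPartial {θ : KForm M n K p} (hθ : MemW1 g κ θ) :
    ∃ P : M → Fin 3 → (Fin p → Fin 3) → E3 → EuclideanSpace ℝ (Fin n), ∀ c i J,
      IsWeakPartial (interior (chartRange c)) i (comp θ c J) (P c i J) ∧
        ∀ m, L2On (chartRange c) (fun y => P c i J y m) := by
  have h := hθ.2
  simp only [sobolevNormSq, iInf_lt_iff] at h
  obtain ⟨N, hN, hfin⟩ := h
  have hfin' := lt_of_le_of_lt le_self_add hfin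
  refine ⟨_, fun c i J => ⟨hN c i J, fun m => ?_⟩⟩
  have hL2 := hθ.memL2
  have hcon : ∀ J' : Fin p → Fin 3, ∀ G : E3 → ℝ, ContinuousOn G (chartRange c) →
      L2On (chartRange c) (fun y => G y * comp θ c J' y m) := by
    intro J' G hG
    obtain ⟨C, hC, hb⟩ := exists_coord_bound κ
    refine L2On.of_sq_le (g := g)
      ((hG.aestronglyMeasurable (measurableSet_chartRange c)).mul (hL2.1.coord c J' m))
      (G := fun y => G y ^ 2 * (C * ((∏ k, gram g c (chartPoint c y) (J' k) (J' k)) * p.factorial)))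
      (F := fun x => covInner g κ x (θ x) (θ x)) ?_ (fun x => covInner_nonneg g κ x _) hL2.2 ?_
    · exact (hG.pow 2).mul (continuousOn_const.mul ((continuousOn_finsetProd _ fun k _ =>
        (contDiffOn_gram g c _ _).continuousOn).mul continuousOn_const))
    · intro y hy
      rw [mul_pow, mul_assoc]
      refine mul_le_mul_of_nonneg_left ((hb m _).trans ?_) (sq_nonneg _)
      rw [mul_assoc, mul_assoc]
      exact mul_le_mul_of_nonneg_left (inner_frame_le g κ _ _ c (chartPoint_mem c hy) J') hC
  -- the Christoffel terms: the Christoffel symbols are continuous up to the boundary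
  have hΓ : L2On (chartRange c) (fun y => ∑ k : Fin p, ∑ l : Fin 3,
      christoffel g c l i (J k) y * comp θ c (Function.update J k l) y m) := fun S hS hSR =>
    memLp_finsetSum _ fun k _ => memLp_finsetSum _ fun l _ =>
      hcon _ _ (continuousOn_christoffel g c l i (J k)) S hS hSR
  have hΓm : AEStronglyMeasurable (fun y => ∑ k : Fin p, ∑ l : Fin 3,
      christoffel g c l i (J k) y * comp θ c (Function.update J k l) y m)
      ((volume : Measure E3).restrict (chartRange c)) :=
    Finset.aestronglyMeasurable_fun_sum _ fun k _ => Finset.aestronglyMeasurable_fun_sum _ fun l _ =>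
      ((continuousOn_christoffel g c l i (J k)).aestronglyMeasurable (measurableSet_chartRange c)).mul
        (hL2.1.coord c _ m)
  have hPm := (hN c i J).2.1.aestronglyMeasurable
  rw [Measure.restrict_congr_set (chartRange_ae_interior c).symm] at hPm
  have hPm' := (EuclideanSpace.proj (𝕜 := ℝ) m).continuous.comp_aestronglyMeasurable hPm
  have hsplit : ∀ y, (tensorComp N c i J y + ∑ k : Fin p, ∑ l : Fin 3,
      christoffel g c l i (J k) y • comp θ c (Function.update J k l) y) m
      = tensorComp N c i J y m + ∑ k : Fin p, ∑ l : Fin 3,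
        christoffel g c l i (J k) y * comp θ c (Function.update J k l) y m := by
    intro y
    simp
  -- The gradient `N` is an arbitrary section; its components are measurable because the weak partial
  -- derivatives and the Christoffel terms are.
  have hNm : AEStronglyMeasurable (fun y => tensorComp N c i J y m)
      ((volume : Measure E3).restrict (chartRange c)) := by
    refine (hPm'.sub hΓm).congr (Filter.Eventually.of_forall fun y => ?_)
    rw [Pi.sub_apply, sub_eq_iff_eq_add]
    exact hsplit y
  have hN2 : L2On (chartRange c) (fun y => tensorComp N c i J y m) := by
    obtain ⟨C, hC, hb⟩ := exists_coord_bound κ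
    refine L2On.of_sq_le (g := g) hNm
      (G := fun y => C * ((∏ k, gram g c (chartPoint c y) (J k) (J k)) * (p.factorial *
        gram g c (chartPoint c y) i i)))
      (F := fun x => tensorNormSq g κ x (N x)) ?_ (fun x => tensorNormSq_nonneg g κ x _) hfin' ?_
    · exact continuousOn_const.mul ((continuousOn_finsetProd _ fun k _ =>
        (contDiffOn_gram g c _ _).continuousOn).mul (continuousOn_const.mul
          (contDiffOn_gram g c _ _).continuousOn))
    · intro y hy
      refine (hb m _).trans ?_
      rw [mul_assoc, mul_assoc, mul_assoc]
      refine mul_le_mul_of_nonneg_left ((inner_frame_le g κ _ _ c (chartPoint_mem c hy) J).trans ?_) hC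
      refine mul_le_mul_of_nonneg_left ?_ (Finset.prod_nonneg fun k _ =>
        (isPosForm_metricForm g _).nonneg _)
      exact mul_le_mul_of_nonneg_left (covInner_tensor_le g κ _ _ _) (by positivity)
  intro S hS hSR
  exact ((hN2 S hS hSR).add (hΓ S hS hSR)).ae_eq
    (Filter.Eventually.of_forall fun y => (hsplit y).symm)

end Components

/-! ### Smooth test forms and the coderivative in coordinates -/

section TestFunctions

theorem IsTestFunction.mul_contDiffOn {U : Set E3} (hU : IsOpen U) {φ G : E3 → ℝ}
    (hφ : IsTestFunction U φ) (hG : ContDiffOn ℝ ∞ G U) : IsTestFunction U (fun y => φ y * G y) := by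
  obtain ⟨hs, hc, hsub⟩ := hφ
  refine ⟨contDiff_iff_contDiffAt.2 fun y => ?_, hc.mul_right,
    tsupport_mul_subset_left.trans hsub⟩
  by_cases hy : y ∈ tsupport φ
  · exact hs.contDiffAt.mul (hG.contDiffAt (hU.mem_nhds (hsub hy)))
  · have h0 : (fun y => φ y * G y) =ᶠ[𝓝 y] fun _ => 0 := by
      filter_upwards [(isClosed_tsupport φ).isOpen_compl.mem_nhds hy] with z hz
      rw [image_eq_zero_of_notMem_tsupport hz, zero_mul]
    exact contDiffAt_const.congr_of_eventuallyEq h0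

theorem IsTestFunction.continuous_fderiv {U : Set E3} {φ : E3 → ℝ} (hφ : IsTestFunction U φ)
    (i : Fin 3) : Continuous fun y => fderiv ℝ φ y (stdVec i) :=
  (hφ.1.continuous_fderiv (by simp)).clm_apply continuous_const

theorem IsTestFunction.hasCompactSupport_fderiv {U : Set E3} {φ : E3 → ℝ}
    (hφ : IsTestFunction U φ) (i : Fin 3) : HasCompactSupport fun y => fderiv ℝ φ y (stdVec i) :=
  hφ.2.1.fderiv_apply ℝ (stdVec i)

/-- The integral of a derivative of a function with compact support vanishes. -/
theorem IsTestFunction.integral_fderiv {U : Set E3} {φ : E3 → ℝ} (hφ : IsTestFunction U φ)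
    (i : Fin 3) : ∫ y, fderiv ℝ φ y (stdVec i) = 0 := by
  have h1 := (hφ.continuous_fderiv i).integrable_of_hasCompactSupport (μ := volume)
    (hφ.hasCompactSupport_fderiv i)
  have h2 := hφ.1.continuous.integrable_of_hasCompactSupport (μ := volume) hφ.2.1
  have := integral_mul_fderiv_eq_neg_fderiv_mul_of_integrable (μ := (volume : Measure E3))
    (f := fun _ : E3 => (1 : ℝ)) (g := φ) (v := stdVec i) (by simp)
    (by simpa using h1) (by simpa using h2) (fun x _ => differentiableAt_const _)
    (fun x _ => (hφ.1.differentiable (by simp)).differentiableAt)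
  simpa using this

/-- The weak form of `d (F dH) = dF ∧ dH`. -/
theorem IsTestFunction.integral_wedge {U : Set E3} (hU : IsOpen U) {φ F H : E3 → ℝ}
    (hφ : IsTestFunction U φ) (hF : ContDiffOn ℝ ∞ F U) (hH : ContDiffOn ℝ ∞ H U) (i j : Fin 3) :
    ∫ y, (fderiv ℝ φ y (stdVec i) * (F y * fderiv ℝ H y (stdVec j))
        - fderiv ℝ φ y (stdVec j) * (F y * fderiv ℝ H y (stdVec i)))
      = - ∫ y, φ y * (fderiv ℝ F y (stdVec i) * fderiv ℝ H y (stdVec j)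
        - fderiv ℝ F y (stdVec j) * fderiv ℝ H y (stdVec i)) := by
  have hFd : ∀ k, ContDiffOn ℝ ∞ (fun y => fderiv ℝ F y (stdVec k)) U := fun k =>
    (hF.fderiv_of_isOpen hU (by simp)).clm_apply contDiffOn_const
  have hHd : ∀ k, ContDiffOn ℝ ∞ (fun y => fderiv ℝ H y (stdVec k)) U := fun k =>
    (hH.fderiv_of_isOpen hU (by simp)).clm_apply contDiffOn_const
  have ht : ∀ k, IsTestFunction U (fun y => φ y * (F y * fderiv ℝ H y (stdVec k))) := fun k =>
    hφ.mul_contDiffOn hU (hF.mul (hHd k))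
  have ht2 : IsTestFunction U (fun y => φ y * (fderiv ℝ F y (stdVec i) * fderiv ℝ H y (stdVec j)
        - fderiv ℝ F y (stdVec j) * fderiv ℝ H y (stdVec i))) :=
    hφ.mul_contDiffOn hU (((hFd i).mul (hHd j)).sub ((hFd j).mul (hHd i)))
  have hder : ∀ k l y, y ∈ U → fderiv ℝ (fun y => φ y * (F y * fderiv ℝ H y (stdVec k))) y (stdVec l)
      = fderiv ℝ φ y (stdVec l) * (F y * fderiv ℝ H y (stdVec k))
        + φ y * (fderiv ℝ F y (stdVec l) * fderiv ℝ H y (stdVec k)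
          + F y * fderiv ℝ (fderiv ℝ H) y (stdVec l) (stdVec k)) := by
    intro k l y hy
    have h1 : HasFDerivAt φ (fderiv ℝ φ y) y :=
      (hφ.1.differentiable (by simp)).differentiableAt.hasFDerivAt
    have h2 : HasFDerivAt F (fderiv ℝ F y) y :=
      ((hF.contDiffAt (hU.mem_nhds hy)).differentiableAt (by simp)).hasFDerivAt
    have h3 : HasFDerivAt (fderiv ℝ H) (fderiv ℝ (fderiv ℝ H) y) y :=
      (((hH.fderiv_of_isOpen hU (m := ∞) (by simp)).contDiffAt
        (hU.mem_nhds hy)).differentiableAt (by simp)).hasFDerivAt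
    have h4 := h3.clm_apply (hasFDerivAt_const (stdVec k) y)
    have h5 := h1.mul (h2.mul h4)
    rw [show (fun y => φ y * (F y * fderiv ℝ H y (stdVec k)))
      = φ * (F * fun y => fderiv ℝ H y (stdVec k)) from rfl, h5.fderiv]
    simp
    ring
  have hzero : ∀ k l, ∀ y, y ∉ U → fderiv ℝ (fun y => φ y * (F y * fderiv ℝ H y (stdVec k))) y
      (stdVec l) = 0 := by
    intro k l y hy
    rw [image_eq_zero_of_notMem_tsupport
      (fun h => hy ((ht k).2.2 (tsupport_fderiv_subset ℝ h)))]
    rfl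
  have hφ0 : ∀ y, y ∉ U → φ y = 0 := fun y hy =>
    image_eq_zero_of_notMem_tsupport fun h => hy (hφ.2.2 h)
  have hφ0' : ∀ k, ∀ y, y ∉ U → fderiv ℝ φ y (stdVec k) = 0 := by
    intro k y hy
    rw [image_eq_zero_of_notMem_tsupport (fun h => hy (hφ.2.2 (tsupport_fderiv_subset ℝ h)))]
    rfl
  have hpt : ∀ y, fderiv ℝ φ y (stdVec i) * (F y * fderiv ℝ H y (stdVec j))
        - fderiv ℝ φ y (stdVec j) * (F y * fderiv ℝ H y (stdVec i))
      = (fderiv ℝ (fun y => φ y * (F y * fderiv ℝ H y (stdVec j))) y (stdVec i)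
        - fderiv ℝ (fun y => φ y * (F y * fderiv ℝ H y (stdVec i))) y (stdVec j))
        - φ y * (fderiv ℝ F y (stdVec i) * fderiv ℝ H y (stdVec j)
        - fderiv ℝ F y (stdVec j) * fderiv ℝ H y (stdVec i)) := by
    intro y
    by_cases hy : y ∈ U
    · have hsymm := (hH.contDiffAt (hU.mem_nhds hy)).isSymmSndFDerivAt
        (by
        rw [minSmoothness_of_isRCLikeNormedField]; exact WithTop.coe_le_coe.2 (le_top (a := (2 : ℕ∞))))
      rw [hder _ _ y hy, hder _ _ y hy, hsymm.eq (stdVec j) (stdVec i)]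
      ring
    · rw [hzero _ _ y hy, hzero _ _ y hy, hφ0 y hy, hφ0' _ y hy, hφ0' _ y hy]
      ring
  simp only [hpt]
  have hi : ∀ k l, Integrable (fun y =>
      fderiv ℝ (fun y => φ y * (F y * fderiv ℝ H y (stdVec k))) y (stdVec l)) volume := fun k l =>
    ((ht k).continuous_fderiv l).integrable_of_hasCompactSupport ((ht k).hasCompactSupport_fderiv l)
  have e1 := integral_sub ((hi j i).sub (hi i j))
    (ht2.1.continuous.integrable_of_hasCompactSupport ht2.2.1)
  simp only [Pi.sub_apply] at e1
  rw [e1, integral_sub (hi j i) (hi i j), (ht j).integral_fderiv, (ht i).integral_fderiv, sub_self,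
    zero_sub]

/-- A test function which is equal to one near a given compact set. -/
theorem exists_testFunction_eq_one {U S : Set E3} (hU : IsOpen U) (hS : IsCompact S) (hSU : S ⊆ U) :
    ∃ θ : E3 → ℝ, IsTestFunction U θ ∧ ∃ V : Set E3, IsOpen V ∧ S ⊆ V ∧ ∀ y ∈ V, θ y = 1 := by
  obtain ⟨L, hL, hSL, hLU⟩ := exists_compact_between hS hU hSU
  obtain ⟨f, hf1, hf0, -⟩ := exists_contMDiffMap_one_nhds_of_subset_interior 𝓘(ℝ, E3) (n := (⊤ : ℕ∞))
    hS.isClosed hSL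
  have hsupp : tsupport (f : E3 → ℝ) ⊆ L := by
    refine closure_minimal (fun y hy => ?_) hL.isClosed
    by_contra h
    exact hy (hf0 y h)
  refine ⟨f, ⟨f.contMDiff.contDiff, hL.of_isClosed_subset (isClosed_tsupport _) hsupp,
    hsupp.trans hLU⟩, ?_⟩
  obtain ⟨V, hVo, hSV, hV⟩ := mem_nhdsSet_iff_exists.1 hf1
  exact ⟨V, hVo, hSV, fun y hy => hV hy⟩

end TestFunctions

section Covectors

variable {V W : Type*} [AddCommGroup V] [Module ℝ V] [AddCommGroup W] [Module ℝ W]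

/-- The `W`-valued covector `l ⊗ ξ`. -/
def covectorTensor (l : V →ₗ[ℝ] ℝ) (ξ : W) : V [⋀^Fin 1]→ₗ[ℝ] W :=
  AlternatingMap.ofSubsingleton ℝ V W (0 : Fin 1) (l.smulRight ξ)

theorem oneForm_add (u : V [⋀^Fin 1]→ₗ[ℝ] W) (X Y : V) : u ![X + Y] = u ![X] + u ![Y] := by
  have := u.map_update_add ![0] 0 X Y
  simpa only [upd] using this

theorem oneForm_smul (u : V [⋀^Fin 1]→ₗ[ℝ] W) (r : ℝ) (X : V) : u ![r • X] = r • u ![X] := by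
  have := u.map_update_smul ![0] 0 r X
  simpa only [upd] using this

/-- The exterior product `l ∧ u` of a covector with a `W`-valued covector. -/
def covectorWedge (l : V →ₗ[ℝ] ℝ) (u : V [⋀^Fin 1]→ₗ[ℝ] W) : V [⋀^Fin 2]→ₗ[ℝ] W where
  toFun X := l (X 0) • u ![X 1] - l (X 1) • u ![X 0]
  map_update_add' := by
    intro _ m i X Y
    fin_cases i <;> simp [oneForm_add, add_smul] <;> abel
  map_update_smul' := by
    intro _ m i c X
    fin_cases i <;> simp [oneForm_smul, smul_sub, mul_smul, smul_comm c]
  map_eq_zero_of_eq' := by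
    intro X i j hX hij
    have h : X 0 = X 1 := by
      fin_cases i <;> fin_cases j <;> simp_all
    rw [h, sub_self]

theorem covectorWedge_apply (l : V →ₗ[ℝ] ℝ) (u : V [⋀^Fin 1]→ₗ[ℝ] W) (X : Fin 2 → V) :
    covectorWedge l u X = l (X 0) • u ![X 1] - l (X 1) • u ![X 0] := rfl

theorem covectorWedge_add (l l' : V →ₗ[ℝ] ℝ) (u : V [⋀^Fin 1]→ₗ[ℝ] W) :
    covectorWedge (l + l') u = covectorWedge l u + covectorWedge l' u := by
  ext X
  simp only [covectorWedge_apply, AlternatingMap.add_apply, LinearMap.add_apply, add_smul]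
  abel

theorem covectorWedge_zero (u : V [⋀^Fin 1]→ₗ[ℝ] W) :
    covectorWedge (0 : V →ₗ[ℝ] ℝ) u = 0 := by
  ext X
  simp [covectorWedge_apply]

theorem sum_covectorWedge {ι : Type*} (s : Finset ι) (l : ι → V →ₗ[ℝ] ℝ)
    (u : V [⋀^Fin 1]→ₗ[ℝ] W) :
    covectorWedge (∑ i ∈ s, l i) u = ∑ i ∈ s, covectorWedge (l i) u := by
  classical
  induction s using Finset.induction_on with
  | empty => simp [covectorWedge_zero]
  | insert a s ha ih => rw [Finset.sum_insert ha, Finset.sum_insert ha, covectorWedge_add, ih]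

end Covectors

section ExactForms

variable {M : Type*} [TopologicalSpace M] [ChartedSpace (EuclideanHalfSpace 3) M]
  [IsManifold (𝓡∂ 3) ∞ M]
  {n : ℕ} {K : Type*} [TopologicalSpace K] [ChartedSpace (EuclideanSpace ℝ (Fin n)) K] [Group K]

/-- The differential of a function, as a section of linear forms. -/
def dForm (f : M → ℝ) (x : M) : TangentSpace (𝓡∂ 3) x →ₗ[ℝ] ℝ :=
  (show TangentSpace (𝓡∂ 3) x →L[ℝ] ℝ from mfderiv (𝓡∂ 3) 𝓘(ℝ, ℝ) f x).toLinearMap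

/-- The components of `df` are the partial derivatives in coordinates, which at boundary points are
one-sided. -/
theorem dForm_frame {f : M → ℝ} (c : M) {y : E3} (hy : y ∈ chartRange c)
    (hf : MDifferentiableAt (𝓡∂ 3) 𝓘(ℝ, ℝ) f (chartPoint c y)) (i : Fin 3) :
    dForm f (chartPoint c y) (frame c (chartPoint c y) i)
      = fderivWithin ℝ (fun z => f (chartPoint c z)) (chartRange c) y (stdVec i) :=
  mfderiv_frame c hy hf i

theorem comp_one (θ : KForm M n K 1) (c : M) (i : Fin 3) (y : E3) :
    comp θ c ![i] y = θ (chartPoint c y) ![frame c (chartPoint c y) i] := by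
  unfold comp
  congr 1
  ext k; fin_cases k; rfl

variable {f h : M → ℝ} (hf : ContMDiff (𝓡∂ 3) 𝓘(ℝ, ℝ) ∞ f) (hh : ContMDiff (𝓡∂ 3) 𝓘(ℝ, ℝ) ∞ h)
  (ξ : EuclideanSpace ℝ (Fin n))

include hf in
theorem contDiffOn_coord (c : M) :
    ContDiffOn ℝ ∞ (fun z => f (chartPoint c z)) (chartRange c) :=
  contDiffOn_comp_chartPoint c hf.contMDiffOn

include hf in
theorem contDiffOn_coord_deriv (c : M) (i : Fin 3) :
    ContDiffOn ℝ ∞ (fun y => fderivWithin ℝ (fun z => f (chartPoint c z)) (chartRange c) y (stdVec i))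
      (chartRange c) :=
  ((contDiffOn_coord hf c).fderivWithin (uniqueDiffOn_chartRange c) (by simp)).clm_apply
    contDiffOn_const

include hf in
theorem mdifferentiableAt_of_smooth (x : M) : MDifferentiableAt (𝓡∂ 3) 𝓘(ℝ, ℝ) f x :=
  hf.contMDiffAt.mdifferentiableAt (by simp)

/-- The one-form `f dh ⊗ ξ`. -/
def functionForm (f h : M → ℝ) (ξ : EuclideanSpace ℝ (Fin n)) : KForm M n K 1 :=
  fun x => f x • covectorTensor (W := GroupLieAlgebra (𝓡 n) K) (dForm h x) ξ

/-- The two-form `df ∧ dh ⊗ ξ`. -/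
def exactForm (f h : M → ℝ) (ξ : EuclideanSpace ℝ (Fin n)) : KForm M n K 2 :=
  fun x => covectorWedge (dForm f x) (covectorTensor (W := GroupLieAlgebra (𝓡 n) K) (dForm h x) ξ)

include hh in
theorem comp_functionForm (c : M) {y : E3} (hy : y ∈ chartRange c) (J : Fin 1 → Fin 3) :
    comp (functionForm (K := K) f h ξ) c J y = (f (chartPoint c y) *
      fderivWithin ℝ (fun z => h (chartPoint c z)) (chartRange c) y (stdVec (J 0))) •
        ξ := by
  rw [← dForm_frame c hy (mdifferentiableAt_of_smooth hh _), mul_smul]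
  rfl

include hf hh in
theorem comp_exactForm (c : M) {y : E3} (hy : y ∈ chartRange c) (i j : Fin 3) :
    comp (exactForm (K := K) f h ξ) c ![i, j] y =
      (fderivWithin ℝ (fun z => f (chartPoint c z)) (chartRange c) y (stdVec i) *
        fderivWithin ℝ (fun z => h (chartPoint c z)) (chartRange c) y (stdVec j)
      - fderivWithin ℝ (fun z => f (chartPoint c z)) (chartRange c) y (stdVec j) *
        fderivWithin ℝ (fun z => h (chartPoint c z)) (chartRange c) y (stdVec i)) •
        ξ := by
  simp only [← dForm_frame c hy (mdifferentiableAt_of_smooth hh _),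
    ← dForm_frame c hy (mdifferentiableAt_of_smooth hf _), sub_smul, mul_smul]
  rfl

include hf hh in
theorem isTestForm_functionForm {S : Set M} (hS : IsCompact S) (hSi : S ⊆ (𝓡∂ 3).interior M)
    (h0 : ∀ x, x ∉ S → f x = 0) : IsTestForm (functionForm (K := K) f h ξ) := by
  refine ⟨fun c J => ?_, S, hS, hSi, fun x hx => ?_⟩
  · refine ContDiffOn.congr ?_ fun y hy => comp_functionForm hh ξ c hy J
    exact ((contDiffOn_coord hf c).mul (contDiffOn_coord_deriv hh c _)).smul contDiffOn_const
  · simp [functionForm, h0 x hx]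

include hf hh in
/-- `d (f dh ⊗ ξ) = df ∧ dh ⊗ ξ`, in the weak sense used for curvatures. -/
theorem isExtDeriv_functionForm : IsExtDeriv (functionForm (K := K) f h ξ) (exactForm f h ξ) := by
  intro c i j
  have hU : IsOpen (interior (chartRange c)) := isOpen_interior
  have hsub : interior (chartRange c) ⊆ chartRange c := interior_subset
  refine ⟨?_, ?_, fun φ hφ => ?_⟩
  · refine (ContinuousOn.locallyIntegrableOn ?_ hU.measurableSet)
    refine ContinuousOn.congr ?_ fun y hy => comp_functionForm hh ξ c (hsub hy) _
    exact (((contDiffOn_coord hf c).mul (contDiffOn_coord_deriv hh c _)).continuousOn.mono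
      hsub).smul continuousOn_const
  · refine (ContinuousOn.locallyIntegrableOn ?_ hU.measurableSet)
    refine ContinuousOn.congr ?_ fun y hy => comp_exactForm hf hh ξ c (hsub hy) _ _
    exact ((((contDiffOn_coord_deriv hf c _).mul (contDiffOn_coord_deriv hh c _)).sub
      ((contDiffOn_coord_deriv hf c _).mul (contDiffOn_coord_deriv hh c _))).continuousOn.mono
      hsub).smul continuousOn_const
  · have key := hφ.integral_wedge hU ((contDiffOn_coord hf c).mono hsub)
      ((contDiffOn_coord hh c).mono hsub) i j
    have hw : ∀ y ∈ interior (chartRange c), ∀ u : E3 → ℝ,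
        fderivWithin ℝ u (chartRange c) y = fderiv ℝ u y := fun y hy u =>
      fderivWithin_of_mem_nhds (mem_interior_iff_mem_nhds.1 hy)
    have hφ0 : ∀ y, y ∉ interior (chartRange c) → φ y = 0 := fun y hy =>
      image_eq_zero_of_notMem_tsupport fun h => hy (hφ.2.2 h)
    have hφ0' : ∀ k, ∀ y, y ∉ interior (chartRange c) → fderiv ℝ φ y (stdVec k) = 0 := by
      intro k y hy
      rw [image_eq_zero_of_notMem_tsupport (fun h => hy (hφ.2.2 (tsupport_fderiv_subset ℝ h)))]
      rfl
    have e1 : ∀ y, (fderiv ℝ φ y (stdVec i)) • comp (functionForm (K := K) f h ξ) c ![j] y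
          - (fderiv ℝ φ y (stdVec j)) • comp (functionForm (K := K) f h ξ) c ![i] y
        = (fderiv ℝ φ y (stdVec i) * (f (chartPoint c y) *
            fderiv ℝ (fun z => h (chartPoint c z)) y (stdVec j))
          - fderiv ℝ φ y (stdVec j) * (f (chartPoint c y) *
            fderiv ℝ (fun z => h (chartPoint c z)) y (stdVec i))) •
              ξ := by
      intro y
      by_cases hy : y ∈ interior (chartRange c)
      · rw [comp_functionForm hh ξ c (hsub hy), comp_functionForm hh ξ c (hsub hy), hw y hy]
        simp only [sub_smul, mul_smul]
        rfl
      · simp [hφ0' _ y hy]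
    have e2 : ∀ y, φ y • comp (exactForm (K := K) f h ξ) c ![i, j] y
        = (φ y * (fderiv ℝ (fun z => f (chartPoint c z)) y (stdVec i) *
            fderiv ℝ (fun z => h (chartPoint c z)) y (stdVec j)
          - fderiv ℝ (fun z => f (chartPoint c z)) y (stdVec j) *
            fderiv ℝ (fun z => h (chartPoint c z)) y (stdVec i))) •
              ξ := by
      intro y
      by_cases hy : y ∈ interior (chartRange c)
      · rw [comp_exactForm hf hh ξ c (hsub hy), hw y hy, hw y hy, mul_smul]
      · simp [hφ0 y hy]
    simp only [e1, e2]
    rw [integral_smul_const, integral_smul_const, key, neg_smul]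

end ExactForms

/-! ### Functions supported in the interior of a chart -/

section ChartExtend

variable {M : Type*} [TopologicalSpace M] [ChartedSpace (EuclideanHalfSpace 3) M]
  [IsManifold (𝓡∂ 3) ∞ M] [T2Space M]

open Classical in
/-- The function with coordinate expression `φ` in the chart at `c`, extended by zero. -/
def chartExtend (c : M) (φ : E3 → ℝ) (x : M) : ℝ :=
  if x ∈ (extChartAt (𝓡∂ 3) c).source then φ (extChartAt (𝓡∂ 3) c x) else 0

theorem chartExtend_chartPoint (c : M) (φ : E3 → ℝ) {y : E3} (hy : y ∈ chartRange c) :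
    chartExtend c φ (chartPoint c y) = φ y := by
  rw [chartExtend, if_pos (chartPoint_mem c hy), extChartAt_chartPoint c hy]

theorem chartExtend_eq_zero (c : M) {φ : E3 → ℝ} {x : M}
    (hx : x ∉ chartPoint c '' tsupport φ) : chartExtend c φ x = 0 := by
  unfold chartExtend
  split_ifs with h
  · apply image_eq_zero_of_notMem_tsupport
    intro h'
    exact hx ⟨_, h', (extChartAt (𝓡∂ 3) c).left_inv h⟩
  · rfl

theorem isCompact_image_chartPoint (c : M) {S : Set E3} (hS : IsCompact S) (hSR : S ⊆ chartRange c) :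
    IsCompact (chartPoint c '' S) := hS.image_of_continuousOn ((continuousOn_chartPoint c).mono hSR)

theorem image_chartPoint_subset_interior (c : M) {S : Set E3}
    (hSR : S ⊆ interior (chartRange c)) : chartPoint c '' S ⊆ (𝓡∂ 3).interior M := by
  rintro _ ⟨y, hy, rfl⟩
  have hy' := hSR hy
  have hx := chartPoint_mem c (interior_subset hy')
  rw [extChartAt_source] at hx
  refine (ModelWithCorners.isInteriorPoint_iff_of_mem_atlas (I := 𝓡∂ 3) (n := ∞) (by simp)
    (chart_mem_atlas (EuclideanHalfSpace 3) c) hx).2 ?_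
  have h1 : extChartAt (𝓡∂ 3) c (chartPoint c y) = y := extChartAt_chartPoint c (interior_subset hy')
  exact h1.symm ▸ hy'

/-- A test function in the interior of a chart, extended by zero, is smooth on `M`. -/
theorem contMDiff_chartExtend (c : M) {φ : E3 → ℝ}
    (hφ : IsTestFunction (interior (chartRange c)) φ) :
    ContMDiff (𝓡∂ 3) 𝓘(ℝ, ℝ) ∞ (chartExtend c φ) := by
  intro x
  by_cases hx : x ∈ (extChartAt (𝓡∂ 3) c).source
  · have h1 : ContMDiffAt (𝓡∂ 3) 𝓘(ℝ, ℝ) ∞ (fun x => φ (extChartAt (𝓡∂ 3) c x)) x := by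
      refine hφ.1.contMDiff.contMDiffAt.comp x ?_
      exact contMDiffAt_extChartAt' (by rwa [extChartAt_source] at hx)
    refine h1.congr_of_eventuallyEq ?_
    filter_upwards [(isOpen_extChartAt_source c).mem_nhds hx] with z hz
    rw [chartExtend, if_pos hz]
  · have hK : IsClosed (chartPoint c '' tsupport φ) :=
      (isCompact_image_chartPoint c hφ.2.1 (hφ.2.2.trans interior_subset)).isClosed
    have hxK : x ∉ chartPoint c '' tsupport φ := by
      rintro ⟨y, hy, rfl⟩
      exact hx (chartPoint_mem c (interior_subset (hφ.2.2 hy)))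
    refine (contMDiffAt_const (c := (0 : ℝ))).congr_of_eventuallyEq ?_
    filter_upwards [hK.isOpen_compl.mem_nhds hxK] with z hz
    exact chartExtend_eq_zero c hz

theorem dForm_chartExtend (c : M) {φ : E3 → ℝ}
    (hφ : IsTestFunction (interior (chartRange c)) φ) {y : E3} (hy : y ∈ chartRange c) (i : Fin 3) :
    dForm (chartExtend c φ) (chartPoint c y) (frame c (chartPoint c y) i)
      = fderiv ℝ φ y (stdVec i) := by
  rw [dForm_frame c hy (mdifferentiableAt_of_smooth (contMDiff_chartExtend c hφ) _)]
  have h1 : fderivWithin ℝ (fun z => chartExtend c φ (chartPoint c z)) (chartRange c) y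
      = fderivWithin ℝ φ (chartRange c) y :=
    fderivWithin_congr (fun z hz => chartExtend_chartPoint c φ hz) (chartExtend_chartPoint c φ hy)
  rw [h1, (hφ.1.differentiable (by simp)).differentiableAt.fderivWithin
    (uniqueDiffOn_chartRange c y hy)]

end ChartExtend

/-! ### Inner products and the coderivative in coordinates -/

section Coordinates

variable {M : Type*} [TopologicalSpace M] [ChartedSpace (EuclideanHalfSpace 3) M]
  [IsManifold (𝓡∂ 3) ∞ M]
  {n : ℕ} {K : Type*} [TopologicalSpace K] [ChartedSpace (EuclideanSpace ℝ (Fin n)) K] [Group K]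
  (g : SmoothMetric M) (κ : AdInvariantInner n K)

/-- The inverse metric coefficient `g^{ij}` in the chart at `c`. -/
def invGram (c : M) (y : E3) (i j : Fin 3) : ℝ := (gram g c (chartPoint c y))⁻¹ i j

/-- The inner product of the Lie algebra on the model space. -/
def modelInner : EuclideanSpace ℝ (Fin n) →ₗ[ℝ] EuclideanSpace ℝ (Fin n) →ₗ[ℝ] ℝ := κ.inner

/-- The coefficients `√(det g) ∑ g^{ik} g^{i'j} ⟨B_{ii'}, ξ⟩` of the vector field, with index `k`,
which is obtained by contracting a two-form with the `j`-th coordinate covector and `ξ`. -/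
def fluxCoeff (B : KForm M n K 2) (c : M) (ξ : EuclideanSpace ℝ (Fin n)) (j k : Fin 3) (y : E3) : ℝ :=
  volDensity g c y * ∑ i, ∑ i', invGram g c y i k * invGram g c y i' j *
    modelInner κ (comp B c ![i, i'] y) ξ

/-- The coefficient `√(det g) ∑ g^{ij} ⟨δ_i, ξ⟩`. -/
def sourceCoeff (δ : KForm M n K 1) (c : M) (ξ : EuclideanSpace ℝ (Fin n)) (j : Fin 3) (y : E3) : ℝ :=
  volDensity g c y * ∑ i, invGram g c y i j * modelInner κ (comp δ c ![i] y) ξ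

theorem sum_fin_one {A : Type*} [AddCommMonoid A] (F : (Fin 1 → Fin 3) → A) :
    ∑ I, F I = ∑ i, F ![i] :=
  Fintype.sum_equiv (Equiv.funUnique (Fin 1) (Fin 3)) _ _ fun I => by
    congr 1; ext k; fin_cases k; rfl

theorem sum_fin_two {A : Type*} [AddCommMonoid A] (F : (Fin 2 → Fin 3) → A) :
    ∑ I, F I = ∑ i, ∑ j, F ![i, j] := by
  rw [← Fintype.sum_prod_type']
  exact Fintype.sum_equiv (finTwoArrowEquiv (Fin 3)) _ _ fun I => by
    congr 1; ext k; fin_cases k <;> rfl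

theorem sum_comm_last {ι₁ ι₂ ι₃ : Type*} [Fintype ι₁] [Fintype ι₂] [Fintype ι₃]
    (F : ι₁ → ι₂ → ι₃ → ℝ) : ∑ i, ∑ j, ∑ k, F i j k = ∑ k, ∑ i, ∑ j, F i j k := by
  rw [Finset.sum_comm (s := (Finset.univ : Finset ι₃))]
  exact Finset.sum_congr rfl fun i _ => Finset.sum_comm

theorem covInner_one (θ η : KForm M n K 1) (c : M) {y : E3} (hy : y ∈ chartRange c) :
    covInner g κ (chartPoint c y) (θ (chartPoint c y)) (η (chartPoint c y))
      = ∑ i, ∑ j, invGram g c y i j * modelInner κ (comp θ c ![i] y) (comp η c ![j] y) := by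
  rw [covInner_chartPoint g κ θ η c hy]
  simp only [sum_fin_one]
  simp [invGram, modelInner]
  rfl

theorem covInner_two (θ η : KForm M n K 2) (c : M) {y : E3} (hy : y ∈ chartRange c) :
    covInner g κ (chartPoint c y) (θ (chartPoint c y)) (η (chartPoint c y))
      = (1 / 2) * ∑ i, ∑ i', ∑ k, ∑ k', invGram g c y i k * invGram g c y i' k' *
        modelInner κ (comp θ c ![i, i'] y) (comp η c ![k, k'] y) := by
  rw [covInner_chartPoint g κ θ η c hy]
  simp only [sum_fin_two, Fin.prod_univ_two]
  simp [invGram, modelInner, Nat.factorial]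
  rfl

theorem comp_two_antisymm (θ : KForm M n K 2) (c : M) (i j : Fin 3) (y : E3) :
    comp θ c ![i, j] y = - comp θ c ![j, i] y := by
  have := (θ (chartPoint c y)).map_swap (fun k => frame c (chartPoint c y) (![j, i] k))
    (i := 0) (j := 1) (by simp)
  refine Eq.trans ?_ this
  unfold comp
  congr 1
  ext k; fin_cases k <;> simp

/-- The inner product with a two-form whose components are given as `P_{kj} - P_{jk}`. -/
theorem covInner_two_of_eq_sub (θ η : KForm M n K 2) (c : M) {y : E3} (hy : y ∈ chartRange c)
    {P : Fin 3 → Fin 3 → EuclideanSpace ℝ (Fin n)}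
    (hP : ∀ k j, comp η c ![k, j] y = P k j - P j k) :
    covInner g κ (chartPoint c y) (θ (chartPoint c y)) (η (chartPoint c y))
      = ∑ i, ∑ i', ∑ k, ∑ k', invGram g c y i k * invGram g c y i' k' *
        modelInner κ (comp θ c ![i, i'] y) (P k k') := by
  rw [covInner_two g κ θ η c hy]
  have h1 : ∑ i, ∑ i', ∑ k, ∑ k', invGram g c y i k * invGram g c y i' k' *
        modelInner κ (comp θ c ![i, i'] y) (P k' k)
      = - ∑ i, ∑ i', ∑ k, ∑ k', invGram g c y i k * invGram g c y i' k' *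
        modelInner κ (comp θ c ![i, i'] y) (P k k') := by
    rw [Finset.sum_comm, ← Finset.sum_neg_distrib]
    refine Finset.sum_congr rfl fun i _ => ?_
    rw [← Finset.sum_neg_distrib]
    refine Finset.sum_congr rfl fun i' _ => ?_
    rw [Finset.sum_comm, ← Finset.sum_neg_distrib]
    refine Finset.sum_congr rfl fun k _ => ?_
    rw [← Finset.sum_neg_distrib]
    refine Finset.sum_congr rfl fun k' _ => ?_
    rw [comp_two_antisymm θ c i' i, map_neg, LinearMap.neg_apply]
    ring
  simp only [hP, map_sub, mul_sub, Finset.sum_sub_distrib, h1]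
  ring

theorem modelInner_expand (a b : EuclideanSpace ℝ (Fin n)) :
    modelInner κ a b = ∑ m, modelInner κ a (EuclideanSpace.single m 1) * b m := by
  have hs : ∑ k, b k • EuclideanSpace.single k (1 : ℝ) = b := by
    simpa using (EuclideanSpace.basisFun (Fin n) ℝ).sum_repr b
  conv_lhs => rw [← hs]
  simp only [map_sum, map_smul, smul_eq_mul, mul_comm]

/-- The integrand of `(θ, η)` for one-forms, in coordinates. -/
theorem volDensity_mul_covInner_one (θ η : KForm M n K 1) (c : M) {y : E3} (hy : y ∈ chartRange c) :
    volDensity g c y * covInner g κ (chartPoint c y) (θ (chartPoint c y)) (η (chartPoint c y))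
      = ∑ j, ∑ m, sourceCoeff g κ θ c (EuclideanSpace.single m 1) j y * comp η c ![j] y m := by
  rw [covInner_one g κ θ η c hy, Finset.sum_comm, Finset.mul_sum]
  refine Finset.sum_congr rfl fun j _ => ?_
  simp only [modelInner_expand κ (comp θ c _ y) (comp η c _ y), sourceCoeff, Finset.mul_sum,
    Finset.sum_mul]
  rw [Finset.sum_comm]
  refine Finset.sum_congr rfl fun m _ => Finset.sum_congr rfl fun i _ => ?_
  ring

/-- The integrand of `(θ, η)` for two-forms, in coordinates, when `η_kj = P_kj - P_jk`. The
antisymmetry of `θ` absorbs the factor `1 / 2!`. -/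
theorem volDensity_mul_covInner_two (θ η : KForm M n K 2) (c : M) {y : E3} (hy : y ∈ chartRange c)
    {P : Fin 3 → Fin 3 → EuclideanSpace ℝ (Fin n)}
    (hP : ∀ k j, comp η c ![k, j] y = P k j - P j k) :
    volDensity g c y * covInner g κ (chartPoint c y) (θ (chartPoint c y)) (η (chartPoint c y))
      = ∑ j, ∑ m, ∑ k, fluxCoeff g κ θ c (EuclideanSpace.single m 1) j k y * P k j m := by
  rw [covInner_two_of_eq_sub g κ θ η c hy hP]
  have h1 : ∀ j m k, fluxCoeff g κ θ c (EuclideanSpace.single m 1) j k y * P k j m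
      = ∑ i, ∑ i', volDensity g c y * (invGram g c y i k * invGram g c y i' j *
        (modelInner κ (comp θ c ![i, i'] y) (EuclideanSpace.single m 1) * P k j m)) := by
    intro j m k
    simp only [fluxCoeff, Finset.mul_sum, Finset.sum_mul]
    exact Finset.sum_congr rfl fun i _ => Finset.sum_congr rfl fun i' _ => by ring
  have h2 : ∀ i i' k k', invGram g c y i k * invGram g c y i' k' *
        modelInner κ (comp θ c ![i, i'] y) (P k k') = ∑ m, invGram g c y i k * invGram g c y i' k' *
        (modelInner κ (comp θ c ![i, i'] y) (EuclideanSpace.single m 1) * P k k' m) := by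
    intro i i' k k'
    rw [modelInner_expand, Finset.mul_sum]
  simp only [h1, h2, Finset.mul_sum]
  rw [sum_comm_pairs fun i i' k j => ∑ m, volDensity g c y * (invGram g c y i k *
    invGram g c y i' j * (modelInner κ (comp θ c ![i, i'] y) (EuclideanSpace.single m 1) *
      P k j m))]
  refine (Finset.sum_congr rfl fun k _ => Finset.sum_congr rfl fun j _ => sum_comm_last _).trans ?_
  exact (sum_comm_last fun j m k => ∑ i, ∑ i', volDensity g c y * (invGram g c y i k *
    invGram g c y i' j * (modelInner κ (comp θ c ![i, i'] y) (EuclideanSpace.single m 1) *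
      P k j m))).symm

end Coordinates

section WeakCoderivative

variable {M : Type*} [TopologicalSpace M] [ChartedSpace (EuclideanHalfSpace 3) M]
  [IsManifold (𝓡∂ 3) ∞ M] [T2Space M] [MeasurableSpace M] [BorelSpace M]
  {n : ℕ} {K : Type*} [TopologicalSpace K] [ChartedSpace (EuclideanSpace ℝ (Fin n)) K] [Group K]
  {g : SmoothMetric M} {κ : AdInvariantInner n K}

/-- The coderivative of a two-form is, in coordinates, a divergence. The test forms are
`φ dy^j ⊗ ξ`. -/
theorem IsCoderiv.hasWeakCodiv {B : KForm M n K 2} {δ : KForm M n K 1} (h : IsCoderiv g κ B δ)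
    (c : M) (ξ : EuclideanSpace ℝ (Fin n)) (j : Fin 3) :
    HasWeakCodiv (interior (chartRange c)) (fluxCoeff g κ B c ξ j) (sourceCoeff g κ δ c ξ j) := by
  intro φ hφ
  have hU : IsOpen (interior (chartRange c)) := isOpen_interior
  -- The coordinate `y j` is multiplied by a cutoff `θ` equal to `1` near the support of `φ`, so that it
  -- extends to `M`; near that support the test form is `φ dy^j ⊗ ξ`.
  obtain ⟨θ, hθ, V, hV, hSV, hθ1⟩ := exists_testFunction_eq_one hU hφ.2.1 hφ.2.2
  have hproj : ContDiff ℝ ∞ (fun y : E3 => y j) := (EuclideanSpace.proj (𝕜 := ℝ) j).contDiff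
  have hψ : IsTestFunction (interior (chartRange c)) (fun y => θ y * y j) :=
    hθ.mul_contDiffOn hU hproj.contDiffOn
  have hf := contMDiff_chartExtend c hφ
  have hh := contMDiff_chartExtend c hψ
  have hsupp : ∀ x, x ∉ chartPoint c '' tsupport φ → chartExtend c φ x = 0 :=
    fun x hx => chartExtend_eq_zero c hx
  have hder : ∀ y ∈ tsupport φ, ∀ k, fderiv ℝ (fun y => θ y * y j) y (stdVec k)
      = if k = j then 1 else 0 := by
    intro y hy k
    have h1 : (fun y => θ y * y j) =ᶠ[𝓝 y] (EuclideanSpace.proj j : E3 →L[ℝ] ℝ) := by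
      filter_upwards [hV.mem_nhds (hSV hy)] with z hz
      simp [hθ1 z hz]
    rw [h1.fderiv_eq, ContinuousLinearMap.fderiv]
    simp [stdVec, eq_comm]
  have hφ0 : ∀ y, y ∉ tsupport φ → φ y = 0 := fun y hy => image_eq_zero_of_notMem_tsupport hy
  have hφ0' : ∀ y, y ∉ tsupport φ → ∀ k, fderiv ℝ φ y (stdVec k) = 0 := by
    intro y hy k
    rw [image_eq_zero_of_notMem_tsupport (fun h => hy (tsupport_fderiv_subset ℝ h))]
    rfl
  have hd1 : ∀ y ∈ chartRange c, ∀ k, fderivWithin ℝ (fun z => chartExtend c (fun y => θ y * y j)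
      (chartPoint c z)) (chartRange c) y (stdVec k) = fderiv ℝ (fun y => θ y * y j) y (stdVec k) := by
    intro y hy k
    rw [← dForm_frame c hy (mdifferentiableAt_of_smooth hh _), dForm_chartExtend c hψ hy]
  have hd2 : ∀ y ∈ chartRange c, ∀ k, fderivWithin ℝ (fun z => chartExtend c φ
      (chartPoint c z)) (chartRange c) y (stdVec k) = fderiv ℝ φ y (stdVec k) := by
    intro y hy k
    rw [← dForm_frame c hy (mdifferentiableAt_of_smooth hf _), dForm_chartExtend c hφ hy]
  set Φ : KForm M n K 1 := functionForm (chartExtend c φ) (chartExtend c fun y => θ y * y j) ξ with hΦ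
  set Ψ : KForm M n K 2 := exactForm (chartExtend c φ) (chartExtend c fun y => θ y * y j) ξ with hΨ
  have key := h.2.2 Φ Ψ
    (isTestForm_functionForm hf hh ξ (isCompact_image_chartPoint c hφ.2.1
      (hφ.2.2.trans interior_subset)) (image_chartPoint_subset_interior c hφ.2.2) hsupp)
    (isExtDeriv_functionForm hf hh ξ)
  have hsrc : ∀ x, x ∉ (extChartAt (𝓡∂ 3) c).source → chartExtend c φ =ᶠ[𝓝 x] fun _ => 0 := by
    intro x hx
    have hK : IsClosed (chartPoint c '' tsupport φ) :=
      (isCompact_image_chartPoint c hφ.2.1 (hφ.2.2.trans interior_subset)).isClosed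
    have hxK : x ∉ chartPoint c '' tsupport φ := by
      rintro ⟨y, hy, rfl⟩
      exact hx (chartPoint_mem c (interior_subset (hφ.2.2 hy)))
    filter_upwards [hK.isOpen_compl.mem_nhds hxK] with z hz
    exact chartExtend_eq_zero c hz
  have hΦ0 : ∀ x, x ∉ (extChartAt (𝓡∂ 3) c).source → Φ x = 0 := by
    intro x hx
    simp [hΦ, functionForm, (hsrc x hx).self_of_nhds]
  have hΨ0 : ∀ x, x ∉ (extChartAt (𝓡∂ 3) c).source → Ψ x = 0 := by
    intro x hx
    have : dForm (chartExtend c φ) x = 0 := by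
      unfold dForm
      rw [(hsrc x hx).mfderiv_eq, mfderiv_const]
      rfl
    simp [hΨ, exactForm, this, covectorWedge_zero]
  have hcΦ : ∀ y ∈ chartRange c, ∀ k, comp Φ c ![k] y = (φ y * if k = j then 1 else 0) • ξ := by
    intro y hy k
    rw [hΦ, comp_functionForm hh ξ c hy, chartExtend_chartPoint c φ hy, hd1 y hy]
    by_cases hs : y ∈ tsupport φ
    · rw [hder y hs]
      rfl
    · simp [hφ0 y hs]
  have hcΨ : ∀ y ∈ chartRange c, ∀ k l, comp Ψ c ![k, l] y
      = (fderiv ℝ φ y (stdVec k) * if l = j then 1 else 0) • ξ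
        - (fderiv ℝ φ y (stdVec l) * if k = j then 1 else 0) • ξ := by
    intro y hy k l
    rw [hΨ, comp_exactForm hf hh ξ c hy, hd1 y hy, hd1 y hy, hd2 y hy, hd2 y hy, sub_smul]
    by_cases hs : y ∈ tsupport φ
    · rw [hder y hs, hder y hs]
    · simp [hφ0' y hs]
  have hL : l2Inner g κ δ Φ = ∫ y, sourceCoeff g κ δ c ξ j y * φ y := by
    unfold l2Inner
    rw [integral_vol_eq g c fun x hx => by rw [hΦ0 x hx, ← covForm_apply, map_zero]]
    refine Eq.trans ?_ (setIntegral_eq_integral_of_forall_compl_eq_zero (s := chartRange c) ?_)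
    · refine setIntegral_congr_fun (measurableSet_chartRange c) fun y hy => ?_
      rw [covInner_one g κ δ Φ c hy]
      simp only [hcΦ y hy, map_smul, smul_eq_mul, sourceCoeff]
      simp only [mul_ite, mul_one, mul_zero, ite_mul, zero_mul, Finset.sum_ite_eq',
        Finset.mem_univ, if_true, Finset.sum_mul, Finset.mul_sum]
      exact Finset.sum_congr rfl fun i _ => by ring
    · intro y hy
      rw [hφ0 y fun h' => hy (interior_subset (hφ.2.2 h')), mul_zero]
  have hR : l2Inner g κ B Ψ = ∫ y, ∑ k, fluxCoeff g κ B c ξ j k y * fderiv ℝ φ y (stdVec k) := by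
    unfold l2Inner
    rw [integral_vol_eq g c fun x hx => by rw [hΨ0 x hx, ← covForm_apply, map_zero]]
    refine Eq.trans ?_ (setIntegral_eq_integral_of_forall_compl_eq_zero (s := chartRange c) ?_)
    · refine setIntegral_congr_fun (measurableSet_chartRange c) fun y hy => ?_
      rw [covInner_two_of_eq_sub g κ B Ψ c hy (hcΨ y hy)]
      simp only [map_smul, smul_eq_mul, fluxCoeff]
      simp only [mul_ite, mul_one, mul_zero, ite_mul, zero_mul, Finset.sum_ite_eq',
        Finset.mem_univ, if_true, Finset.sum_mul, Finset.mul_sum]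
      rw [sum_comm_last]
      exact Finset.sum_congr rfl fun k _ => Finset.sum_congr rfl fun i _ =>
        Finset.sum_congr rfl fun i' _ => by ring
    · intro y hy
      refine Finset.sum_eq_zero fun k _ => ?_
      rw [hφ0' y fun h' => hy (interior_subset (hφ.2.2 h')), mul_zero]
  rw [← hL, ← hR, key]

end WeakCoderivative

/-! ### Regularity of the coefficients -/

section LocalBounds

/-- Essential boundedness on all compact subsets of `R`. -/
def BddOn (R : Set E3) (f : E3 → ℝ) : Prop :=
  ∀ S : Set E3, IsCompact S → S ⊆ R → ∃ C : ℝ, ∀ᵐ y ∂(volume.restrict S), |f y| ≤ C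

variable {R : Set E3}

theorem BddOn.sum {ι : Type*} (s : Finset ι) {f : ι → E3 → ℝ} (hf : ∀ i ∈ s, BddOn R (f i)) :
    BddOn R (fun y => ∑ i ∈ s, f i y) := by
  intro S hS hSR
  choose! C hC using fun i hi => hf i hi S hS hSR
  refine ⟨∑ i ∈ s, C i, ?_⟩
  have := (ae_ball_iff s.countable_toSet).2 hC
  filter_upwards [this] with y hy
  exact (Finset.abs_sum_le_sum_abs _ _).trans (Finset.sum_le_sum hy)

theorem BddOn.continuousOn_mul {G f : E3 → ℝ} (hf : BddOn R f) (hG : ContinuousOn G R) :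
    BddOn R (fun y => G y * f y) := by
  intro S hS hSR
  obtain ⟨C, hC⟩ := hf S hS hSR
  obtain ⟨D, hD⟩ := hS.exists_bound_of_continuousOn (hG.mono hSR)
  refine ⟨D * C, ?_⟩
  filter_upwards [hC, ae_restrict_mem hS.measurableSet] with y hy hyS
  rw [abs_mul]
  exact mul_le_mul (hD y hyS) hy (abs_nonneg _) ((norm_nonneg _).trans (hD y hyS))

theorem L2On.sum {ι : Type*} (s : Finset ι) {f : ι → E3 → ℝ} (hf : ∀ i ∈ s, L2On R (f i)) :
    L2On R (fun y => ∑ i ∈ s, f i y) :=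
  fun S hS hSR => memLp_finsetSum _ fun i hi => hf i hi S hS hSR

theorem L2On.continuousOn_mul {G f : E3 → ℝ} (hf : L2On R f) (hG : ContinuousOn G R) :
    L2On R (fun y => G y * f y) := by
  intro S hS hSR
  obtain ⟨D, hD⟩ := hS.exists_bound_of_continuousOn (hG.mono hSR)
  refine MemLp.of_le_mul (c := D) (hf S hS hSR)
    (((hG.mono hSR).aestronglyMeasurable hS.measurableSet).mul (hf S hS hSR).1) ?_
  filter_upwards [ae_restrict_mem hS.measurableSet] with y hyS
  rw [norm_mul]
  exact mul_le_mul_of_nonneg_right (hD y hyS) (norm_nonneg _)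

theorem L2On.congr {f f' : E3 → ℝ} (hf : L2On R f) (h : ∀ y, f y = f' y) : L2On R f' := by
  rwa [show f' = f from (funext h).symm]

end LocalBounds

section Coefficients

variable {M : Type*} [TopologicalSpace M] [ChartedSpace (EuclideanHalfSpace 3) M]
  [IsManifold (𝓡∂ 3) ∞ M]
  {n : ℕ} {K : Type*} [TopologicalSpace K] [ChartedSpace (EuclideanSpace ℝ (Fin n)) K] [Group K]
  (g : SmoothMetric M) (κ : AdInvariantInner n K)

theorem modelInner_expand_left (a b : EuclideanSpace ℝ (Fin n)) :
    modelInner κ a b = ∑ m, modelInner κ (EuclideanSpace.single m 1) b * a m := by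
  rw [show modelInner κ a b = modelInner κ b a from κ.symm a b, modelInner_expand]
  exact Finset.sum_congr rfl fun m _ => congrArg (· * a m) (κ.symm _ _)

/-- The coefficient with which a component of a two-form enters `fluxCoeff`. -/
def fluxWeight (c : M) (ξ : EuclideanSpace ℝ (Fin n)) (j k i i' : Fin 3) (m : Fin n) (y : E3) : ℝ :=
  volDensity g c y * (invGram g c y i k * invGram g c y i' j) *
    modelInner κ (EuclideanSpace.single m 1) ξ

theorem fluxCoeff_eq (B : KForm M n K 2) (c : M) (ξ : EuclideanSpace ℝ (Fin n)) (j k : Fin 3)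
    (y : E3) : fluxCoeff g κ B c ξ j k y
      = ∑ i, ∑ i', ∑ m, fluxWeight g κ c ξ j k i i' m y * comp B c ![i, i'] y m := by
  simp only [fluxCoeff, Finset.mul_sum, modelInner_expand_left κ (comp B c _ y) ξ]
  exact Finset.sum_congr rfl fun i _ => Finset.sum_congr rfl fun i' _ =>
    Finset.sum_congr rfl fun m _ => by unfold fluxWeight; ring

theorem continuousOn_invGram (c : M) (i j : Fin 3) :
    ContinuousOn (fun y => invGram g c y i j) (chartRange c) := continuousOn_gram_inv g c i j

theorem continuousOn_fluxWeight (c : M) (ξ : EuclideanSpace ℝ (Fin n)) (j k i i' : Fin 3)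
    (m : Fin n) : ContinuousOn (fluxWeight g κ c ξ j k i i' m) (chartRange c) :=
  ((continuousOn_volDensity g c).mul ((continuousOn_invGram g c i k).mul
    (continuousOn_invGram g c i' j))).mul continuousOn_const

theorem fluxCoeff_antisymm (B : KForm M n K 2) (c : M) (ξ : EuclideanSpace ℝ (Fin n))
    (j : Fin 3) (y : E3) : fluxCoeff g κ B c ξ j j y = 0 := by
  unfold fluxCoeff
  have h : ∑ i, ∑ i', invGram g c y i j * invGram g c y i' j * modelInner κ (comp B c ![i, i'] y) ξ
      = - ∑ i, ∑ i', invGram g c y i j * invGram g c y i' j *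
        modelInner κ (comp B c ![i, i'] y) ξ := by
    conv_lhs => rw [Finset.sum_comm]
    rw [← Finset.sum_neg_distrib]
    refine Finset.sum_congr rfl fun i _ => ?_
    rw [← Finset.sum_neg_distrib]
    refine Finset.sum_congr rfl fun i' _ => ?_
    rw [comp_two_antisymm B c i' i, map_neg, LinearMap.neg_apply]
    ring
  rw [show ∑ i, ∑ i', invGram g c y i j * invGram g c y i' j *
    modelInner κ (comp B c ![i, i'] y) ξ = 0 by linarith, mul_zero]

variable [MeasurableSpace M] [BorelSpace M] [CompactSpace M]
variable {g κ}

theorem MemL2.fluxCoeff {B : KForm M n K 2} (hB : MemL2 g κ B) (c : M)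
    (ξ : EuclideanSpace ℝ (Fin n)) (j k : Fin 3) :
    L2On (chartRange c) (YangMillsHeat.fluxCoeff g κ B c ξ j k) := by
  refine L2On.congr ?_ fun y => (fluxCoeff_eq g κ B c ξ j k y).symm
  exact L2On.sum _ fun i _ => L2On.sum _ fun i' _ => L2On.sum _ fun m _ =>
    (hB.l2On c _ m).continuousOn_mul (continuousOn_fluxWeight g κ c ξ j k i i' m)

theorem MemL2.sourceCoeff {δ : KForm M n K 1} (hδ : MemL2 g κ δ) (c : M)
    (ξ : EuclideanSpace ℝ (Fin n)) (j : Fin 3) :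
    L2On (chartRange c) (YangMillsHeat.sourceCoeff g κ δ c ξ j) := by
  have h : L2On (chartRange c) (fun y => ∑ i, ∑ m, (volDensity g c y * invGram g c y i j *
      modelInner κ (EuclideanSpace.single m 1) ξ) * comp δ c ![i] y m) :=
    L2On.sum _ fun i _ => L2On.sum _ fun m _ => (hδ.l2On c _ m).continuousOn_mul
      (((continuousOn_volDensity g c).mul (continuousOn_invGram g c i j)).mul continuousOn_const)
  refine h.congr fun y => ?_
  simp only [YangMillsHeat.sourceCoeff, Finset.mul_sum, modelInner_expand_left κ (comp δ c _ y) ξ]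
  exact Finset.sum_congr rfl fun i _ => Finset.sum_congr rfl fun m _ => by ring

/-- A bounded two-form has bounded coefficients on compact subsets of the chart range. -/
theorem bddOn_fluxCoeff {B : KForm M n K 2} {C : ℝ}
    (hB : ∀ᵐ x ∂(vol g), covInner g κ x (B x) (B x) ≤ C) (c : M)
    (ξ : EuclideanSpace ℝ (Fin n)) (j k : Fin 3) :
    BddOn (chartRange c) (fluxCoeff g κ B c ξ j k) := by
  have hcomp : ∀ J m, BddOn (chartRange c) (fun y => comp B c J y m) := by
    intro J m S hS hSR
    obtain ⟨D, hD, hb⟩ := exists_coord_bound κ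
    obtain ⟨G, hG⟩ := hS.exists_bound_of_continuousOn
      (f := fun y => ∏ l, gram g c (chartPoint c y) (J l) (J l))
      (continuousOn_finsetProd _ fun l _ => (contDiffOn_gram g c _ _).continuousOn.mono hSR)
    have hae : ∀ᵐ y ∂(volume : Measure E3).restrict S,
        covInner g κ (chartPoint c y) (B (chartPoint c y)) (B (chartPoint c y)) ≤ C :=
      ae_mono (Measure.restrict_mono_set _ hSR) ((ae_vol_iff g).1 hB c)
    refine ⟨√(D * (G * (Nat.factorial 2 * C))), ?_⟩
    filter_upwards [hae, ae_restrict_mem hS.measurableSet] with y hy hyS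
    apply Real.abs_le_sqrt
    refine (hb m _).trans ?_
    refine mul_le_mul_of_nonneg_left ?_ hD
    refine (inner_frame_le g κ _ _ c (chartPoint_mem c (hSR hyS)) J).trans ?_
    have h0 := covInner_nonneg g κ (chartPoint c y) (B (chartPoint c y))
    refine mul_le_mul ((le_abs_self _).trans (hG y hyS)) ?_ (by positivity)
      ((norm_nonneg _).trans (hG y hyS))
    exact mul_le_mul_of_nonneg_left hy (by positivity)
  rw [show fluxCoeff g κ B c ξ j k = _ from funext fun y => fluxCoeff_eq g κ B c ξ j k y]
  exact BddOn.sum _ fun i _ => BddOn.sum _ fun i' _ => BddOn.sum _ fun m _ =>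
    (hcomp _ m).continuousOn_mul (continuousOn_fluxWeight g κ c ξ j k i i' m)

end Coefficients

/-! ### Boundary traces -/

section Traces

/-- A function has vanishing boundary values on the compact set `S`, in the sense of collar
averages. -/
def TraceZeroOn (S : Set E3) (f : E3 → ℝ) : Prop :=
  Filter.Tendsto (fun ε : ℝ => ENNReal.ofReal ε⁻¹ * ∫⁻ y in S ∩ {y | y 0 < ε}, ‖f y‖ₑ) (𝓝[>] 0) (𝓝 0)

/-- Vanishing traces pass to functions dominated on `S`. -/
theorem TraceZeroOn.of_le {S : Set E3} (hS : MeasurableSet S) {f : E3 → ℝ} {F : E3 → ℝ≥0∞} {C : ℝ≥0∞}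
    (hC : C ≠ ⊤) (hF : Filter.Tendsto (fun ε : ℝ => ENNReal.ofReal ε⁻¹ *
      ∫⁻ y in S ∩ {y | y 0 < ε}, F y) (𝓝[>] 0) (𝓝 0)) (hle : ∀ y ∈ S, ‖f y‖ₑ ≤ C * F y) :
    TraceZeroOn S f := by
  have h1 := ENNReal.Tendsto.const_mul hF (Or.inr hC)
  rw [mul_zero] at h1
  refine tendsto_of_tendsto_of_tendsto_of_le_of_le tendsto_const_nhds h1 (fun _ => zero_le)
    fun ε => ?_
  have hm : MeasurableSet (S ∩ {y : E3 | y 0 < ε}) := hS.inter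
    (isOpen_lt (by fun_prop : Continuous fun y : E3 => y 0) continuous_const).measurableSet
  calc ENNReal.ofReal ε⁻¹ * ∫⁻ y in S ∩ {y | y 0 < ε}, ‖f y‖ₑ
      ≤ ENNReal.ofReal ε⁻¹ * ∫⁻ y in S ∩ {y | y 0 < ε}, C * F y :=
        mul_le_mul_right (setLIntegral_mono' hm fun y hy => hle y hy.1) _
    _ = _ := by rw [lintegral_const_mul' _ _ hC]; ring

theorem TraceZeroOn.sum {S : Set E3} {ι : Type*} (s : Finset ι) {f : ι → E3 → ℝ}
    (hm : ∀ i ∈ s, AEStronglyMeasurable (f i) (volume.restrict S))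
    (hf : ∀ i ∈ s, TraceZeroOn S (f i)) : TraceZeroOn S (fun y => ∑ i ∈ s, f i y) := by
  have h1 := tendsto_finsetSum s hf
  rw [Finset.sum_const_zero] at h1
  refine tendsto_of_tendsto_of_tendsto_of_le_of_le tendsto_const_nhds h1 (fun _ => zero_le)
    fun ε => ?_
  simp only [← Finset.mul_sum]
  rw [← lintegral_finsetSum' _ fun i hi => ((hm i hi).mono_measure
    (Measure.restrict_mono_set _ Set.inter_subset_left)).enorm]
  refine mul_le_mul_right (lintegral_mono fun y => ?_) _
  exact enorm_sum_le _ _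

end Traces

/-! ### Green's formula on the manifold -/

section Green

variable {M : Type*} [TopologicalSpace M] [ChartedSpace (EuclideanHalfSpace 3) M]
  [IsManifold (𝓡∂ 3) ∞ M] [T2Space M] [MeasurableSpace M] [BorelSpace M] [CompactSpace M]
  {n : ℕ} {K : Type*} [TopologicalSpace K] [ChartedSpace (EuclideanSpace ℝ (Fin n)) K] [Group K]
  {g : SmoothMetric M} {κ : AdInvariantInner n K}

/-- The coefficients through which `B` enters the boundary term are combinations, with continuous
factors, of the components `∑ g^{0i} B_{ii'}` of the contraction with the normal field. -/
theorem NormZero.traceZeroOn_fluxCoeff {B : KForm M n K 2} (hm : MeasurableForm B)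
    (h : NormZero g B) (c : M) (ξ : EuclideanSpace ℝ (Fin n)) (j : Fin 3) {S : Set E3}
    (hS : IsCompact S) (hSR : S ⊆ chartRange c) : TraceZeroOn S (fluxCoeff g κ B c ξ j 0) := by
  set ν : Fin 3 → E3 → EuclideanSpace ℝ (Fin n) := fun i' y =>
    ∑ i, invGram g c y 0 i • comp B c ![i, i'] y with hν
  have hsymm : ∀ y i, invGram g c y i 0 = invGram g c y 0 i := by
    intro y i
    have h1 : (gram g c (chartPoint c y)).transpose = gram g c (chartPoint c y) :=
      Matrix.ext fun a b => gram_symm g c _ b a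
    have h2 := Matrix.transpose_nonsing_inv (gram g c (chartPoint c y))
    rw [h1] at h2
    exact congrFun (congrFun h2 0) i
  have hflux : ∀ y, fluxCoeff g κ B c ξ j 0 y
      = ∑ i', ∑ m, (volDensity g c y * invGram g c y i' j *
        modelInner κ (EuclideanSpace.single m 1) ξ) * ν i' y m := by
    intro y
    have h1 : ∀ i', ∑ m, (volDensity g c y * invGram g c y i' j *
        modelInner κ (EuclideanSpace.single m 1) ξ) * ν i' y m
        = volDensity g c y * invGram g c y i' j * modelInner κ (ν i' y) ξ := by
      intro i'
      rw [modelInner_expand_left κ (ν i' y) ξ, Finset.mul_sum]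
      exact Finset.sum_congr rfl fun m _ => by ring
    rw [Finset.sum_congr rfl fun i' _ => h1 i']
    simp only [hν, map_sum, map_smul, LinearMap.sum_apply, LinearMap.smul_apply, smul_eq_mul,
      fluxCoeff, Finset.mul_sum]
    rw [Finset.sum_comm]
    refine Finset.sum_congr rfl fun i' _ => Finset.sum_congr rfl fun i _ => ?_
    rw [hsymm]
    ring
  rw [show fluxCoeff g κ B c ξ j 0 = _ from funext hflux]
  have hνm : ∀ i' m, AEStronglyMeasurable (fun y => ν i' y m) (volume.restrict S) := by
    intro i' m
    have h1 : ∀ y, ν i' y m = ∑ i, invGram g c y 0 i * comp B c ![i, i'] y m := by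
      intro y; simp [hν]
    simp only [h1]
    exact Finset.aestronglyMeasurable_fun_sum _ fun i _ =>
      (((continuousOn_invGram g c 0 i).mono hSR).aestronglyMeasurable hS.measurableSet).mul
        ((hm.coord c _ m).mono_measure (Measure.restrict_mono_set _ hSR))
  have hw : ∀ i' m, ContinuousOn (fun y => volDensity g c y * invGram g c y i' j *
      modelInner κ (EuclideanSpace.single m 1) ξ) S := fun i' m =>
    (((continuousOn_volDensity g c).mul (continuousOn_invGram g c i' j)).mul
      continuousOn_const).mono hSR
  have hterm : ∀ i' m, AEStronglyMeasurable (fun y => (volDensity g c y * invGram g c y i' j *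
      modelInner κ (EuclideanSpace.single m 1) ξ) * ν i' y m) (volume.restrict S) := fun i' m =>
    ((hw i' m).aestronglyMeasurable hS.measurableSet).mul (hνm i' m)
  refine TraceZeroOn.sum _ (fun i' _ => Finset.aestronglyMeasurable_fun_sum _ fun m _ => hterm i' m)
    fun i' _ => TraceZeroOn.sum _ (fun m _ => hterm i' m) fun m _ => ?_
  obtain ⟨C, hC⟩ := hS.exists_bound_of_continuousOn (hw i' m)
  have htr : Filter.Tendsto (fun ε : ℝ => ENNReal.ofReal ε⁻¹ *
      ∫⁻ y in S ∩ {y | y 0 < ε}, ‖ν i' y‖ₑ) (𝓝[>] 0) (𝓝 0) := by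
    refine (h c ![i'] S hS hSR).congr fun ε => ?_
    congr 1
    refine lintegral_congr fun y => ?_
    rw [Pi.zero_apply, sub_zero]
    rfl
  refine TraceZeroOn.of_le hS.measurableSet (C := ENNReal.ofReal C) ENNReal.ofReal_ne_top htr ?_
  intro y hy
  rw [enorm_mul]
  refine mul_le_mul' ?_ ?_
  · rw [← ofReal_norm]
    exact ENNReal.ofReal_le_ofReal (hC y hy)
  · rw [← ofReal_norm, ← ofReal_norm]
    exact ENNReal.ofReal_le_ofReal (PiLp.norm_apply_le (ν i' y) m)

theorem TanZero.traceZeroOn {α : KForm M n K 1} (h : TanZero α) (c : M) {j : Fin 3} (hj : j ≠ 0)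
    (m : Fin n) {S : Set E3} (hS : IsCompact S) (hSR : S ⊆ chartRange c) :
    TraceZeroOn S (fun y => comp α c ![j] y m) := by
  have htr := h c ![j] (fun k => by fin_cases k; exact hj) S hS hSR
  refine TraceZeroOn.of_le hS.measurableSet (C := 1) (by simp) htr ?_
  intro y _
  rw [Pi.zero_apply, sub_zero, one_mul, ← ofReal_norm, ← ofReal_norm]
  exact ENNReal.ofReal_le_ofReal (PiLp.norm_apply_le (comp α c ![j] y) m)

open Classical in
/-- The coordinate expression of a function, extended by zero. -/
def chartCutoff (c : M) (χ : M → ℝ) (y : E3) : ℝ :=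
  if y ∈ chartRange c then χ (chartPoint c y) else 0

theorem chartCutoff_of_mem (c : M) (χ : M → ℝ) {y : E3} (hy : y ∈ chartRange c) :
    chartCutoff c χ y = χ (chartPoint c y) := if_pos hy

/-- A smooth function supported in a chart domain is a cutoff in the half space. -/
theorem isHalfSpaceCutoff_chartCutoff (c : M) {χ : M → ℝ} (hχ : ContMDiff (𝓡∂ 3) 𝓘(ℝ, ℝ) ∞ χ)
    (hsupp : tsupport χ ⊆ (extChartAt (𝓡∂ 3) c).source) (h0 : ∀ x, 0 ≤ χ x) (h1 : ∀ x, χ x ≤ 1) :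
    IsHalfSpaceCutoff (chartRange c) (extChartAt (𝓡∂ 3) c '' tsupport χ) (chartCutoff c χ) := by
  have hS : IsCompact (extChartAt (𝓡∂ 3) c '' tsupport χ) :=
    (isClosed_tsupport χ).isCompact.image_of_continuousOn ((continuousOn_extChartAt c).mono hsupp)
  have hzero : ∀ y ∈ chartRange c, y ∉ extChartAt (𝓡∂ 3) c '' tsupport χ → χ (chartPoint c y) = 0 := by
    intro y hy hyS
    apply image_eq_zero_of_notMem_tsupport
    exact fun h => hyS ⟨_, h, extChartAt_chartPoint c hy⟩
  have hcongr : ∀ y ∈ interior (chartRange c),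
      chartCutoff c χ =ᶠ[𝓝 y] fun z => χ (chartPoint c z) := by
    intro y hy
    filter_upwards [mem_interior_iff_mem_nhds.1 hy] with z hz
    exact chartCutoff_of_mem c χ hz
  refine ⟨chartRange_nonneg c, mem_interior_chartRange c, hS, ?_, ?_, ?_, ?_, ?_, ?_⟩
  · rintro _ ⟨x, hx, rfl⟩
    exact (extChartAt (𝓡∂ 3) c).map_source (hsupp hx)
  · intro y hy
    unfold chartCutoff
    split_ifs with h
    · exact hzero y h hy
    · rfl
  · refine ((contDiffOn_coord hχ c).mono interior_subset).congr fun y hy => ?_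
    exact chartCutoff_of_mem c χ (interior_subset hy)
  · intro y; unfold chartCutoff; split_ifs <;> simp [h0]
  · intro y; unfold chartCutoff; split_ifs <;> simp [h1]
  · have hSR : extChartAt (𝓡∂ 3) c '' tsupport χ ⊆ chartRange c := by
      rintro _ ⟨x, hx, rfl⟩
      exact (extChartAt (𝓡∂ 3) c).map_source (hsupp hx)
    choose C hC using fun i => hS.exists_bound_of_continuousOn
      ((contDiffOn_coord_deriv hχ c i).continuousOn.mono hSR)
    refine ⟨∑ i, |C i|, fun y hy i => ?_⟩
    have hle : |C i| ≤ ∑ i, |C i| :=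
      Finset.single_le_sum (f := fun i => |C i|) (fun i _ => abs_nonneg _) (Finset.mem_univ i)
    by_cases hyS : y ∈ extChartAt (𝓡∂ 3) c '' tsupport χ
    · rw [(hcongr y hy).fderiv_eq, ← fderivWithin_of_mem_nhds (mem_interior_iff_mem_nhds.1 hy)]
      exact ((hC i y hyS).trans (le_abs_self _)).trans hle
    · have : chartCutoff c χ =ᶠ[𝓝 y] fun _ => 0 := by
        filter_upwards [hS.isClosed.isOpen_compl.mem_nhds hyS, mem_interior_iff_mem_nhds.1 hy]
          with z hz hz'
        rw [chartCutoff_of_mem c χ hz', hzero z hz' hz]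
      rw [this.fderiv_eq]
      simpa using (abs_nonneg _).trans hle

theorem dForm_chartCutoff (c : M) {χ : M → ℝ} (hχ : ContMDiff (𝓡∂ 3) 𝓘(ℝ, ℝ) ∞ χ) {y : E3}
    (hy : y ∈ interior (chartRange c)) (i : Fin 3) :
    dForm χ (chartPoint c y) (frame c (chartPoint c y) i)
      = fderiv ℝ (chartCutoff c χ) y (stdVec i) := by
  rw [dForm_frame c (interior_subset hy) (mdifferentiableAt_of_smooth hχ _),
    fderivWithin_of_mem_nhds (mem_interior_iff_mem_nhds.1 hy)]
  congr 1
  refine Filter.EventuallyEq.fderiv_eq ?_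
  filter_upwards [mem_interior_iff_mem_nhds.1 hy] with z hz
  exact (chartCutoff_of_mem c χ hz).symm

/-- A one-form with square integrable weak partial derivatives `P`, and its exterior derivative. -/
structure HasWeakPartials (α : KForm M n K 1) (η : KForm M n K 2)
    (P : M → Fin 3 → Fin 3 → E3 → EuclideanSpace ℝ (Fin n)) : Prop where
  isWeakDeriv : ∀ c i j m, IsWeakDeriv (interior (chartRange c)) i
    (fun y => comp α c ![j] y m) (fun y => P c i j y m)
  l2On : ∀ c i j m, L2On (chartRange c) (fun y => P c i j y m)
  comp_eq : ∀ c k j, ∀ᵐ y ∂(volume : Measure E3).restrict (chartRange c),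
    comp η c ![k, j] y = P c k j y - P c j k y

/-- Green's formula for the components, localized in a chart. -/
theorem HasWeakPartials.integral_greenIntegrand {α : KForm M n K 1} {η : KForm M n K 2}
    {P : M → Fin 3 → Fin 3 → E3 → EuclideanSpace ℝ (Fin n)} (hP : HasWeakPartials α η P)
    (hα : MemL2 g κ α) {B : KForm M n K 2} {δ : KForm M n K 1} (hδ : IsCoderiv g κ B δ) {C : ℝ}
    (hB : ∀ᵐ x ∂(vol g), covInner g κ x (B x) (B x) ≤ C) (hbd : NormZero g B ∨ TanZero α)
    (c : M) {S : Set E3} {χ : E3 → ℝ} (hχ : IsHalfSpaceCutoff (chartRange c) S χ) (j : Fin 3)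
    (m : Fin n) :
    ∫ y in S ∩ {y : E3 | 0 < y 0}, greenIntegrand χ (fun y => comp α c ![j] y m)
      (sourceCoeff g κ δ c (EuclideanSpace.single m 1) j) (fun i y => P c i j y m)
      (fluxCoeff g κ B c (EuclideanSpace.single m 1) j) y = 0 := by
  obtain ⟨Cb, hCb⟩ := bddOn_fluxCoeff hB c (EuclideanSpace.single m 1) j 0 S hχ.isCompact hχ.subset
  refine hχ.integral_greenIntegrand (hα.l2On c _ m) (fun i => hP.l2On c i j m)
    (fun i => hδ.1.fluxCoeff c _ j i) (hδ.2.1.sourceCoeff c _ j) (fun i => hP.isWeakDeriv c i j m)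
    (hδ.hasWeakCodiv c _ j) hCb ?_
  rcases hbd with hN | hT
  · exact ⟨_, Or.inl rfl, hN.traceZeroOn_fluxCoeff hδ.1.1 c _ j hχ.isCompact hχ.subset⟩
  -- For `j = 0` the flux coefficient `B^{j 0}` vanishes by antisymmetry, so that only the tangential
  -- components of `α` enter the boundary term.
  · by_cases hj : j = 0
    · subst hj
      refine ⟨_, Or.inl rfl, ?_⟩
      simp [fluxCoeff_antisymm]
    · exact ⟨_, Or.inr rfl, hT.traceZeroOn c hj m hχ.isCompact hχ.subset⟩

/-- The integrand of Green's formula with a cutoff function `χ`. -/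
def greenDensity (g : SmoothMetric M) (κ : AdInvariantInner n K) (χ : M → ℝ) (α : KForm M n K 1)
    (η B : KForm M n K 2) (δ : KForm M n K 1) (x : M) : ℝ :=
  covInner g κ x (B x) (covectorWedge (dForm χ x) (α x)) + χ x * covInner g κ x (B x) (η x)
    - χ x * covInner g κ x (δ x) (α x)

/-- In coordinates the Green density is the sum over components of the half space integrands. -/
theorem HasWeakPartials.volDensity_mul_greenDensity {α : KForm M n K 1} {η : KForm M n K 2}
    {P : M → Fin 3 → Fin 3 → E3 → EuclideanSpace ℝ (Fin n)} (hP : HasWeakPartials α η P)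
    (B : KForm M n K 2) (δ : KForm M n K 1) {χ : M → ℝ} (hχ : ContMDiff (𝓡∂ 3) 𝓘(ℝ, ℝ) ∞ χ)
    (c : M) : ∀ᵐ y ∂(volume : Measure E3).restrict (interior (chartRange c)),
      volDensity g c y * greenDensity g κ χ α η B δ (chartPoint c y)
        = ∑ j, ∑ m, greenIntegrand (chartCutoff c χ) (fun y => comp α c ![j] y m)
          (sourceCoeff g κ δ c (EuclideanSpace.single m 1) j) (fun i y => P c i j y m)
          (fluxCoeff g κ B c (EuclideanSpace.single m 1) j) y := by
  have hae : ∀ᵐ y ∂(volume : Measure E3).restrict (interior (chartRange c)), ∀ k j,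
      comp η c ![k, j] y = P c k j y - P c j k y := by
    refine ae_mono (Measure.restrict_mono_set _ interior_subset) ?_
    exact ae_all_iff.2 fun k => ae_all_iff.2 fun j => hP.comp_eq c k j
  filter_upwards [hae, ae_restrict_mem isOpen_interior.measurableSet] with y hy hyi
  have hyR := interior_subset hyi
  have e1 := volDensity_mul_covInner_two g κ B η c hyR hy
  have e2 := volDensity_mul_covInner_one g κ δ α c hyR
  have e3 := volDensity_mul_covInner_two g κ B (fun x => covectorWedge (dForm χ x) (α x)) c hyR
    (P := fun k j => fderiv ℝ (chartCutoff c χ) y (stdVec k) • comp α c ![j] y) (by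
      intro k j
      simp only [← dForm_chartCutoff c hχ hyi, comp_one]
      rfl)
  have e4 : volDensity g c y * greenDensity g κ χ α η B δ (chartPoint c y)
      = volDensity g c y * covInner g κ (chartPoint c y) (B (chartPoint c y))
          (covectorWedge (dForm χ (chartPoint c y)) (α (chartPoint c y)))
        + χ (chartPoint c y) * (volDensity g c y * covInner g κ (chartPoint c y)
          (B (chartPoint c y)) (η (chartPoint c y)))
        - χ (chartPoint c y) * (volDensity g c y * covInner g κ (chartPoint c y)
          (δ (chartPoint c y)) (α (chartPoint c y))) := by
    unfold greenDensity; ring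
  rw [e4, e1, e2, e3, ← chartCutoff_of_mem c χ hyR]
  simp only [Finset.mul_sum, ← Finset.sum_add_distrib, ← Finset.sum_sub_distrib, greenIntegrand]
  refine Finset.sum_congr rfl fun j _ => Finset.sum_congr rfl fun m _ => ?_
  simp only [PiLp.smul_apply, smul_eq_mul]
  congr 1
  · exact Finset.sum_congr rfl fun i _ => by ring
  · ring

/-- Green's formula localized by a cutoff function with support in a chart domain. -/
theorem HasWeakPartials.integral_greenDensity {α : KForm M n K 1} {η : KForm M n K 2}
    {P : M → Fin 3 → Fin 3 → E3 → EuclideanSpace ℝ (Fin n)} (hP : HasWeakPartials α η P)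
    (hα : MemL2 g κ α) {B : KForm M n K 2} {δ : KForm M n K 1} (hδ : IsCoderiv g κ B δ) {C : ℝ}
    (hB : ∀ᵐ x ∂(vol g), covInner g κ x (B x) (B x) ≤ C) (hbd : NormZero g B ∨ TanZero α)
    (c : M) {χ : M → ℝ} (hχ : ContMDiff (𝓡∂ 3) 𝓘(ℝ, ℝ) ∞ χ)
    (hsupp : tsupport χ ⊆ (extChartAt (𝓡∂ 3) c).source) (h0 : ∀ x, 0 ≤ χ x) (h1 : ∀ x, χ x ≤ 1) :
    Integrable (greenDensity g κ χ α η B δ) (vol g) ∧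
      ∫ x, greenDensity g κ χ α η B δ x ∂(vol g) = 0 := by
  have hcut := isHalfSpaceCutoff_chartCutoff c hχ hsupp h0 h1
  set S := extChartAt (𝓡∂ 3) c '' tsupport χ with hS
  have hd0 : ∀ x, x ∉ tsupport χ → greenDensity g κ χ α η B δ x = 0 := by
    intro x hx
    have e1 : χ =ᶠ[𝓝 x] fun _ => 0 := by
      filter_upwards [(isClosed_tsupport χ).isOpen_compl.mem_nhds hx] with z hz
      exact image_eq_zero_of_notMem_tsupport hz
    have e2 : dForm χ x = 0 := by
      unfold dForm
      rw [e1.mfderiv_eq, mfderiv_const]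
      rfl
    rw [greenDensity, e2, e1.self_of_nhds, covectorWedge_zero, ← covForm_apply, map_zero]
    ring
  have hsrc : ∀ x, x ∉ (extChartAt (𝓡∂ 3) c).source → greenDensity g κ χ α η B δ x = 0 :=
    fun x hx => hd0 x fun h => hx (hsupp h)
  set F : E3 → ℝ := fun y => volDensity g c y * greenDensity g κ χ α η B δ (chartPoint c y) with hF
  have hsub : S ∩ {y : E3 | 0 < y 0} ⊆ interior (chartRange c) := fun y hy =>
    mem_interior_chartRange c y (hcut.subset hy.1) hy.2
  have hF0 : ∀ y ∈ interior (chartRange c) \ (S ∩ {y : E3 | 0 < y 0}), F y = 0 := by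
    rintro y ⟨hy, hyS⟩
    have hy' := hy
    rw [interior_chartRange] at hy'
    rw [hF]
    simp only
    rw [hd0, mul_zero]
    intro h
    exact hyS ⟨⟨_, h, extChartAt_chartPoint c hy'.1⟩, hy'.2⟩
  have hmS : MeasurableSet (S ∩ {y : E3 | 0 < y 0}) := hcut.measurableSet
  have hae := ae_mono (Measure.restrict_mono_set volume hsub)
    (hP.volDensity_mul_greenDensity (g := g) (κ := κ) B δ hχ c)
  have hint : ∀ j m, Integrable (greenIntegrand (chartCutoff c χ) (fun y => comp α c ![j] y m)
          (sourceCoeff g κ δ c (EuclideanSpace.single m 1) j) (fun i y => P c i j y m)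
          (fluxCoeff g κ B c (EuclideanSpace.single m 1) j))
          (volume.restrict (S ∩ {y : E3 | 0 < y 0})) := fun j m =>
    hcut.integrable_greenIntegrand (hα.l2On c _ m) (fun i => hP.l2On c i j m)
      (fun i => hδ.1.fluxCoeff c _ j i) (hδ.2.1.sourceCoeff c _ j)
  have hi1 : IntegrableOn F (S ∩ {y : E3 | 0 < y 0}) := by
    refine Integrable.congr ?_ (Filter.EventuallyEq.symm hae)
    exact integrable_finsetSum _ fun j _ => integrable_finsetSum _ fun m _ => hint j m
  have hi2 : IntegrableOn F (interior (chartRange c)) :=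
    hi1.of_forall_sdiff_eq_zero isOpen_interior.measurableSet hF0
  constructor
  · refine integrable_vol_of_chart g c hsrc ?_
    exact hi2.congr_set_ae (chartRange_ae_interior c)
  · rw [integral_vol_eq g c hsrc, setIntegral_congr_set (chartRange_ae_interior c),
      setIntegral_eq_of_subset_of_forall_sdiff_eq_zero isOpen_interior.measurableSet hsub hF0,
      integral_congr_ae hae, integral_finsetSum _ fun j _ => integrable_finsetSum _ fun m _ => hint j m]
    refine Finset.sum_eq_zero fun j _ => ?_
    rw [integral_finsetSum _ fun m _ => hint j m]
    exact Finset.sum_eq_zero fun m _ =>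
      hP.integral_greenIntegrand hα hδ hB hbd c hcut j m

variable (M) in
/-- A finite smooth partition of unity subordinate to chart domains. -/
theorem exists_finite_partition : ∃ (N : ℕ) (c : Fin N → M) (χ : Fin N → M → ℝ),
    (∀ i, ContMDiff (𝓡∂ 3) 𝓘(ℝ, ℝ) ∞ (χ i)) ∧
    (∀ i, tsupport (χ i) ⊆ (extChartAt (𝓡∂ 3) (c i)).source) ∧ (∀ i x, 0 ≤ χ i x) ∧
    (∀ i x, χ i x ≤ 1) ∧ ∀ x, ∑ i, χ i x = 1 := by
  obtain ⟨f, hf⟩ := SmoothPartitionOfUnity.exists_isSubordinate_chartAt_source (𝓡∂ 3) M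
  have hfin := f.locallyFinite.finite_nonempty_of_compact
  let e := hfin.toFinset.equivFin
  refine ⟨_, fun i => e.symm i, fun i => f (e.symm i), fun i => (f _).contMDiff, fun i => ?_,
    fun i => f.nonneg _, fun i => f.le_one _, fun x => ?_⟩
  · rw [extChartAt_source]; exact hf _
  · rw [e.symm.sum_comp (fun c => f c x), Finset.sum_coe_sort _ fun c => f c x,
      ← f.sum_eq_one (Set.mem_univ x), finsum_eq_sum_of_support_subset]
    intro c hc
    rw [Set.Finite.coe_toFinset]
    exact ⟨x, hc⟩

/-- Green's formula: if the normal part of `B` or the tangential part of `α` vanishes on the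
boundary, then `(d*B, α) = (B, dα)`. -/
theorem HasWeakPartials.green {α : KForm M n K 1} {η : KForm M n K 2}
    {P : M → Fin 3 → Fin 3 → E3 → EuclideanSpace ℝ (Fin n)} (hP : HasWeakPartials α η P)
    (hα : MemL2 g κ α) {B : KForm M n K 2} {δ : KForm M n K 1} (hδ : IsCoderiv g κ B δ) {C : ℝ}
    (hB : ∀ᵐ x ∂(vol g), covInner g κ x (B x) (B x) ≤ C) (hbd : NormZero g B ∨ TanZero α) :
    Integrable (fun x => covInner g κ x (B x) (η x)) (vol g) ∧
      l2Inner g κ δ α = l2Inner g κ B η := by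
  obtain ⟨N, c, χ, hχ, hsupp, h0, h1, hsum⟩ := exists_finite_partition M
  have hloc := fun i => hP.integral_greenDensity hα hδ hB hbd (c i) (hχ i) (hsupp i) (h0 i) (h1 i)
  -- the gradient terms of the localized formulas cancel, as the functions `χ i` add up to `1`
  have hd : ∀ x, ∑ i, dForm (χ i) x = 0 := by
    intro x
    have e1 : HasMFDerivAt (𝓡∂ 3) 𝓘(ℝ, ℝ) (∑ i, χ i) x
        (∑ i, (show TangentSpace (𝓡∂ 3) x →L[ℝ] ℝ from mfderiv (𝓡∂ 3) 𝓘(ℝ, ℝ) (χ i) x)) :=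
      HasMFDerivAt.sum fun i _ => (mdifferentiableAt_of_smooth (hχ i) x).hasMFDerivAt
    have e2 : ∑ i, χ i = fun _ => (1 : ℝ) := by
      ext x
      rw [Finset.sum_apply, hsum]
    rw [e2] at e1
    have e3 := hasMFDerivAt_unique e1 (hasMFDerivAt_const (1 : ℝ) x)
    ext X
    have e4 := congrArg (fun L : TangentSpace (𝓡∂ 3) x →L[ℝ] ℝ => L X) e3
    rw [LinearMap.sum_apply]
    refine Eq.trans ?_ e4
    have e5 : ∀ L : Fin N → TangentSpace (𝓡∂ 3) x →L[ℝ] ℝ, (∑ i, L i) X = ∑ i, L i X := by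
      intro L
      simp
    exact (e5 _).symm
  have hpt : ∀ x, ∑ i, greenDensity g κ (χ i) α η B δ x
      = covInner g κ x (B x) (η x) - covInner g κ x (δ x) (α x) := by
    intro x
    simp only [greenDensity, Finset.sum_sub_distrib, Finset.sum_add_distrib, ← Finset.sum_mul, hsum,
      one_mul]
    rw [← covForm_apply]
    simp only [← covForm_apply]
    rw [← map_sum, ← sum_covectorWedge, hd, covectorWedge_zero, map_zero, zero_add]
  have hi : Integrable (fun x => covInner g κ x (B x) (η x) - covInner g κ x (δ x) (α x)) (vol g) := by
    simp only [← hpt]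
    exact integrable_finsetSum _ fun i _ => (hloc i).1
  have hi2 := hδ.2.1.integrable hα
  have hi1 : Integrable (fun x => covInner g κ x (B x) (η x)) (vol g) := by
    refine (hi.add hi2).congr (Filter.Eventually.of_forall fun x => ?_)
    simp
  refine ⟨hi1, ?_⟩
  have h2 : ∫ x, (covInner g κ x (B x) (η x) - covInner g κ x (δ x) (α x)) ∂(vol g) = 0 := by
    simp only [← hpt]
    rw [integral_finsetSum _ fun i _ => (hloc i).1]
    exact Finset.sum_eq_zero fun i _ => (hloc i).2
  rw [integral_sub hi1 hi2] at h2
  unfold l2Inner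
  linarith

end Green

/-! ### Weak derivatives of the difference of two connections -/

section WeakDerivatives

variable {n : ℕ} {U : Set E3}

theorem LocallyIntegrableOn.integrable_smul_of_tsupport {f : E3 → EuclideanSpace ℝ (Fin n)}
    (hf : LocallyIntegrableOn f U) {φ : E3 → ℝ} (hφ : Continuous φ) (hc : HasCompactSupport φ)
    (hsub : tsupport φ ⊆ U) : Integrable (fun y => φ y • f y) := by
  have h1 : IntegrableOn (fun y => φ y • f y) (tsupport φ) :=
    (hf.integrableOn_compact_subset hsub hc.isCompact).continuousOn_smul hφ.continuousOn
      hc.isCompact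
  refine (integrableOn_iff_integrable_of_support_subset fun y hy => ?_).1 h1
  by_contra h
  exact hy (by simp [image_eq_zero_of_notMem_tsupport h])

theorem IsTestFunction.integrable_smul {f : E3 → EuclideanSpace ℝ (Fin n)} {φ : E3 → ℝ}
    (hφ : IsTestFunction U φ) (hf : LocallyIntegrableOn f U) : Integrable (fun y => φ y • f y) :=
  LocallyIntegrableOn.integrable_smul_of_tsupport hf hφ.1.continuous hφ.2.1 hφ.2.2

theorem IsTestFunction.integrable_fderiv_smul {f : E3 → EuclideanSpace ℝ (Fin n)} {φ : E3 → ℝ}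
    (hφ : IsTestFunction U φ) (hf : LocallyIntegrableOn f U) (i : Fin 3) :
    Integrable (fun y => fderiv ℝ φ y (stdVec i) • f y) :=
  LocallyIntegrableOn.integrable_smul_of_tsupport hf (hφ.continuous_fderiv i)
    (hφ.hasCompactSupport_fderiv i)
    ((tsupport_fderiv_apply_subset ℝ (stdVec i)).trans hφ.2.2)

theorem IsWeakPartial.sub {i : Fin 3} {f f₁ h h₁ : E3 → EuclideanSpace ℝ (Fin n)}
    (hf : IsWeakPartial U i f f₁) (hh : IsWeakPartial U i h h₁) :
    IsWeakPartial U i (f - h) (f₁ - h₁) := by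
  refine ⟨hf.1.sub hh.1, hf.2.1.sub hh.2.1, fun φ hφ => ?_⟩
  simp only [Pi.sub_apply, smul_sub]
  rw [integral_sub (hφ.integrable_fderiv_smul hf.1 i) (hφ.integrable_fderiv_smul hh.1 i),
    integral_sub (hφ.integrable_smul hf.2.1) (hφ.integrable_smul hh.2.1), hf.2.2 φ hφ, hh.2.2 φ hφ]
  abel

theorem IsWeakPartial.coord {i : Fin 3} {f f₁ : E3 → EuclideanSpace ℝ (Fin n)}
    (hf : IsWeakPartial U i f f₁) (m : Fin n) :
    IsWeakDeriv U i (fun y => f y m) (fun y => f₁ y m) := by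
  intro φ hφ
  have h := congrArg (EuclideanSpace.proj m : EuclideanSpace ℝ (Fin n) →L[ℝ] ℝ) (hf.2.2 φ hφ)
  rw [map_neg, ← ContinuousLinearMap.integral_comp_comm _ (hφ.integrable_fderiv_smul hf.1 i),
    ← ContinuousLinearMap.integral_comp_comm _ (hφ.integrable_smul hf.2.1)] at h
  simpa using h

variable {M : Type*} [TopologicalSpace M] [ChartedSpace (EuclideanHalfSpace 3) M]
  [IsManifold (𝓡∂ 3) ∞ M]
  {K : Type*} [TopologicalSpace K] [ChartedSpace (EuclideanSpace ℝ (Fin n)) K] [Group K]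

/-- The weak exterior derivative is the antisymmetrization of the weak partial derivatives. -/
theorem IsExtDeriv.comp_eq {α : KForm M n K 1} {η : KForm M n K 2} (h : IsExtDeriv α η) (c : M)
    {P : Fin 3 → Fin 3 → E3 → EuclideanSpace ℝ (Fin n)}
    (hP : ∀ i j, IsWeakPartial (interior (chartRange c)) i (comp α c ![j]) (P i j)) (k j : Fin 3) :
    ∀ᵐ y ∂(volume : Measure E3).restrict (chartRange c),
      comp η c ![k, j] y = P k j y - P j k y := by
  obtain ⟨-, hη, hw⟩ := h c k j
  have key := isOpen_interior.ae_eq_zero_of_integral_contDiff_smul_eq_zero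
    (hη.sub ((hP k j).2.1.sub (hP j k).2.1)) (fun φ h1 h2 h3 => by
      have hφ : IsTestFunction (interior (chartRange c)) φ := ⟨h1, h2, h3⟩
      have e := hw φ hφ
      rw [integral_sub (hφ.integrable_fderiv_smul (hP k j).1 k)
        (hφ.integrable_fderiv_smul (hP j k).1 j), (hP k j).2.2 φ hφ, (hP j k).2.2 φ hφ] at e
      simp only [Pi.sub_apply, smul_sub]
      have hi1 := hφ.integrable_smul (hP k j).2.1
      have hi2 := hφ.integrable_smul (hP j k).2.1
      have e2 := integral_sub (hφ.integrable_smul hη) (hi1.sub hi2)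
      simp only [Pi.sub_apply] at e2
      rw [e2, integral_sub hi1 hi2, ← neg_eq_iff_eq_neg.2 e]
      abel)
  rw [Measure.restrict_congr_set (chartRange_ae_interior c),
    ae_restrict_iff' isOpen_interior.measurableSet]
  filter_upwards [key] with y hy hyU
  exact sub_eq_zero.1 (hy hyU)

variable [MeasurableSpace M] [BorelSpace M] [CompactSpace M] [T2Space M]
  {g : SmoothMetric M} {κ : AdInvariantInner n K}

/-- The difference of two forms in `W_1` has square integrable weak partial derivatives, and its weak
exterior derivative is given by them. -/
theorem MemW1.exists_hasWeakPartials_sub {α α' : KForm M n K 1} {η η' : KForm M n K 2}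
    (hα : MemW1 g κ α) (hα' : MemW1 g κ α') (hη : IsExtDeriv α η) (hη' : IsExtDeriv α' η') :
    ∃ P, HasWeakPartials (α - α') (η - η') P := by
  obtain ⟨P, hP⟩ := hα.exists_weakPartial
  obtain ⟨P', hP'⟩ := hα'.exists_weakPartial
  refine ⟨fun c i j => P c i ![j] - P' c i ![j], ⟨fun c i j m => ?_, fun c i j m => ?_,
    fun c k j => ?_⟩⟩
  · exact ((hP c i ![j]).1.sub (hP' c i ![j]).1).coord m
  · exact fun S hS hSR => ((hP c i ![j]).2 m S hS hSR).sub ((hP' c i ![j]).2 m S hS hSR)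
  · filter_upwards [hη.comp_eq c (P := fun i j => P c i ![j]) (fun i j => (hP c i ![j]).1) k j,
      hη'.comp_eq c (P := fun i j => P' c i ![j]) (fun i j => (hP' c i ![j]).1) k j] with y h1 h2
    have h3 : comp (η - η') c ![k, j] y = comp η c ![k, j] y - comp η' c ![k, j] y := rfl
    rw [h3, h1, h2]
    simp only [Pi.sub_apply]
    abel

theorem TanZero.sub {α α' : KForm M n K 1} (hm : MeasurableForm α)
    (h : TanZero α) (h' : TanZero α') : TanZero (α - α') := by
  intro c J hJ S hS hSR
  have h1 := (h c J hJ S hS hSR).add (h' c J hJ S hS hSR)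
  rw [add_zero] at h1
  refine tendsto_of_tendsto_of_tendsto_of_le_of_le tendsto_const_nhds h1 (fun _ => zero_le)
    fun ε => ?_
  simp only [← mul_add, Pi.zero_apply, sub_zero]
  rw [← lintegral_add_left' (((hm c J).mono_measure
    (Measure.restrict_mono_set _ (Set.inter_subset_left.trans hSR))).enorm)]
  refine mul_le_mul_right (lintegral_mono fun y => ?_) _
  exact enorm_sub_le

end WeakDerivatives

/-! ### The energy identity -/

section Energy

variable {M : Type*} [TopologicalSpace M] [ChartedSpace (EuclideanHalfSpace 3) M]
  [IsManifold (𝓡∂ 3) ∞ M]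
  {n : ℕ} {K : Type*} [TopologicalSpace K] [ChartedSpace (EuclideanSpace ℝ (Fin n)) K] [Group K]
  [LieGroup (𝓡 n) ∞ K]

/-- The difference of the exterior derivatives of two connections, in terms of the difference of
the curvatures. -/
theorem curvature_difference_left {x : M}
    (a a' : (TangentSpace (𝓡∂ 3) x) [⋀^Fin 1]→ₗ[ℝ] GroupLieAlgebra (𝓡 n) K)
    (b b' : (TangentSpace (𝓡∂ 3) x) [⋀^Fin 2]→ₗ[ℝ] GroupLieAlgebra (𝓡 n) K) :
    (b - (1 / 2 : ℝ) • bracketWedge a a) - (b' - (1 / 2 : ℝ) • bracketWedge a' a')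
      = (b - b') + (1 / 2 : ℝ) • bracketWedge (a - a') (a - a') - bracketWedge a (a - a') := by
  ext X
  have h1 : bracketWedge a a X = ⁅a ![X 0], a ![X 1]⁆ - ⁅a ![X 1], a ![X 0]⁆ := rfl
  have h2 : bracketWedge a' a' X = ⁅a' ![X 0], a' ![X 1]⁆ - ⁅a' ![X 1], a' ![X 0]⁆ := rfl
  have h3 : bracketWedge (a - a') (a - a') X = ⁅a ![X 0] - a' ![X 0], a ![X 1] - a' ![X 1]⁆
    - ⁅a ![X 1] - a' ![X 1], a ![X 0] - a' ![X 0]⁆ := rfl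
  have h4 : bracketWedge a (a - a') X = ⁅a ![X 0], a ![X 1] - a' ![X 1]⁆
    - ⁅a ![X 1], a ![X 0] - a' ![X 0]⁆ := rfl
  simp only [AlternatingMap.sub_apply, AlternatingMap.add_apply, AlternatingMap.smul_apply, h1, h2,
    h3, h4, lie_sub, sub_lie]
  rw [← lie_skew (a ![X 1]) (a ![X 0]), ← lie_skew (a' ![X 1]) (a' ![X 0]),
    ← lie_skew (a' ![X 1]) (a ![X 0]), ← lie_skew (a ![X 1]) (a' ![X 0])]
  module

/-- The same difference, written with `a'` in place of `a` in the linear term. -/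
theorem curvature_difference_right {x : M}
    (a a' : (TangentSpace (𝓡∂ 3) x) [⋀^Fin 1]→ₗ[ℝ] GroupLieAlgebra (𝓡 n) K)
    (b b' : (TangentSpace (𝓡∂ 3) x) [⋀^Fin 2]→ₗ[ℝ] GroupLieAlgebra (𝓡 n) K) :
    (b - (1 / 2 : ℝ) • bracketWedge a a) - (b' - (1 / 2 : ℝ) • bracketWedge a' a')
      = (b - b') - (1 / 2 : ℝ) • bracketWedge (a - a') (a - a') - bracketWedge a' (a - a') := by
  ext X
  have h1 : bracketWedge a a X = ⁅a ![X 0], a ![X 1]⁆ - ⁅a ![X 1], a ![X 0]⁆ := rfl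
  have h2 : bracketWedge a' a' X = ⁅a' ![X 0], a' ![X 1]⁆ - ⁅a' ![X 1], a' ![X 0]⁆ := rfl
  have h3 : bracketWedge (a - a') (a - a') X = ⁅a ![X 0] - a' ![X 0], a ![X 1] - a' ![X 1]⁆
    - ⁅a ![X 1] - a' ![X 1], a ![X 0] - a' ![X 0]⁆ := rfl
  have h4 : bracketWedge a' (a - a') X = ⁅a' ![X 0], a ![X 1] - a' ![X 1]⁆
    - ⁅a' ![X 1], a ![X 0] - a' ![X 0]⁆ := rfl
  simp only [AlternatingMap.sub_apply, AlternatingMap.smul_apply, h1, h2,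
    h3, h4, lie_sub, sub_lie]
  rw [← lie_skew (a ![X 1]) (a ![X 0]), ← lie_skew (a' ![X 1]) (a' ![X 0]),
    ← lie_skew (a' ![X 1]) (a ![X 0]), ← lie_skew (a ![X 1]) (a' ![X 0])]
  module

/-- The pointwise form of the energy estimate: the quadratic term `|B - B'|²` has a good sign. -/
theorem energyDensity_le (g : SmoothMetric M) (κ : AdInvariantInner n K) {x : M} {Cw : ℝ}
    (hCw : ∀ u v : (TangentSpace (𝓡∂ 3) x) [⋀^Fin 1]→ₗ[ℝ] GroupLieAlgebra (𝓡 n) K,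
      covInner g κ x (bracketWedge u v) (bracketWedge u v)
        ≤ Cw * (covInner g κ x u u * covInner g κ x v v)) (hCw0 : 0 ≤ Cw)
    (a a' : (TangentSpace (𝓡∂ 3) x) [⋀^Fin 1]→ₗ[ℝ] GroupLieAlgebra (𝓡 n) K)
    (b b' h : (TangentSpace (𝓡∂ 3) x) [⋀^Fin 2]→ₗ[ℝ] GroupLieAlgebra (𝓡 n) K)
    (hh : h = (b - (1 / 2 : ℝ) • bracketWedge a a) - (b' - (1 / 2 : ℝ) • bracketWedge a' a'))
    {C C' : ℝ} (hC : 0 ≤ C) (hC' : 0 ≤ C') (hb : covInner g κ x b b ≤ C ^ 2)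
    (hb' : covInner g κ x b' b' ≤ C' ^ 2) :
    - (covInner g κ x b h + covInner g κ x (bracketWedge a (a - a')) b)
      + (covInner g κ x b' h + covInner g κ x (bracketWedge a' (a - a')) b')
      ≤ (C + C') * √Cw * covInner g κ x (a - a') (a - a') := by
  set w := bracketWedge (a - a') (a - a') with hw
  have hd0 := covInner_nonneg g κ x (a - a')
  have e1 : covInner g κ x b h + covInner g κ x (bracketWedge a (a - a')) b
      = covInner g κ x b (b - b') + (1 / 2) * covInner g κ x b w := by
    rw [hh, curvature_difference_left, covInner_sub_right, covInner_add_right, covInner_smul_right,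
      covInner_comm g κ x (bracketWedge a (a - a')) b]
    ring
  have e2 : covInner g κ x b' h + covInner g κ x (bracketWedge a' (a - a')) b'
      = covInner g κ x b' (b - b') - (1 / 2) * covInner g κ x b' w := by
    rw [hh, curvature_difference_right, covInner_sub_right, covInner_sub_right, covInner_smul_right,
      covInner_comm g κ x (bracketWedge a' (a - a')) b']
    ring
  have e3 : covInner g κ x b (b - b') - covInner g κ x b' (b - b')
      = covInner g κ x (b - b') (b - b') := by
    rw [← covInner_sub_left]
  have e4 := covInner_nonneg g κ x (b - b')
  have hbound : ∀ (β : (TangentSpace (𝓡∂ 3) x) [⋀^Fin 2]→ₗ[ℝ] GroupLieAlgebra (𝓡 n) K) (D : ℝ),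
      0 ≤ D → covInner g κ x β β ≤ D ^ 2 →
      |covInner g κ x β w| ≤ D * √Cw * covInner g κ x (a - a') (a - a') := by
    intro β D hD hβ
    refine abs_le_of_sq_le_sq ?_ (by positivity)
    refine (covInner_sq_le g κ x β w).trans ?_
    have h1 := hCw (a - a') (a - a')
    calc covInner g κ x β β * covInner g κ x w w
        ≤ D ^ 2 * (Cw * (covInner g κ x (a - a') (a - a') * covInner g κ x (a - a') (a - a'))) :=
          mul_le_mul hβ h1 (covInner_nonneg g κ x w) (sq_nonneg _)
      _ = (D * √Cw * covInner g κ x (a - a') (a - a')) ^ 2 := by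
          rw [mul_pow, mul_pow, Real.sq_sqrt hCw0]; ring
  have h1 := (abs_le.1 (hbound b C hC hb)).1
  have h2 := (abs_le.1 (hbound b' C' hC' hb')).1
  have h3 : 0 ≤ C * √Cw * covInner g κ x (a - a') (a - a') := by positivity
  have h4 : 0 ≤ C' * √Cw * covInner g κ x (a - a') (a - a') := by positivity
  rw [e1, e2]
  nlinarith

variable [T2Space M] [MeasurableSpace M] [BorelSpace M] [CompactSpace M]
  {g : SmoothMetric M} {κ : AdInvariantInner n K}

/-- The pairing of a covariant coderivative with a one-form is the pairing of the two-form with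
the covariant exterior derivative. -/
theorem IsCovCoderiv.green {A : KForm M n K 1} {B : KForm M n K 2} {A' : KForm M n K 1}
    (hA : IsCovCoderiv g κ A B (-A')) (hA' : MemL2 g κ A') {α : KForm M n K 1} {η : KForm M n K 2}
    {P : M → Fin 3 → Fin 3 → E3 → EuclideanSpace ℝ (Fin n)} (hP : HasWeakPartials α η P)
    (hα : MemL2 g κ α) {C : ℝ} (hB : ∀ᵐ x ∂(vol g), covInner g κ x (B x) (B x) ≤ C)
    (hbd : NormZero g B ∨ TanZero α) :
    Integrable (fun x => covInner g κ x (B x) (η x)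
      + covInner g κ x (bracketWedge (A x) (α x)) (B x)) (vol g) ∧
    l2Inner g κ A' α = - ∫ x, (covInner g κ x (B x) (η x)
      + covInner g κ x (bracketWedge (A x) (α x)) (B x)) ∂(vol g) := by
  obtain ⟨δ, ι, hδ, hι, hsum⟩ := hA
  obtain ⟨hi, hgreen⟩ := hP.green hα hδ hB hbd
  have hpt : ∀ᵐ x ∂(vol g), covInner g κ x (bracketWedge (A x) (α x)) (B x)
      = - covInner g κ x (A' x) (α x) - covInner g κ x (δ x) (α x) := by
    filter_upwards [hsum] with x hx
    have e1 : -A' x = δ x + ι x := hx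
    -- `ι` is not assumed to be measurable; the equation expresses it by `A'` and `δ` almost everywhere
    have e2 : ι x = (-1 : ℝ) • A' x - δ x := by rw [neg_one_smul, e1]; abel
    rw [← hι x (α x), covInner_comm, e2, covInner_sub_left, covInner_smul_left]
    ring
  have hi2 := hA'.integrable hα
  have hi3 := hδ.2.1.integrable hα
  have hi4 : Integrable (fun x => covInner g κ x (bracketWedge (A x) (α x)) (B x)) (vol g) :=
    (hi2.neg.sub hi3).congr (Filter.EventuallyEq.symm hpt)
  refine ⟨hi.add hi4, ?_⟩
  have h0 := integral_sub hi2.neg hi3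
  simp only [Pi.neg_apply] at h0
  rw [integral_add hi hi4, integral_congr_ae hpt, h0, integral_neg]
  have h1 : l2Inner g κ δ α = l2Inner g κ B η := hgreen
  unfold l2Inner at h1 ⊢
  linarith

end Energy

/-! ### Differentiation of the squared norm -/

section L2Derivative

variable {M : Type*} [TopologicalSpace M] [ChartedSpace (EuclideanHalfSpace 3) M]
  [IsManifold (𝓡∂ 3) ∞ M] [MeasurableSpace M] [BorelSpace M] [CompactSpace M]
  {n : ℕ} {K : Type*} [TopologicalSpace K] [ChartedSpace (EuclideanSpace ℝ (Fin n)) K] [Group K]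
  {p : ℕ} {g : SmoothMetric M} {κ : AdInvariantInner n K}

theorem l2Inner_comm (θ η : KForm M n K p) : l2Inner g κ θ η = l2Inner g κ η θ :=
  integral_congr_ae (Filter.Eventually.of_forall fun x => covInner_comm g κ x _ _)

theorem MemL2.l2Inner_add_left {θ η ζ : KForm M n K p} (hθ : MemL2 g κ θ) (hη : MemL2 g κ η)
    (hζ : MemL2 g κ ζ) : l2Inner g κ (θ + η) ζ = l2Inner g κ θ ζ + l2Inner g κ η ζ := by
  unfold l2Inner
  rw [← integral_add (hθ.integrable hζ) (hη.integrable hζ)]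
  exact integral_congr_ae (Filter.Eventually.of_forall fun x => covInner_add_left g κ x _ _ _)

theorem MemL2.l2Inner_sub_left {θ η ζ : KForm M n K p} (hθ : MemL2 g κ θ) (hη : MemL2 g κ η)
    (hζ : MemL2 g κ ζ) : l2Inner g κ (θ - η) ζ = l2Inner g κ θ ζ - l2Inner g κ η ζ := by
  unfold l2Inner
  rw [← integral_sub (hθ.integrable hζ) (hη.integrable hζ)]
  exact integral_congr_ae (Filter.Eventually.of_forall fun x => covInner_sub_left g κ x _ _ _)

theorem l2Inner_smul_left (θ η : KForm M n K p) (r : ℝ) :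
    l2Inner g κ (r • θ) η = r * l2Inner g κ θ η := by
  unfold l2Inner
  rw [← integral_const_mul]
  exact integral_congr_ae (Filter.Eventually.of_forall fun x => covInner_smul_left g κ x _ _ _)

theorem MemL2.l2Inner_add_smul_self {θ η : KForm M n K p} (hθ : MemL2 g κ θ) (hη : MemL2 g κ η)
    (r : ℝ) : l2Inner g κ (θ + r • η) (θ + r • η)
      = l2Inner g κ θ θ + 2 * r * l2Inner g κ θ η + r ^ 2 * l2Inner g κ η η := by
  have hs := hθ.add (hη.smul r)
  rw [hθ.l2Inner_add_left (hη.smul r) hs, l2Inner_smul_left, l2Inner_comm θ, l2Inner_comm η,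
    hθ.l2Inner_add_left (hη.smul r) hθ, hθ.l2Inner_add_left (hη.smul r) hη, l2Inner_smul_left,
    l2Inner_smul_left, l2Inner_comm η θ]
  ring

/-- The Cauchy-Schwarz inequality. -/
theorem MemL2.l2Inner_sq_le {θ η : KForm M n K p} (hθ : MemL2 g κ θ) (hη : MemL2 g κ η) :
    l2Inner g κ θ η ^ 2 ≤ l2Inner g κ θ θ * l2Inner g κ η η := by
  have h := discrim_le_zero (a := l2Inner g κ η η) (b := 2 * l2Inner g κ θ η)
    (c := l2Inner g κ θ θ) fun r => by
      have := l2Inner_nonneg (g := g) (κ := κ) (θ + r • η)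
      rw [hθ.l2Inner_add_smul_self hη] at this
      linarith
  rw [discrim] at h
  linarith

theorem MemL2.l2Inner_add_self_le {θ η : KForm M n K p} (hθ : MemL2 g κ θ) (hη : MemL2 g κ η) :
    l2Inner g κ (θ + η) (θ + η) ≤ 2 * l2Inner g κ θ θ + 2 * l2Inner g κ η η := by
  have h1 := hθ.l2Inner_add_smul_self hη 1
  have h2 := hθ.l2Inner_add_smul_self hη (-1)
  have h3 := l2Inner_nonneg (g := g) (κ := κ) (θ + (-1 : ℝ) • η)
  rw [one_smul] at h1
  linarith

theorem MemL2.l2Inner_sub_self_le {θ η : KForm M n K p} (hθ : MemL2 g κ θ) (hη : MemL2 g κ η) :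
    l2Inner g κ (θ - η) (θ - η) ≤ 2 * l2Inner g κ θ θ + 2 * l2Inner g κ η η := by
  have h1 := hθ.l2Inner_add_smul_self hη 1
  have h2 := hθ.l2Inner_add_smul_self hη (-1)
  have h3 := l2Inner_nonneg (g := g) (κ := κ) (θ + (1 : ℝ) • η)
  rw [show θ - η = θ + (-1 : ℝ) • η by simp [sub_eq_add_neg]]
  linarith

theorem MemL2.l2Inner_eq_toReal {θ : KForm M n K p} (hθ : MemL2 g κ θ) :
    l2Inner g κ θ θ = (l2NormSq g κ θ).toReal := by
  rw [hθ.l2NormSq_eq, ENNReal.toReal_ofReal (l2Inner_nonneg θ)]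

/-- The difference quotient of a curve of forms, minus its proposed limit. -/
def quotientError (A : ℝ → KForm M n K p) (A' : KForm M n K p) (t h : ℝ) : KForm M n K p :=
  h⁻¹ • (A (t + h) - A t) - A'

theorem eventually_memL2_add {A : ℝ → KForm M n K p} {t : ℝ} (hA : ∀ᶠ s in 𝓝 t, MemL2 g κ (A s)) :
    ∀ᶠ h in 𝓝[≠] (0 : ℝ), MemL2 g κ (A (t + h)) := by
  have h1 : Filter.Tendsto (fun h : ℝ => t + h) (𝓝[≠] 0) (𝓝 t) := by
    have : Filter.Tendsto (fun h : ℝ => t + h) (𝓝 0) (𝓝 (t + 0)) :=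
      (continuous_const.add continuous_id).tendsto 0
    rw [add_zero] at this
    exact this.mono_left nhdsWithin_le_nhds
  exact h1.eventually hA

theorem eventually_memL2_quotientError {A : ℝ → KForm M n K p} {A' : KForm M n K p} {t : ℝ}
    (hA' : MemL2 g κ A') (hA : ∀ᶠ s in 𝓝 t, MemL2 g κ (A s)) :
    ∀ᶠ h in 𝓝[≠] (0 : ℝ), MemL2 g κ (quotientError A A' t h) := by
  filter_upwards [eventually_memL2_add hA] with h hh
  exact ((hh.sub hA.self_of_nhds).smul _).sub hA'

theorem HasL2Deriv.tendsto_quotientError {A : ℝ → KForm M n K 1} {A' : KForm M n K 1} {t : ℝ}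
    (h : HasL2Deriv g κ A A' t) (hA : ∀ᶠ s in 𝓝 t, MemL2 g κ (A s)) :
    Filter.Tendsto (fun h => l2Inner g κ (quotientError A A' t h) (quotientError A A' t h))
      (𝓝[≠] 0) (𝓝 0) := by
  have h1 := (ENNReal.tendsto_toReal ENNReal.zero_ne_top).comp h.2
  refine Filter.Tendsto.congr' ?_ h1
  filter_upwards [eventually_memL2_quotientError h.1 hA] with s hs
  exact hs.l2Inner_eq_toReal.symm

/-- The difference of two `L²` differentiable curves is `L²` differentiable. -/
theorem HasL2Deriv.tendsto_quotientError_sub {A₁ A₂ : ℝ → KForm M n K 1} {A₁' A₂' : KForm M n K 1}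
    {t : ℝ} (h₁ : HasL2Deriv g κ A₁ A₁' t) (h₂ : HasL2Deriv g κ A₂ A₂' t)
    (hA₁ : ∀ᶠ s in 𝓝 t, MemL2 g κ (A₁ s)) (hA₂ : ∀ᶠ s in 𝓝 t, MemL2 g κ (A₂ s)) :
    Filter.Tendsto (fun h => l2Inner g κ (quotientError (A₁ - A₂) (A₁' - A₂') t h)
      (quotientError (A₁ - A₂) (A₁' - A₂') t h)) (𝓝[≠] 0) (𝓝 0) := by
  have hlim := ((h₁.tendsto_quotientError hA₁).const_mul 2).add
    ((h₂.tendsto_quotientError hA₂).const_mul 2)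
  simp only [mul_zero, add_zero] at hlim
  refine tendsto_of_tendsto_of_tendsto_of_le_of_le' tendsto_const_nhds hlim
    (Filter.Eventually.of_forall fun h => l2Inner_nonneg _) ?_
  filter_upwards [eventually_memL2_quotientError h₁.1 hA₁,
    eventually_memL2_quotientError h₂.1 hA₂] with h e1 e2
  have e3 : quotientError (A₁ - A₂) (A₁' - A₂') t h
      = quotientError A₁ A₁' t h - quotientError A₂ A₂' t h := by
    unfold quotientError
    simp only [Pi.sub_apply]
    module
  rw [e3]
  exact e1.l2Inner_sub_self_le e2

/-- The squared norm of a differentiable curve of forms is differentiable: with the error `R` of the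
difference quotient, `A (t + h) = A t + h (A' + R)`, and the square is expanded. -/
theorem hasDerivAt_l2Inner {A : ℝ → KForm M n K p} {A' : KForm M n K p} {t : ℝ}
    (hA' : MemL2 g κ A') (hA : ∀ᶠ s in 𝓝 t, MemL2 g κ (A s))
    (hr : Filter.Tendsto (fun h => l2Inner g κ (quotientError A A' t h) (quotientError A A' t h))
      (𝓝[≠] 0) (𝓝 0)) :
    HasDerivAt (fun s => l2Inner g κ (A s) (A s)) (2 * l2Inner g κ A' (A t)) t := by
  have hAt := hA.self_of_nhds
  rw [hasDerivAt_iff_tendsto_slope_zero]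
  have hid : Filter.Tendsto (fun h : ℝ => |h|) (𝓝[≠] 0) (𝓝 0) := by
    have : Filter.Tendsto (fun h : ℝ => |h|) (𝓝 0) (𝓝 |0|) := continuous_abs.tendsto 0
    rw [abs_zero] at this
    exact this.mono_left nhdsWithin_le_nhds
  have hbound : Filter.Tendsto (fun h =>
      2 * √(l2Inner g κ (quotientError A A' t h) (quotientError A A' t h) * l2Inner g κ (A t) (A t))
      + |h| * (2 * l2Inner g κ A' A'
        + 2 * l2Inner g κ (quotientError A A' t h) (quotientError A A' t h))) (𝓝[≠] 0) (𝓝 0) := by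
    have h1 := ((Real.continuous_sqrt.tendsto _).comp
      (hr.mul_const (l2Inner g κ (A t) (A t)))).const_mul 2
    have h2 := hid.mul ((hr.const_mul 2).const_add (2 * l2Inner g κ A' A'))
    have h3 := h1.add h2
    simpa using h3
  rw [tendsto_iff_dist_tendsto_zero]
  refine tendsto_of_tendsto_of_tendsto_of_le_of_le' tendsto_const_nhds hbound
    (Filter.Eventually.of_forall fun h => dist_nonneg) ?_
  filter_upwards [eventually_memL2_quotientError hA' hA, self_mem_nhdsWithin] with h hR hh
  have hh0 : h ≠ 0 := hh
  set R := quotientError A A' t h with hRdef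
  have hS := hA'.add hR
  have e1 : A (t + h) = A t + h • (A' + R) := by
    rw [hRdef]
    unfold quotientError
    rw [add_sub_cancel, smul_smul, mul_inv_cancel₀ hh0, one_smul, add_sub_cancel]
  have e2 : h⁻¹ • (l2Inner g κ (A (t + h)) (A (t + h)) - l2Inner g κ (A t) (A t))
      - 2 * l2Inner g κ A' (A t)
      = 2 * l2Inner g κ R (A t) + h * l2Inner g κ (A' + R) (A' + R) := by
    rw [e1, hAt.l2Inner_add_smul_self hS, l2Inner_comm (A t) (A' + R), hA'.l2Inner_add_left hR hAt, smul_eq_mul]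
    field_simp
    ring
  rw [Real.dist_eq, e2]
  refine (abs_add_le _ _).trans (add_le_add ?_ ?_)
  · rw [abs_mul, abs_two]
    exact mul_le_mul_of_nonneg_left (Real.abs_le_sqrt (hR.l2Inner_sq_le hAt)) zero_le_two
  · rw [abs_mul, abs_of_nonneg (l2Inner_nonneg _)]
    exact mul_le_mul_of_nonneg_left (hA'.l2Inner_add_self_le hR) (abs_nonneg _)

end L2Derivative

/-! ### Gronwall's inequality with an integrable singularity -/

section Gronwall

/-- If `f' ≤ k s^{-3/4} f` on `(0, t]` and `f (0) = 0` then `f t ≤ 0`, since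
`f(s) exp (-4 k s^{1/4})` is decreasing. -/
theorem nonpos_of_deriv_le_rpow_mul {f : ℝ → ℝ} {t k : ℝ} (ht : 0 < t) (h0 : f 0 = 0)
    (hc : ContinuousWithinAt f (Set.Icc 0 t) 0)
    (hd : ∀ s ∈ Set.Ioc 0 t, ∃ f', HasDerivAt f f' s ∧ f' ≤ k * s ^ (-(3 / 4) : ℝ) * f s) :
    f t ≤ 0 := by
  have hpow : ∀ s : ℝ, 0 < s → HasDerivAt (fun s : ℝ => Real.exp (-(4 * k * s ^ (1 / 4 : ℝ))))
      (Real.exp (-(4 * k * s ^ (1 / 4 : ℝ))) * (-(k * s ^ (-(3 / 4) : ℝ)))) s := by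
    intro s hs
    have h1 := ((Real.hasDerivAt_rpow_const (x := s) (p := 1 / 4) (Or.inl hs.ne')).const_mul
      (4 * k)).neg.exp
    convert h1 using 1
    simp only [Pi.neg_apply]
    norm_num
    ring
  have hanti : AntitoneOn (fun s => f s * Real.exp (-(4 * k * s ^ (1 / 4 : ℝ)))) (Set.Icc 0 t) := by
    refine antitoneOn_of_deriv_nonpos (convex_Icc 0 t) ?_ ?_ ?_
    · refine ContinuousOn.mul (fun s hs => ?_) ?_
      · rcases hs.1.eq_or_lt with h | h
        · rw [← h]; exact hc
        · obtain ⟨f', hf', -⟩ := hd s ⟨h, hs.2⟩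
          exact hf'.continuousAt.continuousWithinAt
      · refine Continuous.continuousOn ?_
        have : Continuous fun s : ℝ => s ^ (1 / 4 : ℝ) := Real.continuous_rpow_const (by norm_num)
        fun_prop
    · intro s hs
      rw [interior_Icc] at hs
      obtain ⟨f', hf', -⟩ := hd s ⟨hs.1, hs.2.le⟩
      exact (hf'.mul (hpow s hs.1)).differentiableAt.differentiableWithinAt
    · intro s hs
      rw [interior_Icc] at hs
      obtain ⟨f', hf', hle⟩ := hd s ⟨hs.1, hs.2.le⟩
      have := (hf'.mul (hpow s hs.1)).deriv
      rw [show (fun s => f s * Real.exp (-(4 * k * s ^ (1 / 4 : ℝ))))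
        = f * fun s => Real.exp (-(4 * k * s ^ (1 / 4 : ℝ))) from rfl, this]
      have he := Real.exp_pos (-(4 * k * s ^ (1 / 4 : ℝ)))
      nlinarith
  have h1 := hanti (Set.left_mem_Icc.2 ht.le) (Set.right_mem_Icc.2 ht.le) ht.le
  simp only [h0, zero_mul] at h1
  have he := Real.exp_pos (-(4 * k * t ^ (1 / 4 : ℝ)))
  by_contra hneg
  push Not at hneg
  nlinarith [mul_pos hneg he]

end Gronwall

/-! ### Uniqueness -/

section Uniqueness

variable {M : Type*} [TopologicalSpace M] [ChartedSpace (EuclideanHalfSpace 3) M]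
  [IsManifold (𝓡∂ 3) ∞ M] [T2Space M] [MeasurableSpace M] [BorelSpace M] [CompactSpace M]
  {n : ℕ} {K : Type*} [TopologicalSpace K] [ChartedSpace (EuclideanSpace ℝ (Fin n)) K] [Group K]
  [LieGroup (𝓡 n) ∞ K]
  {g : SmoothMetric M} {κ : AdInvariantInner n K} {T : EReal}

/-- The bounds on the curvature of a strong solution combine to `‖B (s)‖_∞ ≤ C s^{-3/4}` on every
interval `(0, t]`. -/
theorem IsStrongSolution.exists_supNorm_le {A : ℝ → KForm M n K 1} {B : ℝ → KForm M n K 2}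
    (h : IsStrongSolution g κ T A B) {t : ℝ} (ht : 0 < t) (htT : (t : EReal) < T) :
    ∃ C : ℝ, 0 ≤ C ∧ ∀ s ∈ Set.Ioc 0 t,
      supNorm g κ (B s) ≤ ENNReal.ofReal (C * s ^ (-(3 / 4) : ℝ)) := by
  obtain ⟨b, hb, hbT, C₁, hC₁⟩ := h.bounded_zero
  -- The bound near `0` holds on `(0, b)`; the other one, on `[b, b')`, has to include the time `t`,
  -- whence `t < b' < T`.
  obtain ⟨b', hb', hb'T⟩ := EReal.lt_iff_exists_real_btwn.1 htT
  obtain ⟨C₂, hC₂⟩ := h.bounded b b' hb hb'T.le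
  have htb' : t < b' := by exact_mod_cast hb'
  refine ⟨C₁ + C₂ * t ^ (3 / 4 : ℝ), by positivity, fun s hs => ?_⟩
  have hs0 : 0 < s ^ (3 / 4 : ℝ) := Real.rpow_pos_of_pos hs.1 _
  have hinv : s ^ (-(3 / 4) : ℝ) = (s ^ (3 / 4 : ℝ))⁻¹ := Real.rpow_neg hs.1.le _
  rcases lt_or_ge s b with hsb | hsb
  · have h1 := hC₁ s ⟨hs.1, hsb⟩
    have h2 : supNorm g κ (B s) ≤ (C₁ : ℝ≥0∞) / ENNReal.ofReal (s ^ (3 / 4 : ℝ)) := by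
      rw [ENNReal.le_div_iff_mul_le (Or.inl (by simpa using hs0)) (Or.inl ENNReal.ofReal_ne_top),
        mul_comm]
      exact h1
    refine h2.trans ?_
    rw [← ENNReal.ofReal_coe_nnreal, ← ENNReal.ofReal_div_of_pos hs0, hinv, div_eq_mul_inv]
    apply ENNReal.ofReal_le_ofReal
    have : 0 ≤ (C₂ : ℝ) * t ^ (3 / 4 : ℝ) := by positivity
    exact mul_le_mul_of_nonneg_right (by linarith) (inv_nonneg.2 hs0.le)
  · have h1 := hC₂ s ⟨hsb, hs.2.trans_lt htb'⟩
    refine h1.trans ?_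
    rw [← ENNReal.ofReal_coe_nnreal, hinv]
    apply ENNReal.ofReal_le_ofReal
    have h3 : s ^ (3 / 4 : ℝ) ≤ t ^ (3 / 4 : ℝ) := Real.rpow_le_rpow hs.1.le hs.2 (by norm_num)
    rw [← div_eq_mul_inv, le_div_iff₀ hs0]
    have h4 : (C₂ : ℝ) * s ^ (3 / 4 : ℝ) ≤ C₂ * t ^ (3 / 4 : ℝ) :=
      mul_le_mul_of_nonneg_left h3 C₂.2
    have h5 : (0 : ℝ) ≤ C₁ := C₁.2
    linarith

/-- Near a positive time below `T` the solution is square integrable. -/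
theorem IsStrongSolution.eventually_memL2 {A : ℝ → KForm M n K 1} {B : ℝ → KForm M n K 2}
    (h : IsStrongSolution g κ T A B) {t : ℝ} (ht : 0 < t) (htT : (t : EReal) < T) :
    ∀ᶠ s in 𝓝 t, MemL2 g κ (A s) := by
  obtain ⟨b, hb, hbT⟩ := EReal.lt_iff_exists_real_btwn.1 htT
  have htb : t < b := by exact_mod_cast hb
  filter_upwards [Ioo_mem_nhds ht htb] with s hs
  refine (h.memW1 s hs.1.le (lt_trans ?_ hbT)).memL2
  exact_mod_cast hs.2

/-- The energy inequality for the difference of two solutions. -/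
theorem IsStrongSolution.exists_hasDerivAt_le {A₁ A₂ : ℝ → KForm M n K 1}
    {B₁ B₂ : ℝ → KForm M n K 2} (h₁ : IsStrongSolution g κ T A₁ B₁)
    (h₂ : IsStrongSolution g κ T A₂ B₂) {Cw : ℝ} (hCw0 : 0 ≤ Cw)
    (hCw : ∀ (x : M) (u v : (TangentSpace (𝓡∂ 3) x) [⋀^Fin 1]→ₗ[ℝ] GroupLieAlgebra (𝓡 n) K),
      covInner g κ x (bracketWedge u v) (bracketWedge u v)
        ≤ Cw * (covInner g κ x u u * covInner g κ x v v))
    {t : ℝ} (ht : 0 < t) (htT : (t : EReal) < T)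
    (hbd : (NormZero g (B₁ t) ∧ NormZero g (B₂ t)) ∨ (TanZero (A₁ t) ∧ TanZero (A₂ t)))
    {C₁ C₂ : ℝ} (hC₁ : 0 ≤ C₁) (hC₂ : 0 ≤ C₂) (hB₁ : supNorm g κ (B₁ t) ≤ ENNReal.ofReal C₁)
    (hB₂ : supNorm g κ (B₂ t) ≤ ENNReal.ofReal C₂) :
    ∃ f', HasDerivAt (fun s => l2Inner g κ ((A₁ - A₂) s) ((A₁ - A₂) s)) f' t ∧
      f' ≤ 2 * ((C₁ + C₂) * √Cw) * l2Inner g κ ((A₁ - A₂) t) ((A₁ - A₂) t) := by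
  obtain ⟨A₁', hd₁, he₁⟩ := h₁.equation t ht htT
  obtain ⟨A₂', hd₂, he₂⟩ := h₂.equation t ht htT
  have hm₁ := h₁.eventually_memL2 ht htT
  have hm₂ := h₂.eventually_memL2 ht htT
  have hD : ∀ᶠ s in 𝓝 t, MemL2 g κ ((A₁ - A₂) s) := by
    filter_upwards [hm₁, hm₂] with s e1 e2
    exact e1.sub e2
  have hDt := hD.self_of_nhds
  refine ⟨_, hasDerivAt_l2Inner (hd₁.1.sub hd₂.1) hD
    (hd₁.tendsto_quotientError_sub hd₂ hm₁ hm₂), ?_⟩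
  obtain ⟨P, hP⟩ := (h₁.memW1 t ht.le htT).exists_hasWeakPartials_sub (h₂.memW1 t ht.le htT)
    (h₁.curvature t ht htT) (h₂.curvature t ht htT)
  have hbd' : (NormZero g (B₁ t) ∧ NormZero g (B₂ t)) ∨ TanZero (A₁ t - A₂ t) :=
    hbd.imp_right fun h => h.1.sub hm₁.self_of_nhds.1 h.2
  have hb₁ := covInner_le_of_supNorm_le hC₁ hB₁
  have hb₂ := covInner_le_of_supNorm_le hC₂ hB₂
  obtain ⟨hi₁, hg₁⟩ := he₁.green hd₁.1 hP hDt hb₁ (hbd'.imp_left And.left)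
  obtain ⟨hi₂, hg₂⟩ := he₂.green hd₂.1 hP hDt hb₂ (hbd'.imp_left And.right)
  rw [mul_assoc]
  refine mul_le_mul_of_nonneg_left ?_ zero_le_two
  -- Both pairings `(A_j', D)` are rewritten by Green's formula and compared pointwise.
  rw [hd₁.1.l2Inner_sub_left hd₂.1 hDt]
  have e1 : (A₁ - A₂) t = A₁ t - A₂ t := rfl
  have e5 := integral_add hi₁.neg hi₂
  simp only [Pi.neg_apply] at e5
  rw [e1, hg₁, hg₂, sub_neg_eq_add, ← integral_neg, ← e5]
  unfold l2Inner
  rw [← integral_const_mul]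
  refine integral_mono_ae (hi₁.neg.add hi₂) (hDt.integrable_self.const_mul _) ?_
  filter_upwards [hb₁, hb₂] with x e2 e3
  exact energyDensity_le g κ (hCw x) hCw0 _ _ _ _ _ rfl hC₁ hC₂ e2 e3

/-- The distance of two solutions with the same initial data is continuous at the initial time. -/
theorem IsStrongSolution.continuousWithinAt_zero {A₁ A₂ : ℝ → KForm M n K 1}
    {B₁ B₂ : ℝ → KForm M n K 2} (h₁ : IsStrongSolution g κ T A₁ B₁)
    (h₂ : IsStrongSolution g κ T A₂ B₂) (h0 : SameForm g (A₁ 0) (A₂ 0)) {t : ℝ} (ht : 0 ≤ t)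
    (htT : (t : EReal) < T) :
    ContinuousWithinAt (fun s => l2Inner g κ ((A₁ - A₂) s) ((A₁ - A₂) s)) (Set.Icc 0 t) 0 ∧
      l2Inner g κ ((A₁ - A₂) 0) ((A₁ - A₂) 0) = 0 := by
  have hT : ((0 : ℝ) : EReal) < T := lt_of_le_of_lt (by exact_mod_cast ht) htT
  have hz : l2Inner g κ ((A₁ - A₂) 0) ((A₁ - A₂) 0) = 0 := by
    unfold l2Inner
    rw [integral_eq_zero_of_ae]
    filter_upwards [h0] with x hx
    have : (A₁ - A₂) 0 x = 0 := sub_eq_zero.2 hx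
    rw [this, ← covForm_apply, map_zero]
    rfl
  refine ⟨?_, hz⟩
  have hsub : Set.Icc 0 t ⊆ {s : ℝ | 0 ≤ s ∧ (s : EReal) < T} := fun s hs =>
    ⟨hs.1, lt_of_le_of_lt (by exact_mod_cast hs.2) htT⟩
  have hlim : ∀ {A : ℝ → KForm M n K 1} {B : ℝ → KForm M n K 2}, IsStrongSolution g κ T A B →
      Filter.Tendsto (fun s => l2Inner g κ (A s - A 0) (A s - A 0)) (𝓝[Set.Icc 0 t] 0) (𝓝 0) := by
    intro A B h
    have e1 := (h.continuous 0 le_rfl hT).mono_left (nhdsWithin_mono 0 hsub)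
    have e2 : Filter.Tendsto (fun s => l2NormSq g κ (A s - A 0)) (𝓝[Set.Icc 0 t] 0) (𝓝 0) :=
      tendsto_of_tendsto_of_tendsto_of_le_of_le tendsto_const_nhds e1 (fun _ => zero_le)
        fun s => l2NormSq_le_sobolevNormSq _
    refine Filter.Tendsto.congr' ?_ ((ENNReal.tendsto_toReal ENNReal.zero_ne_top).comp e2)
    filter_upwards [self_mem_nhdsWithin] with s hs
    exact (((h.memW1 s hs.1 (hsub hs).2).memL2.sub
      (h.memW1 0 le_rfl hT).memL2).l2Inner_eq_toReal).symm
  have hsum := ((hlim h₁).const_mul 2).add ((hlim h₂).const_mul 2)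
  simp only [mul_zero, add_zero] at hsum
  rw [ContinuousWithinAt, hz]
  refine tendsto_of_tendsto_of_tendsto_of_le_of_le' tendsto_const_nhds hsum
    (Filter.Eventually.of_forall fun s => l2Inner_nonneg _) ?_
  filter_upwards [self_mem_nhdsWithin] with s hs
  have m₁ := (h₁.memW1 s hs.1 (hsub hs).2).memL2.sub (h₁.memW1 0 le_rfl hT).memL2
  have m₂ := (h₂.memW1 s hs.1 (hsub hs).2).memL2.sub (h₂.memW1 0 le_rfl hT).memL2
  -- the initial values agree almost everywhere
  have e1 : l2Inner g κ ((A₁ - A₂) s) ((A₁ - A₂) s)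
      = l2Inner g κ ((A₁ s - A₁ 0) - (A₂ s - A₂ 0)) ((A₁ s - A₁ 0) - (A₂ s - A₂ 0)) := by
    refine integral_congr_ae ?_
    filter_upwards [h0] with x hx
    have : (A₁ - A₂) s x = ((A₁ s - A₁ 0) - (A₂ s - A₂ 0)) x := by
      simp only [Pi.sub_apply, hx]
      abel
    simp only [this]
  rw [e1]
  exact m₁.l2Inner_sub_self_le m₂

end Uniqueness

end YangMillsHeat

end

open scoped Manifold ContDiff in
theorem theorem9p12
    {M : Type*} [TopologicalSpace M] [CompactSpace M] [T2Space M]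
    [ChartedSpace (EuclideanHalfSpace 3) M] [IsManifold (𝓡∂ 3) ∞ M]
    [MeasurableSpace M] [BorelSpace M]
    (g : YangMillsHeat.SmoothMetric M)
    {n : ℕ} {K : Type*} [TopologicalSpace K] [CompactSpace K] [ConnectedSpace K] [T2Space K]
    [ChartedSpace (EuclideanSpace ℝ (Fin n)) K] [Group K] [LieGroup (𝓡 n) ∞ K]
    (κ : YangMillsHeat.AdInvariantInner n K)
    (T : EReal) (hT : 0 < T)
    (A₁ A₂ : ℝ → YangMillsHeat.KForm M n K 1) (B₁ B₂ : ℝ → YangMillsHeat.KForm M n K 2)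
    (h₁ : YangMillsHeat.IsStrongSolution g κ T A₁ B₁)
    (h₂ : YangMillsHeat.IsStrongSolution g κ T A₂ B₂)
    (h_init : YangMillsHeat.SameForm g (A₁ 0) (A₂ 0))
    (h_bdry :
      (∀ t : ℝ, 0 < t → (t : EReal) < T →
        YangMillsHeat.NormZero g (B₁ t) ∧ YangMillsHeat.NormZero g (B₂ t)) ∨
      (∀ t : ℝ, 0 < t → (t : EReal) < T →
        YangMillsHeat.TanZero (A₁ t) ∧ YangMillsHeat.TanZero (A₂ t))) :
    ∀ t : ℝ, 0 ≤ t → (t : EReal) < T → YangMillsHeat.SameForm g (A₁ t) (A₂ t) := by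
  intro t ht htT
  rcases ht.eq_or_lt with rfl | ht
  · exact h_init
  obtain ⟨Cw, hCw0, hCw⟩ := YangMillsHeat.exists_bracketWedge_bound g κ
  obtain ⟨C₁, hC₁, hB₁⟩ := h₁.exists_supNorm_le ht htT
  obtain ⟨C₂, hC₂, hB₂⟩ := h₂.exists_supNorm_le ht htT
  obtain ⟨hcont, hzero⟩ := h₁.continuousWithinAt_zero h₂ h_init ht.le htT
  have hle : YangMillsHeat.l2Inner g κ ((A₁ - A₂) t) ((A₁ - A₂) t) ≤ 0 := by
    refine YangMillsHeat.nonpos_of_deriv_le_rpow_mul (k := 2 * ((C₁ + C₂) * √Cw))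
      (f := fun s => YangMillsHeat.l2Inner g κ ((A₁ - A₂) s) ((A₁ - A₂) s)) ht hzero hcont
      fun s hs => ?_
    have hsT : (s : EReal) < T := lt_of_le_of_lt (by exact_mod_cast hs.2) htT
    have hs0 : 0 ≤ s ^ (-(3 / 4) : ℝ) := Real.rpow_nonneg hs.1.le _
    obtain ⟨f', hf', hf'le⟩ := h₁.exists_hasDerivAt_le h₂ hCw0 hCw hs.1 hsT
      (h_bdry.imp (fun h => h s hs.1 hsT) (fun h => h s hs.1 hsT))
      (mul_nonneg hC₁ hs0) (mul_nonneg hC₂ hs0) (hB₁ s hs) (hB₂ s hs)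
    refine ⟨f', hf', hf'le.trans_eq ?_⟩
    ring
  have hmem := (h₁.memW1 t ht.le htT).memL2.sub (h₂.memW1 t ht.le htT).memL2
  have h0 := YangMillsHeat.sameForm_zero_of_l2Inner hmem
    (le_antisymm hle (YangMillsHeat.l2Inner_nonneg _))
  filter_upwards [h0] with x hx
  exact sub_eq_zero.1 hx
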